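/- Let $\mathbb F$ be a field. A tower of algebras over $\mathbb F$ is a graded associative unital algebra $A=\bigoplus_{n\ge 0}A_n$ with external multiplications $\rho_{m,n}\colon A_m\otimes A_n\to A_{m+n}$ such that each $A_n$ is itself a finite-dimensional unital $\mathbb F$-algebra (with another multiplication), $A_0\cong\mathbb F$, each $\rho_{m,n}$ is a homomorphism of unital algebras, $A_{m+n}$ is projective both as a left and as a right $(A_m\otimes A_n)$-module via $\rho_{m,n}$, and for each $n$ the pairing $K_0(A_n)\times G_0(A_n)\to\mathbb Z$, $\langle[P],[M]\rangle=\dim_{\mathbb F}\operatorname{Hom}_{A_n}(P,M)$, is perfect. Here $G_0(B)$ and $K_0(B)$ are the Grothendieck groups of the categories $B\text{-mod}$ and $B\text{-pmod}$ of finitely generated, respectively finitely generated projective, left $B$-modules. Put $A\text{-mod}=\bigoplus_n A_n\text{-mod}$, $A\text{-pmod}=\bigoplus_n A_n\text{-pmod}$ and, for $r=2,4$, $A\text{-mod}^{\otimes r}=\bigoplus_{n_1,\dots,n_r}(A_{n_1}\otimes\cdots\otimes A_{n_r})\text{-mod}$. Let $\nabla\colon A\text{-mod}^{\otimes2}\to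 A\text{-mod}$ be given by the inductions $\operatorname{Ind}_{A_m\otimes A_n}^{A_{m+n}}$, let $\Delta\colon A\text{-mod}\to A\text{-mod}^{\otimes2}$ be given on $A_n\text{-mod}$ by $\bigoplus_{k+l=n}\operatorname{Res}^{A_n}_{A_k\otimes A_l}$, and let $S_{23}$ interchange the second and third tensor factors. Given algebra automorphisms $\psi_n$ of $A_n$ ($n\ge0$), let $\Psi$ be the automorphism of $A\text{-mod}$ that twists the actions by them. Assume that $A$ is strong with conjugation $\Psi$: $\nabla$ is right adjoint to $\Psi^{\otimes2}\Delta\Psi^{-1}$, and $\Delta\nabla\cong\nabla^{\otimes2}S_{23}\Delta^{\otimes2}$ as functors. For $M\in A_m\text{-mod}$ and $N\in A_n\text{-mod}$ let $\operatorname{Ind}_M(N)=\operatorname{Ind}_{A_m\otimes A_n}^{A_{m+n}}(M\otimes N)$. For $P\in A_p\text{-pmod}$ let $\operatorname{Res}_P(N)=\operatorname{Hom}_{A_p}(P,\operatorname{Res}^{A_n}_{A_{n-p}\otimes A_p}N)$, which is $0$ if $p>n$. For $Q\in(A_p\otimes A_q)\text{-mod}$ let $$\operatorname{Res}_Q(M\otimes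 N)=\operatorname{Hom}_{A_p\otimes A_q}\bigl(Q,S_{23}(\operatorname{Res}^{A_m}_{A_{m-p}\otimes A_p}M\otimes\operatorname{Res}^{A_n}_{A_{n-q}\otimes A_q}N)\bigr).$$ Extend all of these additively to direct sums. Then for all $M,N\in A\text{-mod}$ and $P,Q\in A\text{-pmod}$ there are isomorphisms of endofunctors of $A\text{-mod}$ $$\operatorname{Ind}_M\circ\operatorname{Ind}_N\cong\operatorname{Ind}_{\nabla(M\otimes N)},\qquad \operatorname{Res}_P\circ\operatorname{Res}_Q\cong\operatorname{Res}_{\nabla(P\otimes Q)},\qquad \operatorname{Res}_P\circ\operatorname{Ind}_M\cong\nabla\operatorname{Res}_{\Psi^{\otimes2}\Delta\Psi^{-1}(P)}(M\otimes-).$$ Suppose moreover that $A$ is dualizing: with the operations induced by $\nabla$, $\Delta$, the unit $[A_0]$ and the counit $[V]\mapsto\dim_{\mathbb F}V$ in degree $0$ (and $0$ in positive degrees), $\mathcal G(A)=\bigoplus_nG_0(A_n)$ and $\mathcal K(A)=\bigoplus_nK_0(A_n)$ are graded connected Hopf algebras over $\mathbb Z$, graded dual to each other under the Hopf pairing $\langle\cdot,\cdot\rangle$.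 Let $\mathfrak h(A)=\mathcal G(A)\#\mathcal K(A)$ be the Heisenberg double, with $(a\#x)(b\#y)=\sum aR_{x_{(1)}}^*(b)\#x_{(2)}y$, where $R_x^*$ is the adjoint of right multiplication by $x\in\mathcal K(A)$; it acts on the Fock space $\mathcal F(A)=\mathcal G(A)$ by $(a\#x)(b)=aR_x^*(b)$. Let $\mathcal F_{\rm proj}(A)=\mathcal G_{\rm proj}(A)$ be the image of the Cartan map $\mathcal K(A)\to\mathcal G(A)$ and let $\mathfrak h_{\rm proj}(A)=\mathcal G_{\rm proj}(A)\#\mathcal K(A)$. Then the functors above categorify the representation $\mathcal F(A)$ of $\mathfrak h(A)$, that is: (i) $\mathcal F(A)$ is a representation of $\mathfrak h(A)$, and $\operatorname{Ind}_M$, $\operatorname{Res}_P$ and $\operatorname{Ind}_M\circ\operatorname{Res}_P$ induce on $\mathcal G(A)$ the actions of $[M]$, $[P]$ and $[M]\#[P]$; (ii) the first two isomorphisms above lift the multiplications $[M][N]=[\nabla(M\otimes N)]$ of $\mathcal G(A)$ and $[P][Q]=[\nabla(P\otimes Q)]$ of $\mathcal K(A)$; (iii) there are isomorphisms $\operatorname{Res}_P\circ\operatorname{Ind}_M\cong\nabla\operatorname{Res}_{\Delta(P)}(M\otimes-)$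 lifting the relation $R_x^*(ab)=\nabla\bigl(R_{\Delta(x)}^*(a\otimes b)\bigr)$ for $x=[P]$, $a=[M]$, where $[\Delta(P)]=\Delta([P])$ and the right-hand functor induces $b\mapsto\nabla(R_{\Delta(x)}^*(a\otimes b))$. Likewise, $\mathfrak h_{\rm proj}(A)$ is a subalgebra of $\mathfrak h(A)$ that preserves $\mathcal F_{\rm proj}(A)$; for $M,P\in A\text{-pmod}$ the functors $\operatorname{Ind}_M$, $\operatorname{Res}_P$ and $\nabla\operatorname{Res}_{\Delta(P)}(M\otimes-)$ preserve $A\text{-pmod}$; their restrictions induce the action of $\mathfrak h_{\rm proj}(A)$ on $\mathcal F_{\rm proj}(A)$ and satisfy the same isomorphisms of functors on $A\text{-pmod}$. -/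

import Mathlib

open CategoryTheory TensorProduct DirectSum

universe u

namespace TowerAlg

section Modules

variable {F : Type u} [Field F]
variable {R S B : Type u} [Ring R] [Algebra F R] [Ring S] [Algebra F S] [Ring B] [Algebra F B]

/-- Every module over an `F`-algebra is regarded as an `F`-vector space through `F → B`. -/
noncomputable instance instModuleBase (M : ModuleCat.{u} B) : Module F M :=
  ModuleCat.moduleOfAlgebraModule M

instance instScalarTowerBase (M : ModuleCat.{u} B) : IsScalarTower F B M :=
  ModuleCat.isScalarTower_of_algebra_moduleCat M

/-! ### Restriction and induction along an algebra homomorphism -/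

/-- Restriction along `φ : R → S`. -/
noncomputable abbrev resF (φ : R →ₐ[F] S) : ModuleCat.{u} S ⥤ ModuleCat.{u} R :=
  ModuleCat.restrictScalars φ.toRingHom

/-- The relations `s φ(r) ⊗ n = s ⊗ r n` defining `S ⊗_R N` as a quotient of `S ⊗_F N`. -/
noncomputable def indRel (φ : R →ₐ[F] S) (N : ModuleCat.{u} R) : Submodule S (S ⊗[F] N) :=
  Submodule.span S {x | ∃ (s : S) (r : R) (n : N), x = (s * φ r) ⊗ₜ[F] n - s ⊗ₜ[F] (r • n)}

/-- `S ⊗_R N`, where `S` is a right `R`-module through `φ`. -/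
abbrev IndMod (φ : R →ₐ[F] S) (N : ModuleCat.{u} R) : Type u := (S ⊗[F] N) ⧸ indRel φ N

/-- The map `S ⊗_F N → S ⊗_F N'` induced by `f : N → N'`. -/
noncomputable abbrev preInd (S : Type u) [Ring S] [Algebra F S] {N N' : ModuleCat.{u} R}
    (f : N →ₗ[R] N') : S ⊗[F] N →ₗ[S] S ⊗[F] N' :=
  AlgebraTensorModule.map (LinearMap.id : S →ₗ[S] S) (f.restrictScalars F)

theorem preInd_rel (φ : R →ₐ[F] S) {N N' : ModuleCat.{u} R} (f : N →ₗ[R] N') :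
    indRel φ N ≤ (indRel φ N').comap (preInd S f) := by
  refine Submodule.span_le.2 ?_
  rintro _ ⟨s, r, n, rfl⟩
  exact Submodule.subset_span ⟨s, r, f n, by simp⟩

/-- The class of `s ⊗ n` in `S ⊗_R N`. -/
noncomputable def indTmul (φ : R →ₐ[F] S) {N : ModuleCat.{u} R} (s : S) (n : N) : IndMod φ N :=
  Submodule.Quotient.mk (s ⊗ₜ[F] n)

theorem indTmul_smul (φ : R →ₐ[F] S) {N : ModuleCat.{u} R} (s : S) (r : R) (n : N) :
    indTmul φ s (r • n) = indTmul φ (s * φ r) n :=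
  ((Submodule.Quotient.eq (indRel φ N)).2 (Submodule.subset_span ⟨s, r, n, rfl⟩)).symm

theorem indMod_induction (φ : R →ₐ[F] S) {N : ModuleCat.{u} R} {p : IndMod φ N → Prop}
    (h0 : p 0) (ht : ∀ s n, p (indTmul φ s n)) (ha : ∀ x y, p x → p y → p (x + y)) (x) : p x := by
  obtain ⟨x, rfl⟩ := Submodule.Quotient.mk_surjective _ x
  induction x using TensorProduct.induction_on with
  | zero => exact h0
  | tmul s n => exact ht s n
  | add x y hx hy => exact ha _ _ hx hy

theorem indMod_hom_ext (φ : R →ₐ[F] S) {N : ModuleCat.{u} R} {M : Type*} [AddCommGroup M]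
    {f g : IndMod φ N →+ M} (h : ∀ s n, f (indTmul φ s n) = g (indTmul φ s n)) : f = g := by
  ext x
  refine indMod_induction φ (p := fun x => f x = g x) (by simp) h (fun x y hx hy => ?_) x
  rw [map_add, map_add, hx, hy]

/-- The map `S ⊗_R N → S ⊗_R N'` induced by `f : N → N'`. -/
noncomputable def indMap (φ : R →ₐ[F] S) {N N' : ModuleCat.{u} R} (f : N →ₗ[R] N') :
    IndMod φ N →ₗ[S] IndMod φ N' :=
  Submodule.mapQ _ _ (preInd S f) (preInd_rel φ f)

@[simp] theorem indMap_tmul (φ : R →ₐ[F] S) {N N' : ModuleCat.{u} R} (f : N →ₗ[R] N') (s : S)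
    (n : N) : indMap φ f (indTmul φ s n) = indTmul φ s (f n) := rfl

/-- The induction functor `Ind = S ⊗_R -`. -/
noncomputable def indF (φ : R →ₐ[F] S) : ModuleCat.{u} R ⥤ ModuleCat.{u} S where
  obj N := ModuleCat.of S (IndMod φ N)
  map f := ModuleCat.ofHom (indMap φ f.hom)
  map_id N := by
    refine ModuleCat.hom_ext (LinearMap.toAddMonoidHom_injective (indMod_hom_ext φ ?_))
    intro s n
    rfl
  map_comp f g := by
    refine ModuleCat.hom_ext (LinearMap.toAddMonoidHom_injective (indMod_hom_ext φ ?_))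
    intro s n
    rfl

/-! ### External tensor products -/

/-- The underlying space `M ⊗_F N` of the external tensor product of an `R`-module and an
`S`-module. -/
def ExtTensor (F : Type u) [Field F] {R S : Type u} [Ring R] [Algebra F R] [Ring S] [Algebra F S]
    (M : ModuleCat.{u} R) (N : ModuleCat.{u} S) : Type u := M ⊗[F] N

noncomputable instance (M : ModuleCat.{u} R) (N : ModuleCat.{u} S) :
    AddCommGroup (ExtTensor F M N) := inferInstanceAs (AddCommGroup (M ⊗[F] N))

/-- `R ⊗ S` acts on `M ⊗_F N` by `(r ⊗ s)(m ⊗ n) = r m ⊗ s n`. -/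
noncomputable def extAct (F : Type u) [Field F] {R S : Type u} [Ring R] [Algebra F R] [Ring S]
    [Algebra F S] (M : ModuleCat.{u} R) (N : ModuleCat.{u} S) :
    R ⊗[F] S →ₐ[F] Module.End F (M ⊗[F] N) :=
  (Module.endTensorEndAlgHom (R := F) (S := F) (A := F) (M := M) (N := N)).comp
    (Algebra.TensorProduct.map (Algebra.lsmul F F M) (Algebra.lsmul F F N))

noncomputable instance (M : ModuleCat.{u} R) (N : ModuleCat.{u} S) :
    Module (R ⊗[F] S) (ExtTensor F M N) :=
  Module.compHom (M ⊗[F] N) (extAct F M N).toRingHom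

/-- The element `m ⊗ n`. -/
noncomputable def extTmul (F : Type u) [Field F] {R S : Type u} [Ring R] [Algebra F R] [Ring S] [Algebra F S]
    {M : ModuleCat.{u} R} {N : ModuleCat.{u} S} (m : M) (n : N) : ExtTensor F M N := m ⊗ₜ[F] n

theorem extTensor_induction {M : ModuleCat.{u} R} {N : ModuleCat.{u} S}
    {p : ExtTensor F M N → Prop} (h0 : p 0) (ht : ∀ m n, p (extTmul F m n))
    (ha : ∀ x y, p x → p y → p (x + y)) (x) : p x :=
  TensorProduct.induction_on (motive := p) x h0 ht ha

theorem extTensor_smul_tmul {M : ModuleCat.{u} R} {N : ModuleCat.{u} S} (r : R) (s : S) (m : M)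
    (n : N) : (r ⊗ₜ[F] s : R ⊗[F] S) • extTmul F m n = extTmul F (r • m) (s • n) := rfl

/-- The map `f ⊗ g` of external tensor products, as an additive map. -/
noncomputable def extMapAdd {M M' : ModuleCat.{u} R} {N N' : ModuleCat.{u} S} (f : M →ₗ[R] M')
    (g : N →ₗ[S] N') : ExtTensor F M N →+ ExtTensor F M' N' :=
  (TensorProduct.map (f.restrictScalars F) (g.restrictScalars F)).toAddMonoidHom

theorem extMapAdd_tmul {M M' : ModuleCat.{u} R} {N N' : ModuleCat.{u} S} (f : M →ₗ[R] M')
    (g : N →ₗ[S] N') (m : M) (n : N) :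
    extMapAdd f g (extTmul F m n) = extTmul F (f m) (g n) := rfl

/-- The map `f ⊗ g` of external tensor products. -/
noncomputable def extMap {M M' : ModuleCat.{u} R} {N N' : ModuleCat.{u} S} (f : M →ₗ[R] M')
    (g : N →ₗ[S] N') : ExtTensor F M N →ₗ[R ⊗[F] S] ExtTensor F M' N' where
  toFun := extMapAdd f g
  map_add' := map_add _
  map_smul' a x := by
    rw [RingHom.id_apply]
    induction a using TensorProduct.induction_on with
    | zero => simp
    | add a b ha hb => simp only [add_smul, map_add, ha, hb]
    | tmul r s =>
      refine extTensor_induction (p := fun x => extMapAdd f g ((r ⊗ₜ[F] s) • x) =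
        (r ⊗ₜ[F] s) • extMapAdd f g x) ?_ (fun m n => ?_) (fun x y hx hy => ?_) x
      · simp
      · simp only [extTensor_smul_tmul, extMapAdd_tmul, map_smul]
      · simp only [smul_add, map_add, hx, hy]

@[simp] theorem extMap_tmul {M M' : ModuleCat.{u} R} {N N' : ModuleCat.{u} S} (f : M →ₗ[R] M')
    (g : N →ₗ[S] N') (m : M) (n : N) :
    extMap f g (extTmul F m n) = extTmul F (f m) (g n) := rfl

theorem extTensor_hom_ext {M : ModuleCat.{u} R} {N : ModuleCat.{u} S} {L : Type*} [AddCommGroup L]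
    {f g : ExtTensor F M N →+ L} (h : ∀ m n, f (extTmul F m n) = g (extTmul F m n)) : f = g := by
  ext x
  refine extTensor_induction (p := fun x => f x = g x) (by simp) h (fun x y hx hy => ?_) x
  rw [map_add, map_add, hx, hy]

/-- The functor `M ⊗ -` from `S`-modules to `(R ⊗ S)`-modules. -/
noncomputable def extF (M : ModuleCat.{u} R) : ModuleCat.{u} S ⥤ ModuleCat.{u} (R ⊗[F] S) where
  obj N := ModuleCat.of (R ⊗[F] S) (ExtTensor F M N)
  map g := ModuleCat.ofHom (extMap LinearMap.id g.hom)
  map_id N := by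
    refine ModuleCat.hom_ext (LinearMap.toAddMonoidHom_injective (extTensor_hom_ext ?_))
    intro m n
    rfl
  map_comp f g := by
    refine ModuleCat.hom_ext (LinearMap.toAddMonoidHom_injective (extTensor_hom_ext ?_))
    intro m n
    rfl

/-! ### The functor `Hom_S(P, -)` on `(R ⊗ S)`-modules -/

/-- `Hom_S(P, Y)` for an `S`-module `P` and an `(R ⊗ S)`-module `Y`, on which `S` acts through
`s ↦ 1 ⊗ s`. -/
abbrev PHom (P : ModuleCat.{u} S) (Y : ModuleCat.{u} (R ⊗[F] S)) : Type u :=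
  P →ₛₗ[(Algebra.TensorProduct.includeRight : S →ₐ[F] R ⊗[F] S).toRingHom] Y

/-- The `R`-module structure `(r f)(p) = (r ⊗ 1) f(p)` on `Hom_S(P, Y)`. -/
noncomputable instance instModulePHom (P : ModuleCat.{u} S) (Y : ModuleCat.{u} (R ⊗[F] S)) :
    Module R (PHom P Y) where
  smul r f :=
    { toFun := fun p => (r ⊗ₜ[F] (1 : S)) • f p
      map_add' := by simp
      map_smul' := fun s p => by
        simp only [LinearMap.map_smulₛₗ, smul_smul]
        congr 1
        simp }
  one_smul f := by
    ext p
    exact one_smul (R ⊗[F] S) (f p)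
  mul_smul a b f := by
    ext p
    change ((a * b) ⊗ₜ[F] (1 : S)) • f p = (a ⊗ₜ[F] (1 : S)) • (b ⊗ₜ[F] (1 : S)) • f p
    rw [smul_smul]
    simp
  smul_zero a := by
    ext p
    exact smul_zero _
  smul_add a f g := by
    ext p
    exact smul_add _ _ _
  add_smul a b f := by
    ext p
    change ((a + b) ⊗ₜ[F] (1 : S)) • f p = (a ⊗ₜ[F] (1 : S)) • f p + (b ⊗ₜ[F] (1 : S)) • f p
    rw [TensorProduct.add_tmul, add_smul]
  zero_smul f := by
    ext p
    change ((0 : R) ⊗ₜ[F] (1 : S)) • f p = 0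
    rw [TensorProduct.zero_tmul, zero_smul]

/-- The functor `Hom_S(P, -)` from `(R ⊗ S)`-modules to `R`-modules. -/
noncomputable def homF (P : ModuleCat.{u} S) : ModuleCat.{u} (R ⊗[F] S) ⥤ ModuleCat.{u} R where
  obj Y := ModuleCat.of R (PHom P Y)
  map g := ModuleCat.ofHom
    { toFun := fun f => g.hom.comp f
      map_add' := fun f f' => by
        ext p
        exact map_add g.hom _ _
      map_smul' := fun r f => by
        ext p
        exact map_smul g.hom _ _ }

end Modules

/-! ### Exactness -/

section Exactness

variable {F : Type u} [Field F]
variable {R S B : Type u} [Ring R] [Algebra F R] [Ring S] [Algebra F S] [Ring B] [Algebra F B]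

/-- `0 → X → Y → Z → 0` is a short exact sequence. -/
def IsSES {B : Type u} [Ring B] {X Y Z : ModuleCat.{u} B} (f : X ⟶ Y) (g : Y ⟶ Z) : Prop :=
  Function.Injective f.hom ∧ Function.Exact f.hom g.hom ∧ Function.Surjective g.hom

/-- `S` is projective as a left `R`-module through `φ`. -/
def LeftProjective (φ : R →ₐ[F] S) : Prop :=
  Module.Projective R ((resF φ).obj (ModuleCat.of S S))

/-- `S` is projective as a right `R`-module through `φ`. -/
def RightProjective (φ : R →ₐ[F] S) : Prop :=
  @Module.Projective Rᵐᵒᵖ _ S _ (Module.compHom S (RingHom.op φ.toRingHom))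

theorem RightProjective.exists_dual {φ : R →ₐ[F] S} (h : RightProjective φ) :
    ∃ σ : S →+ (S →₀ R), (∀ s r a, σ (s * φ r) a = σ s a * r) ∧
      ∀ s, (σ s).sum (fun a r => a * φ r) = s := by
  let _ : Module Rᵐᵒᵖ S := Module.compHom S (RingHom.op φ.toRingHom)
  obtain ⟨σ, hσ⟩ := h.out
  refine ⟨(Finsupp.mapRange.addMonoidHom (MulOpposite.opAddEquiv (α := R)).symm.toAddMonoidHom).comp
    σ.toAddMonoidHom, fun s r a => ?_, fun s => ?_⟩
  · have : s * φ r = MulOpposite.op r • s := rfl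
    simp [this]
  · have := hσ s
    rw [Finsupp.linearCombination_apply] at this
    conv_rhs => rw [← this]
    simp only [AddMonoidHom.comp_apply, Finsupp.mapRange.addMonoidHom_apply]
    rw [Finsupp.sum_mapRange_index (by simp)]
    rfl

theorem indMap_injective {φ : R →ₐ[F] S} (h : RightProjective φ) {N N' : ModuleCat.{u} R}
    (f : N →ₗ[R] N') (hf : Function.Injective f) : Function.Injective (indMap φ f) := by
  obtain ⟨σ, hσ, hs⟩ := h.exists_dual
  have hF : ∀ (c : F) s a, σ (c • s) a = c • σ s a := fun c s a => by
    rw [Algebra.smul_def, Algebra.commutes, ← φ.commutes, hσ, Algebra.smul_def, Algebra.commutes]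
  -- the coordinate map `s ⊗ n ↦ (σ s a • n)_a`
  have key : ∀ M : ModuleCat.{u} R, ∃ G : IndMod φ M →+ (S →₀ M),
      ∀ s m a, G (indTmul φ s m) a = σ s a • m := by
    intro M
    let g : S →+ M →+ (S →₀ M) := AddMonoidHom.mk' (fun s => AddMonoidHom.mk'
      (fun m => (σ s).mapRange (fun r => r • m) (by simp)) (by intro m m'; ext a; simp))
      (by intro s s'; ext m a; simp [add_smul])
    have hg : ∀ s m a, g s m a = σ s a • m := fun s m a => by simp [g]
    let G₀ : S ⊗[F] M →+ (S →₀ M) := TensorProduct.liftAddHom g (fun c s m => by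
      ext a
      rw [hg, hg, hF, smul_assoc, smul_comm])
    have hG₀ : ∀ s m a, G₀ (s ⊗ₜ m) a = σ s a • m := fun s m a => hg s m a
    refine ⟨QuotientAddGroup.lift (indRel φ M).toAddSubgroup G₀ ?_, hG₀⟩
    intro x hx
    have : ∀ t : S, G₀ (t • x) = 0 := by
      have hx' : x ∈ indRel φ M := hx
      unfold indRel at hx'
      clear hx
      induction hx' using Submodule.span_induction with
      | zero => simp
      | add x y _ _ h1 h2 => exact fun t => by rw [smul_add, map_add, h1, h2, add_zero]
      | smul t x _ h1 => exact fun t' => by rw [smul_smul]; exact h1 _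
      | mem x hx =>
        obtain ⟨s, r, n, rfl⟩ := hx
        intro t
        ext a
        rw [smul_sub, TensorProduct.smul_tmul', TensorProduct.smul_tmul', smul_eq_mul, smul_eq_mul,
          map_sub, Finsupp.sub_apply, hG₀, hG₀, ← mul_assoc, hσ, mul_smul, sub_self]
        rfl
    simpa using this 1
  obtain ⟨G, hG⟩ := key N
  obtain ⟨G', hG'⟩ := key N'
  let H : (S →₀ N) →+ IndMod φ N := Finsupp.liftAddHom fun a => AddMonoidHom.mk'
    (fun n => indTmul φ a n) (fun m n => by
      simp only [indTmul, TensorProduct.tmul_add, Submodule.Quotient.mk_add])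
  have hrel : ∀ (s : S) (r : R) (n : N), indTmul φ s (r • n) = indTmul φ (s * φ r) n :=
    fun s r n => indTmul_smul φ s r n
  have hHG : H.comp G = AddMonoidHom.id _ := by
    refine indMod_hom_ext φ fun s n => ?_
    have : G (indTmul φ s n) = (σ s).mapRange (fun r => r • n) (by simp) := by
      ext a
      rw [hG, Finsupp.mapRange_apply]
    rw [AddMonoidHom.comp_apply, this, Finsupp.liftAddHom_apply,
      Finsupp.sum_mapRange_index (by simp)]
    conv_rhs => rw [← hs s]
    let T : S →+ IndMod φ N := AddMonoidHom.mk' (fun s => indTmul φ s n) (fun s t => by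
      simp only [indTmul, TensorProduct.add_tmul, Submodule.Quotient.mk_add])
    refine Eq.trans ?_ (map_finsuppSum T (σ s) (fun a r => a * φ r)).symm
    exact Finsupp.sum_congr fun a _ => hrel _ _ _
  have hnat : ∀ u a, G' (indMap φ f u) a = f (G u a) := by
    intro u a
    refine indMod_induction φ (p := fun u => G' (indMap φ f u) a = f (G u a)) (by simp) ?_ ?_ u
    · intro s n
      rw [indMap_tmul, hG, hG', map_smul]
    · intro x y hx hy
      simp only [map_add, Finsupp.add_apply, hx, hy]
  rw [injective_iff_map_eq_zero]
  intro u hu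
  have h0 : G u = 0 := by
    ext a
    apply hf
    rw [← hnat, hu]
    simp
  have := DFunLike.congr_fun hHG u
  rw [AddMonoidHom.comp_apply, h0, map_zero] at this
  exact this.symm

theorem indF_isSES {φ : R →ₐ[F] S} (h : RightProjective φ) {X Y Z : ModuleCat.{u} R} {f : X ⟶ Y}
    {g : Y ⟶ Z} (hfg : IsSES f g) : IsSES ((indF φ).map f) ((indF φ).map g) := by
  obtain ⟨hf, he, hg⟩ := hfg
  refine ⟨indMap_injective h f.hom hf, ?_, ?_⟩
  · have hex : Function.Exact (LinearMap.lTensor S (f.hom.restrictScalars F))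
        (LinearMap.lTensor S (g.hom.restrictScalars F)) := lTensor_exact S he hg
    intro y
    constructor
    · intro hy
      obtain ⟨y, rfl⟩ := Submodule.Quotient.mk_surjective _ y
      have hy' : preInd S g.hom y ∈ indRel φ Z := (Submodule.Quotient.mk_eq_zero _).1 hy
      have hle : indRel φ Z ≤ (indRel φ Y).map (preInd S g.hom) := by
        refine Submodule.span_le.2 ?_
        rintro _ ⟨s, r, n, rfl⟩
        obtain ⟨n, rfl⟩ := hg n
        exact ⟨(s * φ r) ⊗ₜ n - s ⊗ₜ (r • n), Submodule.subset_span ⟨s, r, n, rfl⟩, by simp⟩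
      obtain ⟨w, hw, hwy⟩ := hle hy'
      obtain ⟨x, hx⟩ := (hex (y - w)).1 (by
        change preInd S g.hom (y - w) = 0
        rw [map_sub, hwy, sub_self])
      refine ⟨Submodule.Quotient.mk x, ?_⟩
      change Submodule.Quotient.mk (LinearMap.lTensor S (f.hom.restrictScalars F) x) = _
      rw [hx, Submodule.Quotient.mk_sub, (Submodule.Quotient.mk_eq_zero _).2 hw, sub_zero]
    · rintro ⟨x, rfl⟩
      have : f ≫ g = 0 := by
        ext x
        exact he.apply_apply_eq_zero x
      refine indMod_induction φ (p := fun x => indMap φ g.hom (indMap φ f.hom x) = 0)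
        (by simp) (fun s n => ?_) (fun x y hx hy => ?_) x
      · rw [indMap_tmul, indMap_tmul, he.apply_apply_eq_zero]
        simp [indTmul]
      · rw [map_add, map_add, hx, hy, add_zero]
  · intro z
    refine indMod_induction φ (p := fun z => ∃ y, indMap φ g.hom y = z) ⟨0, by simp⟩
      (fun s n => ?_) ?_ z
    · obtain ⟨n, rfl⟩ := hg n
      exact ⟨indTmul φ s n, rfl⟩
    · rintro _ _ ⟨a, rfl⟩ ⟨b, rfl⟩
      exact ⟨a + b, by simp⟩

theorem extF_isSES (M : ModuleCat.{u} R) {X Y Z : ModuleCat.{u} S} {f : X ⟶ Y} {g : Y ⟶ Z}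
    (hfg : IsSES f g) : IsSES ((extF (F := F) M).map f) ((extF (F := F) M).map g) := by
  obtain ⟨hf, he, hg⟩ := hfg
  exact ⟨Module.Flat.lTensor_preserves_injective_linearMap (M := M) (f.hom.restrictScalars F) hf,
    lTensor_exact (f := f.hom.restrictScalars F) (g := g.hom.restrictScalars F) M he hg,
    LinearMap.lTensor_surjective M (g := g.hom.restrictScalars F) hg⟩

theorem extMap_isSES (N : ModuleCat.{u} S) {X Y Z : ModuleCat.{u} R} {f : X ⟶ Y} {g : Y ⟶ Z}
    (hfg : IsSES f g) :
    IsSES (ModuleCat.ofHom (extMap (F := F) f.hom (LinearMap.id : N →ₗ[S] N)))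
      (ModuleCat.ofHom (extMap (F := F) g.hom (LinearMap.id : N →ₗ[S] N))) := by
  obtain ⟨hf, he, hg⟩ := hfg
  exact ⟨Module.Flat.rTensor_preserves_injective_linearMap (M := N) (f.hom.restrictScalars F) hf,
    rTensor_exact (f := f.hom.restrictScalars F) (g := g.hom.restrictScalars F) N he hg,
    LinearMap.rTensor_surjective N (g := g.hom.restrictScalars F) hg⟩

/-! ### Finiteness and projectivity -/

theorem finite_base_iff [Module.Finite F B] (M : ModuleCat.{u} B) :
    Module.Finite F M ↔ Module.Finite B M :=
  ⟨fun _ => Module.Finite.of_restrictScalars_finite F B M, fun _ => Module.Finite.trans B M⟩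

theorem finite_resF [Module.Finite F R] [Module.Finite F S] (φ : R →ₐ[F] S) (M : ModuleCat.{u} S)
    (h : Module.Finite S M) : Module.Finite R ((resF φ).obj M) := by
  rw [← finite_base_iff (F := F)] at h ⊢
  let e : M →ₗ[F] ((resF φ).obj M) :=
    { toFun := fun x => x
      map_add' := fun _ _ => rfl
      map_smul' := fun c x => by
        change algebraMap F S c • x = φ (algebraMap F R c) • x
        rw [φ.commutes] }
  exact Module.Finite.of_surjective e (fun x => ⟨x, rfl⟩)

theorem finite_indF [Module.Finite F R] [Module.Finite F S] (φ : R →ₐ[F] S) (M : ModuleCat.{u} R)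
    (h : Module.Finite R M) : Module.Finite S ((indF φ).obj M) := by
  rw [← finite_base_iff (F := F)] at h
  exact inferInstanceAs (Module.Finite S (IndMod φ M))

theorem finite_ext [Module.Finite F R] [Module.Finite F S] (M : ModuleCat.{u} R)
    (N : ModuleCat.{u} S) (hM : Module.Finite R M) (hN : Module.Finite S N) :
    Module.Finite (R ⊗[F] S) ((extF (F := F) M).obj N) := by
  rw [← finite_base_iff (F := F)] at hM hN ⊢
  let e : M ⊗[F] N →ₗ[F] ((extF (F := F) M).obj N) :=
    { toFun := fun x => x
      map_add' := fun _ _ => rfl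
      map_smul' := fun c x => by
        change c • x = extAct F M N (algebraMap F _ c) x
        rw [AlgHom.commutes]
        rfl }
  exact Module.Finite.of_surjective e (fun x => ⟨x, rfl⟩)

theorem finite_homF [Module.Finite F R] [Module.Finite F S] (P : ModuleCat.{u} S)
    (Y : ModuleCat.{u} (R ⊗[F] S)) (hP : Module.Finite S P) (hY : Module.Finite (R ⊗[F] S) Y) :
    Module.Finite R ((homF P).obj Y) := by
  rw [← finite_base_iff (F := F)] at hP hY ⊢
  let e : ((homF P).obj Y) →ₗ[F] (P →ₗ[F] Y) :=
    { toFun := fun f =>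
        { toFun := fun p => (show PHom P Y from f) p
          map_add' := map_add _
          map_smul' := fun c p => by
            change (show PHom P Y from f) (algebraMap F S c • p) =
              algebraMap F (R ⊗[F] S) c • (show PHom P Y from f) p
            rw [LinearMap.map_smulₛₗ]
            congr 1
            exact (Algebra.TensorProduct.includeRight : S →ₐ[F] R ⊗[F] S).commutes c }
      map_add' := fun _ _ => rfl
      map_smul' := fun c f => by
        ext p
        rfl }
  refine Module.Finite.of_injective e (fun f g h => ?_)
  exact LinearMap.ext fun p => DFunLike.congr_fun h p

theorem projective_resF {φ : R →ₐ[F] S} (h : LeftProjective φ) (M : ModuleCat.{u} S)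
    (hM : Module.Projective S M) : Module.Projective R ((resF φ).obj M) := by
  obtain ⟨σ, hσ⟩ := hM.out
  classical
  have h' : Module.Projective R ((resF φ).obj (ModuleCat.of S S)) := h
  have : Module.Projective R (M →₀ (resF φ).obj (ModuleCat.of S S)) :=
    Module.Projective.of_equiv' (finsuppLequivDFinsupp (ι := M)
      (M := (resF φ).obj (ModuleCat.of S S)) R).symm
  let i : (resF φ).obj M →ₗ[R] (M →₀ (resF φ).obj (ModuleCat.of S S)) :=
    { toFun := fun x => (σ (show M from x) : M →₀ S)
      map_add' := fun x y => map_add σ (show M from x) (show M from y)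
      map_smul' := fun r x => map_smul σ (φ r) (show M from x) }
  let p : (M →₀ (resF φ).obj (ModuleCat.of S S)) →ₗ[R] (resF φ).obj M :=
    { toFun := fun x => Finsupp.linearCombination S id (show M →₀ S from x)
      map_add' := fun x y => map_add (Finsupp.linearCombination S id)
        (show M →₀ S from x) (show M →₀ S from y)
      map_smul' := fun r x => map_smul (Finsupp.linearCombination S id) (φ r)
        (show M →₀ S from x) }
  exact Module.Projective.of_split i p (LinearMap.ext fun x => hσ x)

theorem projective_indF (φ : R →ₐ[F] S) (M : ModuleCat.{u} R)
    (hM : Module.Projective R M) : Module.Projective S ((indF φ).obj M) := by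
  refine Module.Projective.of_lifting_property'' fun f hf => ?_
  let V : ModuleCat.{u} S := ModuleCat.of S (((indF φ).obj M) →₀ S)
  have hbal : ∀ (s : S) (r : R) (n : M), indTmul φ s (r • n) = indTmul φ (s * φ r) n :=
    fun s r n => indTmul_smul φ s r n
  let f' : (resF φ).obj V →ₗ[R] (resF φ).obj ((indF φ).obj M) := ((resF φ).map (ModuleCat.ofHom f)).hom
  let g : M →ₗ[R] (resF φ).obj ((indF φ).obj M) :=
    { toFun := fun m => indTmul φ 1 m
      map_add' := fun m n => by
        simp only [indTmul, TensorProduct.tmul_add, Submodule.Quotient.mk_add]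
        rfl
      map_smul' := fun r m => by
        change indTmul φ 1 (r • m) = φ r • indTmul φ 1 m
        rw [hbal, one_mul]
        change indTmul φ (φ r) m = indTmul φ (φ r • 1) m
        rw [smul_eq_mul, mul_one] }
  obtain ⟨h, hh⟩ := Module.projective_lifting_property f' g hf
  have hres : ∀ (r : R) (m : M), (show V from h (r • m)) = φ r • (show V from h m) :=
    fun r m => map_smul h r m
  let k₀ : S ⊗[F] M →ₗ[S] V := AlgebraTensorModule.lift
    { toFun := fun s =>
        { toFun := fun m => s • (show V from h m)
          map_add' := fun m n => by
            rw [map_add]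
            exact smul_add _ _ _
          map_smul' := fun c m => by
            have : c • m = algebraMap F R c • m := rfl
            rw [this, hres, φ.commutes, smul_smul, ← Algebra.commutes, mul_smul]
            exact algebraMap_smul S c _ }
      map_add' := fun s t => by
        ext m
        exact add_smul _ _ _
      map_smul' := fun s t => by
        ext m
        exact mul_smul _ _ _ }
  let k : IndMod φ M →ₗ[S] V := Submodule.liftQ _ k₀ (by
    refine Submodule.span_le.2 ?_
    rintro _ ⟨s, r, n, rfl⟩
    change k₀ _ = 0
    rw [map_sub]
    change (s * φ r) • (show V from h n) - s • (show V from h (r • n)) = 0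
    rw [hres, mul_smul, sub_self])
  refine ⟨k, LinearMap.toAddMonoidHom_injective (indMod_hom_ext φ fun s m => ?_)⟩
  change f (s • (show V from h m)) = indTmul φ s m
  rw [map_smul]
  have : f (show V from h m) = indTmul φ 1 m := DFunLike.congr_fun hh m
  rw [this]
  change indTmul φ (s • 1) m = indTmul φ s m
  rw [smul_eq_mul, mul_one]

theorem homF_surjective (Q : ModuleCat.{u} S) (hQ : Module.Projective S Q)
    {V W : ModuleCat.{u} (R ⊗[F] S)} (f : V ⟶ W) (hf : Function.Surjective f.hom) :
    Function.Surjective ((homF Q).map f).hom := by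
  intro q
  let ι : S →ₐ[F] R ⊗[F] S := Algebra.TensorProduct.includeRight
  let q' : Q →ₗ[S] (resF ι).obj W :=
    { toFun := fun n => (show PHom Q W from q) n
      map_add' := map_add _
      map_smul' := fun s n => LinearMap.map_smulₛₗ (show PHom Q W from q) s n }
  obtain ⟨h, hh⟩ := Module.projective_lifting_property ((resF ι).map f).hom q' hf
  refine ⟨({ toFun := fun n => h n
             map_add' := map_add h
             map_smul' := fun s n => map_smul h s n } : PHom Q V), ?_⟩
  exact LinearMap.ext fun n => DFunLike.congr_fun hh n

theorem projective_ext (M : ModuleCat.{u} R)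
    (N : ModuleCat.{u} S) (hM : Module.Projective R M) (hN : Module.Projective S N) :
    Module.Projective (R ⊗[F] S) ((extF (F := F) M).obj N) := by
  refine Module.Projective.of_lifting_property'' fun f hf => ?_
  let V : ModuleCat.{u} (R ⊗[F] S) := ModuleCat.of _ (((extF (F := F) M).obj N) →₀ R ⊗[F] S)
  let g : M →ₗ[R] (homF N).obj ((extF (F := F) M).obj N) :=
    { toFun := fun m =>
        ({ toFun := fun n => extTmul F m n
           map_add' := fun n n' => TensorProduct.tmul_add m n n'
           map_smul' := fun s n => by
             refine Eq.trans ?_ (extTensor_smul_tmul (1 : R) s m n).symm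
             exact congrArg (fun m' => extTmul F m' (s • n)) (one_smul R m).symm } : PHom N ((extF (F := F) M).obj N))
      map_add' := fun m m' => LinearMap.ext fun n => TensorProduct.add_tmul m m' n
      map_smul' := fun r m => LinearMap.ext fun n => by
        refine Eq.trans ?_ (extTensor_smul_tmul r (1 : S) m n).symm
        exact congrArg (fun n' => extTmul F (r • m) n') (one_smul S n).symm }
  obtain ⟨u, hu⟩ := Module.projective_lifting_property ((homF N).map (ModuleCat.ofHom f : V ⟶ _)).hom
    g (homF_surjective N hN _ hf)
  let u' : M → PHom N V := fun m => u m
  have hu1 : ∀ (r : R) m n, u' (r • m) n = (r ⊗ₜ[F] (1 : S)) • u' m n := fun r m n =>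
    DFunLike.congr_fun (F := PHom N V) (map_smul u r m) n
  have hu2 : ∀ (s : S) m n, u' m (s • n) = ((1 : R) ⊗ₜ[F] s) • u' m n := fun s m n =>
    LinearMap.map_smulₛₗ (u' m) s n
  let k₀ : ExtTensor F M N →+ V := TensorProduct.liftAddHom
    (AddMonoidHom.mk' (fun m => (u' m).toAddMonoidHom) (fun m m' =>
      AddMonoidHom.ext fun n => DFunLike.congr_fun (F := PHom N V) (map_add u m m') n))
    (fun c m n => by
      change u' (algebraMap F R c • m) n = u' m (algebraMap F S c • n)
      rw [hu1, hu2, Algebra.algebraMap_eq_smul_one, Algebra.algebraMap_eq_smul_one,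
        TensorProduct.smul_tmul])
  have hk₀ : ∀ m n, k₀ (extTmul F m n) = u' m n := fun m n => rfl
  let k : ExtTensor F M N →ₗ[R ⊗[F] S] V :=
    { toFun := k₀
      map_add' := map_add k₀
      map_smul' := fun a x => by
        rw [RingHom.id_apply]
        induction a using TensorProduct.induction_on with
        | zero => simp
        | add a b ha hb => simp only [add_smul, map_add, ha, hb]
        | tmul r s =>
          refine extTensor_induction (p := fun x => k₀ ((r ⊗ₜ[F] s) • x) = (r ⊗ₜ[F] s) • k₀ x)
            ?_ (fun m n => ?_) (fun x y hx hy => ?_) x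
          · simp
          · rw [extTensor_smul_tmul, hk₀, hk₀, hu1, hu2, smul_smul]
            simp
          · simp only [smul_add, map_add, hx, hy] }
  refine ⟨k, LinearMap.toAddMonoidHom_injective (extTensor_hom_ext fun m n => ?_)⟩
  exact DFunLike.congr_fun (F := PHom N ((extF (F := F) M).obj N)) (DFunLike.congr_fun hu m) n

end Exactness

/-! ### Grothendieck groups -/

section Grothendieck

/-- The two kinds of modules considered: finitely generated modules, and finitely generated
projective modules. -/
inductive ModKind
  | fg
  | proj

/-- `M` is finitely generated, respectively finitely generated projective. -/
def IsKind (c : ModKind) (B : Type u) [Ring B] : ObjectProperty (ModuleCat.{u} B) := fun M =>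
  match c with
  | .fg => Module.Finite B M
  | .proj => Module.Finite B M ∧ Module.Projective B M

theorem IsKind.finite {c : ModKind} {B : Type u} [Ring B] {M : ModuleCat.{u} B}
    (h : IsKind c B M) : Module.Finite B M := by
  cases c
  exacts [h, h.1]

/-- The Grothendieck group of the category of modules of kind `c`: the free abelian group on the
modules of kind `c`, modulo `[Y] = [X] + [Z]` for every short exact sequence
`0 → X → Y → Z → 0` of modules of kind `c`. As short exact sequences of projective modules split,
this is the split Grothendieck group when `c = proj`. -/
def Groth (c : ModKind) (B : Type u) [Ring B] : Type (u + 1) :=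
  FreeAbelianGroup (IsKind c B).FullSubcategory ⧸ AddSubgroup.closure
    {x | ∃ (X Y Z : (IsKind c B).FullSubcategory) (f : X.obj ⟶ Y.obj) (g : Y.obj ⟶ Z.obj),
      IsSES f g ∧ x = FreeAbelianGroup.of Y - FreeAbelianGroup.of X - FreeAbelianGroup.of Z}

noncomputable instance (c : ModKind) (B : Type u) [Ring B] : AddCommGroup (Groth c B) :=
  inferInstanceAs (AddCommGroup (_ ⧸ AddSubgroup.closure _))

/-- `G₀(B)`, the Grothendieck group of the finitely generated modules. -/
abbrev G₀ (B : Type u) [Ring B] : Type (u + 1) := Groth .fg B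

/-- `K₀(B)`, the Grothendieck group of the finitely generated projective modules. -/
abbrev K₀ (B : Type u) [Ring B] : Type (u + 1) := Groth .proj B

namespace Groth

variable {c d : ModKind} {B C D : Type u} [Ring B] [Ring C] [Ring D]

/-- The class of a module. -/
noncomputable def mk (X : ModuleCat.{u} B) (h : IsKind c B X) : Groth c B :=
  QuotientAddGroup.mk (FreeAbelianGroup.of (⟨X, h⟩ : (IsKind c B).FullSubcategory))

theorem hom_ext {L : Type*} [AddCommGroup L] {f g : Groth c B →+ L}
    (h : ∀ X hX, f (mk X hX) = g (mk X hX)) : f = g :=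
  QuotientAddGroup.addMonoidHom_ext _ (FreeAbelianGroup.lift_ext _ _ fun X => h X.obj X.property)

theorem mk_ses {X Y Z : ModuleCat.{u} B} (hX : IsKind c B X) (hY : IsKind c B Y)
    (hZ : IsKind c B Z) (f : X ⟶ Y) (g : Y ⟶ Z) (h : IsSES f g) :
    mk Y hY = mk X hX + mk Z hZ := by
  have : mk Y hY - mk X hX - mk Z hZ = 0 :=
    (QuotientAddGroup.eq_zero_iff (FreeAbelianGroup.of _ - FreeAbelianGroup.of _ -
      FreeAbelianGroup.of _)).2 (AddSubgroup.subset_closure ⟨⟨X, hX⟩, ⟨Y, hY⟩, ⟨Z, hZ⟩, f, g, h, rfl⟩)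
  rw [sub_sub, sub_eq_zero] at this
  exact this

/-- A function on modules that is additive on short exact sequences defines a homomorphism on the
Grothendieck group. -/
noncomputable def lift {L : Type*} [AddCommGroup L] (φ : ∀ X : ModuleCat.{u} B, IsKind c B X → L)
    (hφ : ∀ {X Y Z : ModuleCat.{u} B} (hX : IsKind c B X) (hY : IsKind c B Y) (hZ : IsKind c B Z)
      (f : X ⟶ Y) (g : Y ⟶ Z), IsSES f g → φ Y hY = φ X hX + φ Z hZ) : Groth c B →+ L :=
  QuotientAddGroup.lift _ (FreeAbelianGroup.lift fun X => φ X.obj X.property) (by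
    refine (AddSubgroup.closure_le _).2 ?_
    rintro _ ⟨X, Y, Z, f, g, h, rfl⟩
    change FreeAbelianGroup.lift _ _ = 0
    simp [hφ X.property Y.property Z.property f g h])

@[simp] theorem lift_mk {L : Type*} [AddCommGroup L]
    (φ : ∀ X : ModuleCat.{u} B, IsKind c B X → L) (hφ) (X : ModuleCat.{u} B) (hX : IsKind c B X) :
    lift φ hφ (mk X hX) = φ X hX :=
  FreeAbelianGroup.lift_apply_of _ _

section lift₂

variable {L : Type*} [AddCommGroup L]
  (φ : ∀ (X : ModuleCat.{u} B) (_ : IsKind c B X) (M : ModuleCat.{u} C) (_ : IsKind d C M), L)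

theorem lift₂_aux
    (h₁ : ∀ {X Y Z : ModuleCat.{u} B} (hX : IsKind c B X) (hY : IsKind c B Y) (hZ : IsKind c B Z)
      (f : X ⟶ Y) (g : Y ⟶ Z), IsSES f g → ∀ M hM, φ Y hY M hM = φ X hX M hM + φ Z hZ M hM)
    (h₂ : ∀ (M) (hM : IsKind c B M) {X Y Z : ModuleCat.{u} C} (hX : IsKind d C X)
      (hY : IsKind d C Y) (hZ : IsKind d C Z) (f : X ⟶ Y) (g : Y ⟶ Z), IsSES f g →
      φ M hM Y hY = φ M hM X hX + φ M hM Z hZ)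
    {X Y Z : ModuleCat.{u} B} (hX : IsKind c B X) (hY : IsKind c B Y)
    (hZ : IsKind c B Z) (f : X ⟶ Y) (g : Y ⟶ Z) (h : IsSES f g) :
    (lift (φ Y hY) (h₂ Y hY)).toIntLinearMap =
      (lift (φ X hX) (h₂ X hX)).toIntLinearMap + (lift (φ Z hZ) (h₂ Z hZ)).toIntLinearMap := by
  apply LinearMap.toAddMonoidHom_injective
  refine hom_ext fun M hM => ?_
  change lift (φ Y hY) (h₂ Y hY) (mk M hM) =
    lift (φ X hX) (h₂ X hX) (mk M hM) + lift (φ Z hZ) (h₂ Z hZ) (mk M hM)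
  rw [lift_mk, lift_mk, lift_mk, h₁ hX hY hZ f g h]

variable
  (h₁ : ∀ {X Y Z : ModuleCat.{u} B} (hX : IsKind c B X) (hY : IsKind c B Y) (hZ : IsKind c B Z)
    (f : X ⟶ Y) (g : Y ⟶ Z), IsSES f g → ∀ M hM, φ Y hY M hM = φ X hX M hM + φ Z hZ M hM)
  (h₂ : ∀ (M) (hM : IsKind c B M) {X Y Z : ModuleCat.{u} C} (hX : IsKind d C X)
    (hY : IsKind d C Y) (hZ : IsKind d C Z) (f : X ⟶ Y) (g : Y ⟶ Z), IsSES f g →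
    φ M hM Y hY = φ M hM X hX + φ M hM Z hZ)

/-- A function of two modules that is additive on short exact sequences in each variable defines a
biadditive map on Grothendieck groups. -/
noncomputable def lift₂ : Groth c B →ₗ[ℤ] Groth d C →ₗ[ℤ] L :=
  (lift (fun X hX => (lift (φ X hX) (h₂ X hX)).toIntLinearMap)
    (lift₂_aux φ h₁ h₂)).toIntLinearMap

@[simp] theorem lift₂_mk (X : ModuleCat.{u} B) (hX : IsKind c B X) (M : ModuleCat.{u} C)
    (hM : IsKind d C M) : lift₂ φ h₁ h₂ (mk X hX) (mk M hM) = φ X hX M hM := by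
  have : lift₂ φ h₁ h₂ (mk X hX) = (lift (φ X hX) (h₂ X hX)).toIntLinearMap :=
    lift_mk (fun X hX => (lift (φ X hX) (h₂ X hX)).toIntLinearMap) (lift₂_aux φ h₁ h₂) X hX
  rw [this]
  exact lift_mk (φ X hX) (h₂ X hX) M hM

end lift₂

/-- The map induced by an exact functor. -/
noncomputable def map (T : ModuleCat.{u} B ⥤ ModuleCat.{u} C)
    (h : ∀ X, IsKind c B X → IsKind c C (T.obj X))
    (he : ∀ {X Y Z : ModuleCat.{u} B} (f : X ⟶ Y) (g : Y ⟶ Z), IsSES f g →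
      IsSES (T.map f) (T.map g)) : Groth c B →ₗ[ℤ] Groth c C :=
  (lift (fun X hX => mk (T.obj X) (h X hX)) (fun hX hY hZ f g hfg =>
    mk_ses (h _ hX) (h _ hY) (h _ hZ) (T.map f) (T.map g) (he f g hfg))).toIntLinearMap

/-- The Cartan map `K₀(B) → G₀(B)`, `[P] ↦ [P]`. -/
noncomputable def cartan (B : Type u) [Ring B] : K₀ B →ₗ[ℤ] G₀ B :=
  (lift (c := .proj) (fun X hX => (mk X hX.1 : G₀ B)) (fun hX hY hZ f g hfg =>
    mk_ses (c := .fg) hX.1 hY.1 hZ.1 f g hfg)).toIntLinearMap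

end Groth

variable {F : Type u} [Field F]
variable {R S B : Type u} [Ring R] [Algebra F R] [Ring S] [Algebra F S] [Ring B] [Algebra F B]

theorem IsKind.indF [Module.Finite F R] [Module.Finite F S] {c : ModKind} (φ : R →ₐ[F] S)
    {M : ModuleCat.{u} R} (h : IsKind c R M) : IsKind c S ((indF φ).obj M) := by
  cases c
  exacts [finite_indF φ M h, ⟨finite_indF φ M h.1, projective_indF φ M h.2⟩]

theorem IsKind.resF [Module.Finite F R] [Module.Finite F S] {c : ModKind} {φ : R →ₐ[F] S}
    (hφ : LeftProjective φ) {M : ModuleCat.{u} S} (h : IsKind c S M) :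
    IsKind c R ((resF φ).obj M) := by
  cases c
  exacts [finite_resF φ M h, ⟨finite_resF φ M h.1, projective_resF hφ M h.2⟩]

theorem IsKind.ext [Module.Finite F R] [Module.Finite F S] {c : ModKind} {M : ModuleCat.{u} R}
    {N : ModuleCat.{u} S} (hM : IsKind c R M) (hN : IsKind c S N) :
    IsKind c (R ⊗[F] S) ((extF (F := F) M).obj N) := by
  cases c
  exacts [finite_ext M N hM hN, ⟨finite_ext M N hM.1 hN.1, projective_ext M N hM.2 hN.2⟩]

/-- Induction on Grothendieck groups. -/
noncomputable def Groth.ind [Module.Finite F R] [Module.Finite F S] (c : ModKind) (φ : R →ₐ[F] S)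
    (hφ : RightProjective φ) : Groth c R →ₗ[ℤ] Groth c S :=
  Groth.map (indF φ) (fun _ h => h.indF φ) (fun _ _ h => indF_isSES hφ h)

/-- Restriction on Grothendieck groups. -/
noncomputable def Groth.res [Module.Finite F R] [Module.Finite F S] (c : ModKind) (φ : R →ₐ[F] S)
    (hφ : LeftProjective φ) : Groth c S →ₗ[ℤ] Groth c R :=
  Groth.map (resF φ) (fun _ h => h.resF hφ) (fun _ _ h => h)

/-- The map `([M], [N]) ↦ [M ⊗ N]`. -/
noncomputable def Groth.ext (F : Type u) [Field F] (c : ModKind) (R S : Type u) [Ring R]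
    [Algebra F R] [Ring S] [Algebra F S] [Module.Finite F R] [Module.Finite F S] :
    Groth c R →ₗ[ℤ] Groth c S →ₗ[ℤ] Groth c (R ⊗[F] S) :=
  Groth.lift₂ (fun M hM N hN => Groth.mk ((extF (F := F) M).obj N) (hM.ext hN))
    (fun hX hY hZ _ _ h M hM =>
      Groth.mk_ses (hX.ext hM) (hY.ext hM) (hZ.ext hM) _ _ (extMap_isSES M h))
    (fun _ hM _ _ _ hX hY hZ _ _ h =>
      Groth.mk_ses (hM.ext hX) (hM.ext hY) (hM.ext hZ) _ _ (extF_isSES _ h))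

theorem finrank_ses {V₁ V₂ V₃ : Type*} [AddCommGroup V₁] [Module F V₁] [AddCommGroup V₂]
    [Module F V₂] [AddCommGroup V₃] [Module F V₃] [Module.Finite F V₂] (f : V₁ →ₗ[F] V₂)
    (g : V₂ →ₗ[F] V₃) (hf : Function.Injective f) (he : Function.Exact f g)
    (hg : Function.Surjective g) :
    (Module.finrank F V₂ : ℤ) = Module.finrank F V₁ + Module.finrank F V₃ := by
  have h := g.finrank_range_add_finrank_ker
  rw [LinearMap.range_eq_top.2 hg, finrank_top, he.linearMap_ker_eq,
    LinearMap.finrank_range_of_inj hf] at h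
  omega

theorem finite_hom [Module.Finite F B] {P M : ModuleCat.{u} B} (hP : Module.Finite B P)
    (hM : Module.Finite B M) : Module.Finite F (P ⟶ M) := by
  rw [← finite_base_iff (F := F)] at hP hM
  let e : (P ⟶ M) →ₗ[F] (P →ₗ[F] M) :=
    { toFun := fun f => f.hom.restrictScalars F
      map_add' := fun _ _ => rfl
      map_smul' := fun _ _ => rfl }
  refine Module.Finite.of_injective e fun f g h => ?_
  ext x
  exact DFunLike.congr_fun h x

/-- The pairing `⟨[P], [M]⟩ = dim_F Hom_B(P, M)` between `K₀(B)` and `G₀(B)`. -/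
noncomputable def pairing (F : Type u) [Field F] (B : Type u) [Ring B] [Algebra F B]
    [Module.Finite F B] : K₀ B →ₗ[ℤ] G₀ B →ₗ[ℤ] ℤ :=
  Groth.lift₂ (fun P _ M _ => (Module.finrank F (P ⟶ M) : ℤ))
    (fun {X Y Z} hX hY hZ f g h M hM => by
      have := finite_hom (F := F) hY.1 hM
      have hZ' := hZ.2
      obtain ⟨t, ht⟩ := Module.projective_lifting_property g.hom LinearMap.id h.2.2
      have ht' : ∀ z, g.hom (t z) = z := fun z => DFunLike.congr_fun ht z
      rw [add_comm]
      refine finrank_ses (Linear.leftComp F M g) (Linear.leftComp F M f) ?_ ?_ ?_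
      · intro a b hab
        ext z
        obtain ⟨y, rfl⟩ := h.2.2 z
        exact congrArg (fun q : Y ⟶ M => q.hom y) hab
      · intro a
        constructor
        · intro ha
          have ha' : ∀ x, a.hom (f.hom x) = 0 := fun x => congrArg (fun q : X ⟶ M => q.hom x) ha
          refine ⟨ModuleCat.ofHom (a.hom ∘ₗ t), ?_⟩
          ext y
          obtain ⟨x, hx⟩ := (h.2.1 (y - t (g.hom y))).1 (by rw [map_sub, ht', sub_self])
          have := ha' x
          rw [hx, map_sub, sub_eq_zero] at this
          exact this.symm
        · rintro ⟨b, rfl⟩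
          ext x
          change b.hom (g.hom (f.hom x)) = 0
          rw [h.2.1.apply_apply_eq_zero, map_zero]
      · intro b
        -- a retraction of `f`
        have hmem : ∀ y, ∃ x, f.hom x = y - t (g.hom y) := fun y =>
          (h.2.1 _).1 (by rw [map_sub, ht', sub_self])
        choose r hr using hmem
        let r' : Y →ₗ[B] X :=
          { toFun := r
            map_add' := fun y y' => h.1 (by rw [map_add, hr, hr, hr, map_add, map_add]; abel)
            map_smul' := fun s y => h.1 (by
              rw [RingHom.id_apply, map_smul, hr, hr, map_smul, map_smul, smul_sub]) }
        refine ⟨ModuleCat.ofHom (b.hom ∘ₗ r'), ?_⟩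
        ext x
        change b.hom (r (f.hom x)) = b.hom x
        congr 1
        apply h.1
        rw [hr, h.2.1.apply_apply_eq_zero, map_zero, sub_zero])
    (fun P hP {X Y Z} hX hY hZ f g h => by
      have := finite_hom (F := F) hP.1 hY.finite
      have hP' := hP.2
      refine finrank_ses (Linear.rightComp F P f) (Linear.rightComp F P g) ?_ ?_ ?_
      · intro a b hab
        ext p
        exact h.1 (congrArg (fun q : P ⟶ Y => q.hom p) hab)
      · intro a
        constructor
        · intro ha
          have ha' : ∀ p, g.hom (a.hom p) = 0 := fun p => congrArg (fun q : P ⟶ Z => q.hom p) ha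
          have hmem : ∀ p, ∃ x, f.hom x = a.hom p := fun p => (h.2.1 _).1 (ha' p)
          choose r hr using hmem
          let r' : P →ₗ[B] X :=
            { toFun := r
              map_add' := fun p p' => h.1 (by rw [map_add, hr, hr, hr, map_add])
              map_smul' := fun s p => h.1 (by rw [RingHom.id_apply, map_smul, hr, hr, map_smul]) }
          refine ⟨ModuleCat.ofHom r', ?_⟩
          ext p
          exact hr p
        · rintro ⟨b, rfl⟩
          ext p
          exact h.2.1.apply_apply_eq_zero _
      · intro b
        obtain ⟨t, ht⟩ := Module.projective_lifting_property g.hom b.hom h.2.2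
        exact ⟨ModuleCat.ofHom t, ModuleCat.hom_ext ht⟩)

/-- The homomorphism `[M] ↦ dim_F M`. -/
noncomputable def Groth.dim (F : Type u) [Field F] (c : ModKind) (B : Type u) [Ring B]
    [Algebra F B] [Module.Finite F B] : Groth c B →ₗ[ℤ] ℤ :=
  (Groth.lift (fun M _ => (Module.finrank F M : ℤ)) (fun {X Y Z} hX hY hZ f g h => by
    have := (finite_base_iff (F := F) Y).2 hY.finite
    exact finrank_ses (f.hom.restrictScalars F) (g.hom.restrictScalars F) h.1 h.2.1
      h.2.2)).toIntLinearMap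

end Grothendieck

/-! ### Direct sums of module categories -/

section Graded

variable {ι κ : Type} {F : Type u} [Field F]

/-- Families of finitely generated modules, almost all of which are zero. -/
def IsFinFam (R : ι → Type u) [∀ i, Ring (R i)] : ObjectProperty (∀ i, ModuleCat.{u} (R i)) :=
  fun X => (∀ i, Module.Finite (R i) (X i)) ∧ {i | Nontrivial (X i)}.Finite

/-- The direct sum of categories `⨁ i, R_i-mod`. -/
abbrev GrMod (R : ι → Type u) [∀ i, Ring (R i)] : Type (u + 1) := (IsFinFam R).FullSubcategory

/-- The objects of `⨁ i, R_i-mod` all of whose components are projective. -/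
def IsProj (R : ι → Type u) [∀ i, Ring (R i)] : ObjectProperty (GrMod R) :=
  fun X => ∀ i, Module.Projective (R i) (X.obj i)

/-- The direct sum of categories `⨁ i, R_i-pmod`. -/
abbrev GrPMod (R : ι → Type u) [∀ i, Ring (R i)] : Type (u + 1) := (IsProj R).FullSubcategory

/-- The restriction to projective objects of a functor that preserves them. -/
noncomputable def restrictProj {R : ι → Type u} [∀ i, Ring (R i)] {S : κ → Type u}
    [∀ i, Ring (S i)] (Φ : GrMod R ⥤ GrMod S) (h : ∀ X, IsProj R X → IsProj S (Φ.obj X)) :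
    GrPMod R ⥤ GrPMod S :=
  (IsProj S).lift ((IsProj R).ι ⋙ Φ) (fun X => h X.obj X.property)

/-- The family of algebras `R_i ⊗ S_j`. -/
abbrev Tens (F : Type u) [Field F] (R : ι → Type u) [∀ i, Ring (R i)] [∀ i, Algebra F (R i)]
    (S : κ → Type u) [∀ i, Ring (S i)] [∀ i, Algebra F (S i)] : ι × κ → Type u :=
  fun p => R p.1 ⊗[F] S p.2

/-- A map `g` of index sets with finite fibres together with algebra homomorphisms
`R_i → S_{g(i)}`. The homomorphism is given for every `j` with a proof of `g i = j`, which avoids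
transport along equalities. -/
structure AlgFamHom (F : Type u) [Field F] (R : ι → Type u) [∀ i, Ring (R i)]
    [∀ i, Algebra F (R i)] (S : κ → Type u) [∀ i, Ring (S i)] [∀ i, Algebra F (S i)] where
  g : ι → κ
  fib : ∀ j, (g ⁻¹' {j}).Finite
  hom : ∀ {i j}, g i = j → R i →ₐ[F] S j

theorem subsingleton_ind {R S : Type u} [Ring R] [Algebra F R] [Ring S] [Algebra F S]
    (φ : R →ₐ[F] S) (M : ModuleCat.{u} R) (h : Subsingleton M) : Subsingleton (IndMod φ M) := by
  refine subsingleton_of_forall_eq 0 fun x => ?_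
  refine indMod_induction _ (p := fun x => x = 0) rfl (fun s n => ?_) ?_ x
  · rw [Subsingleton.elim n 0]
    simp [indTmul]
  · rintro x y rfl rfl
    exact add_zero 0

theorem subsingleton_ext {R S : Type u} [Ring R] [Algebra F R] [Ring S] [Algebra F S]
    (M : ModuleCat.{u} R) (N : ModuleCat.{u} S) (h : Subsingleton M ∨ Subsingleton N) :
    Subsingleton (ExtTensor F M N) := by
  refine subsingleton_of_forall_eq (0 : ExtTensor F M N) fun x => ?_
  refine extTensor_induction (F := F) (M := M) (N := N) (p := fun x => x = 0) rfl (fun m n => ?_) ?_ x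
  · rcases h with h | h
    · rw [Subsingleton.elim m 0]
      exact TensorProduct.zero_tmul _ _
    · rw [Subsingleton.elim n 0]
      exact TensorProduct.tmul_zero _ _
  · rintro x y rfl rfl
    exact add_zero 0

theorem finite_pi_of_finite_support {B : Type u} [Ring B] {V : κ → Type u}
    [∀ j, AddCommGroup (V j)] [∀ j, Module B (V j)] (h1 : ∀ j, Module.Finite B (V j))
    (h2 : {j | Nontrivial (V j)}.Finite) : Module.Finite B (∀ j, V j) := by
  classical
  have := h2.to_subtype
  let e : (∀ j : {j | Nontrivial (V j)}, V j.1) →ₗ[B] ∀ j, V j := LinearMap.pi fun j =>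
    if h : Nontrivial (V j) then LinearMap.proj (⟨j, h⟩ : {j | Nontrivial (V j)}) else 0
  refine Module.Finite.of_surjective e fun f => ⟨fun j => f j.1, ?_⟩
  funext j
  by_cases hj : Nontrivial (V j)
  · simp [e, hj]
  · have := not_nontrivial_iff_subsingleton.1 hj
    exact Subsingleton.elim _ _

section Functors

variable {R : ι → Type u} [∀ i, Ring (R i)] [∀ i, Algebra F (R i)] [∀ i, Module.Finite F (R i)]
variable {S : κ → Type u} [∀ i, Ring (S i)] [∀ i, Algebra F (S i)] [∀ i, Module.Finite F (S i)]

/-- Restriction: `(Res Y)_i = Res^{S_{g(i)}}_{R_i} Y_{g(i)}`. -/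
noncomputable def grRes (φ : AlgFamHom F R S) : GrMod S ⥤ GrMod R where
  obj Y := ⟨fun i => (resF (φ.hom (i := i) rfl)).obj (Y.obj (φ.g i)), fun i =>
    finite_resF _ _ (Y.property.1 _), by
      refine (Y.property.2.preimage' (f := φ.g) fun j _ => φ.fib j).subset ?_
      intro i hi
      exact hi⟩
  map f := ObjectProperty.homMk fun i => (resF (φ.hom (i := i) rfl)).map (f.hom (φ.g i))

/-- Induction: `(Ind X)_j = ⨁_{g(i) = j} Ind^{S_j}_{R_i} X_i` (a finite direct sum). -/
noncomputable def grInd (φ : AlgFamHom F R S) : GrMod R ⥤ GrMod S where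
  obj X := ⟨fun j => ModuleCat.of (S j)
      (∀ i : {i // φ.g i = j}, (indF (φ.hom i.2)).obj (X.obj i.1)), fun j => by
      have : Finite {i // φ.g i = j} := φ.fib j
      have : ∀ i : {i // φ.g i = j}, Module.Finite (S j) ((indF (φ.hom i.2)).obj (X.obj i.1)) :=
        fun i => finite_indF _ _ (X.property.1 _)
      exact inferInstanceAs (Module.Finite (S j)
        (∀ i : {i // φ.g i = j}, (indF (φ.hom i.2)).obj (X.obj i.1))), by
      refine (X.property.2.image φ.g).subset ?_
      intro j hj
      by_contra hne
      have : ∀ i : {i // φ.g i = j}, Subsingleton ((indF (φ.hom i.2)).obj (X.obj i.1)) := by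
        intro i
        have hi : Subsingleton (X.obj i.1) := by
          rw [← not_nontrivial_iff_subsingleton]
          exact fun h => hne ⟨i.1, h, i.2⟩
        exact subsingleton_ind _ _ hi
      have h2 : Subsingleton (∀ i : {i // φ.g i = j}, (indF (φ.hom i.2)).obj (X.obj i.1)) :=
        inferInstance
      exact not_nontrivial_iff_subsingleton.2 h2 hj⟩
  map f := ObjectProperty.homMk fun j => ModuleCat.ofHom
    (LinearMap.pi fun i => ((indF (φ.hom i.2)).map (f.hom i.1)).hom ∘ₗ LinearMap.proj i)
  map_id X := by
    ext j x i
    exact congrArg (fun q : (indF (φ.hom i.2)).obj (X.obj i.1) ⟶ _ => q.hom (x i))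
      ((indF (φ.hom i.2)).map_id (X.obj i.1))
  map_comp f f' := by
    ext j x i
    exact congrArg (fun q : (indF (φ.hom i.2)).obj _ ⟶ _ => q.hom (x i))
      ((indF (φ.hom i.2)).map_comp (f.hom i.1) (f'.hom i.1))

/-- The functor `M ⊗ -`, where `(M ⊗ N)_{i,j} = M_i ⊗ N_j`. -/
noncomputable def grExt (F : Type u) [Field F] {R : ι → Type u} [∀ i, Ring (R i)]
    [∀ i, Algebra F (R i)] [∀ i, Module.Finite F (R i)] {S : κ → Type u} [∀ i, Ring (S i)]
    [∀ i, Algebra F (S i)] [∀ i, Module.Finite F (S i)] (M : GrMod R) :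
    GrMod S ⥤ GrMod (Tens F R S) where
  obj N := ⟨fun p => (extF (F := F) (M.obj p.1)).obj (N.obj p.2), fun p =>
    finite_ext _ _ (M.property.1 _) (N.property.1 _), by
      refine (M.property.2.prod N.property.2).subset ?_
      rintro p hp
      by_contra hne
      refine not_nontrivial_iff_subsingleton.2 ?_ hp
      refine subsingleton_ext _ _ ?_
      rw [← not_nontrivial_iff_subsingleton, ← not_nontrivial_iff_subsingleton]
      exact not_and_or.1 fun h => hne ⟨h.1, h.2⟩⟩
  map f := ObjectProperty.homMk fun p => (extF (F := F) (M.obj p.1)).map (f.hom p.2)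
  map_id N := by
    ext p : 2
    exact (extF (F := F) (M.obj p.1)).map_id _
  map_comp f f' := by
    ext p : 2
    exact (extF (F := F) (M.obj p.1)).map_comp _ _

/-- The functor `Hom(P, -)` for `P` in `⨁ j, S_j-mod`:
`Hom(P, Y)_i = ⨁_j Hom_{S_j}(P_j, Y_{i,j})`, where only finitely many summands are nonzero. -/
noncomputable def grHom (P : GrMod S) : GrMod (Tens F R S) ⥤ GrMod R where
  obj Y := ⟨fun i => ModuleCat.of (R i)
      (∀ j, (homF (F := F) (R := R i) (P.obj j)).obj (Y.obj (i, j))), fun i => by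
      refine finite_pi_of_finite_support (fun j =>
        finite_homF _ _ (P.property.1 j) (Y.property.1 (i, j))) (P.property.2.subset ?_)
      intro j hj
      by_contra hne
      have hP : Subsingleton (P.obj j) := not_nontrivial_iff_subsingleton.1 hne
      refine not_nontrivial_iff_subsingleton.2 ?_ hj
      refine subsingleton_of_forall_eq 0 fun f => LinearMap.ext fun p => ?_
      rw [Subsingleton.elim p 0]
      exact (map_zero (show PHom (P.obj j) (Y.obj (i, j)) from f)).trans rfl, by
      refine (Y.property.2.image Prod.fst).subset ?_
      intro i hi
      by_contra hne
      have : ∀ j, Subsingleton ((homF (F := F) (R := R i) (P.obj j)).obj (Y.obj (i, j))) := by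
        intro j
        have hj : Subsingleton (Y.obj (i, j)) := by
          rw [← not_nontrivial_iff_subsingleton]
          exact fun h => hne ⟨(i, j), h, rfl⟩
        refine subsingleton_of_forall_eq 0 fun f => ?_
        exact LinearMap.ext fun p => Subsingleton.elim (α := Y.obj (i, j)) _ _
      have h2 : Subsingleton (∀ j, (homF (F := F) (R := R i) (P.obj j)).obj (Y.obj (i, j))) :=
        inferInstance
      exact not_nontrivial_iff_subsingleton.2 h2 hi⟩
  map f := ObjectProperty.homMk fun i => ModuleCat.ofHom
    (LinearMap.pi fun j =>
      ((homF (F := F) (R := R i) (P.obj j)).map (f.hom (i, j))).hom ∘ₗ LinearMap.proj j)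

end Functors

end Graded

/-! ### Dual pairs of Hopf algebras and the Heisenberg double -/

section Hopf

/-- The structure maps of a bialgebra. -/
structure HopfOps (k : Type*) [CommRing k] (H : Type*) [AddCommGroup H] [Module k H] where
  mul : H →ₗ[k] H →ₗ[k] H
  one : H
  comul : H →ₗ[k] H ⊗[k] H
  counit : H →ₗ[k] k

variable {k : Type*} [CommRing k]

/-- The axioms of a bialgebra over `k`. -/
structure HopfOps.IsBialgebra {H : Type*} [AddCommGroup H] [Module k H] (o : HopfOps k H) :
    Prop where
  mul_assoc : ∀ a b c, o.mul (o.mul a b) c = o.mul a (o.mul b c)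
  one_mul : ∀ a, o.mul o.one a = a
  mul_one : ∀ a, o.mul a o.one = a
  coassoc : ∀ a, TensorProduct.assoc k H H H (o.comul.rTensor H (o.comul a)) =
    o.comul.lTensor H (o.comul a)
  rTensor_counit : ∀ a, o.counit.rTensor H (o.comul a) = 1 ⊗ₜ a
  lTensor_counit : ∀ a, o.counit.lTensor H (o.comul a) = a ⊗ₜ 1
  comul_mul : ∀ a b, o.comul (o.mul a b) = TensorProduct.map₂ o.mul o.mul (o.comul a) (o.comul b)
  comul_one : o.comul o.one = o.one ⊗ₜ o.one
  counit_mul : ∀ a b, o.counit (o.mul a b) = o.counit a * o.counit b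
  counit_one : o.counit o.one = 1

/-- The bialgebra `⨁ n, V n` is graded connected; it is then a Hopf algebra. -/
structure HopfOps.IsGradedConnected {V : ℕ → Type*} [∀ n, AddCommGroup (V n)]
    [∀ n, Module k (V n)] (o : HopfOps k (⨁ n, V n)) : Prop where
  isBialgebra : o.IsBialgebra
  finite : ∀ n, Module.Finite k (V n)
  free : ∀ n, Module.Free k (V n)
  mul_mem : ∀ i j (a : V i) (b : V j), o.mul (lof k ℕ V i a) (lof k ℕ V j b) ∈
    LinearMap.range (lof k ℕ V (i + j))
  comul_mem : ∀ n (a : V n), o.comul (lof k ℕ V n a) ∈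
    ⨆ p ∈ Finset.HasAntidiagonal.antidiagonal n,
      LinearMap.range (TensorProduct.map (lof k ℕ V p.1) (lof k ℕ V p.2))
  one_mem : o.one ∈ LinearMap.range (lof k ℕ V 0)
  counit_eq_zero : ∀ n, 0 < n → ∀ a : V n, o.counit (lof k ℕ V n a) = 0
  connected : LinearMap.range (lof k ℕ V 0) = Submodule.span k {o.one}

section Pairing

variable {Hm Hp : Type*} [AddCommGroup Hm] [Module k Hm] [AddCommGroup Hp] [Module k Hp]

/-- `⟨a ⊗ b, x ⊗ y⟩ = ⟨a, x⟩ ⟨b, y⟩`. -/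
noncomputable def tensorPairing (b : Hm →ₗ[k] Hp →ₗ[k] k) :
    Hm ⊗[k] Hm →ₗ[k] Hp ⊗[k] Hp →ₗ[k] k :=
  (TensorProduct.map₂ b b).compr₂ (LinearMap.mul' k k)

/-- Hopf pairings. -/
structure IsHopfPairing (om : HopfOps k Hm) (op : HopfOps k Hp) (b : Hm →ₗ[k] Hp →ₗ[k] k) :
    Prop where
  mul_left : ∀ x y a, b (om.mul x y) a = tensorPairing b (x ⊗ₜ y) (op.comul a)
  mul_right : ∀ x a a', b x (op.mul a a') = tensorPairing b (om.comul x) (a ⊗ₜ a')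
  one_left : ∀ a, b om.one a = op.counit a
  one_right : ∀ x, b x op.one = om.counit x

/-- The left-regular action `R_x^*(a) = ∑ ⟨x, a₍₂₎⟩ a₍₁₎` of `H⁻` on `H⁺`. -/
noncomputable def leftReg (op : HopfOps k Hp) (b : Hm →ₗ[k] Hp →ₗ[k] k) :
    Hm →ₗ[k] Hp →ₗ[k] Hp where
  toFun x := (TensorProduct.rid k Hp).toLinearMap ∘ₗ (b x).lTensor Hp ∘ₗ op.comul
  map_add' x y := by
    rw [map_add, LinearMap.lTensor_add, LinearMap.add_comp, LinearMap.comp_add]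
  map_smul' c x := by
    rw [map_smul, LinearMap.lTensor_smul, LinearMap.smul_comp, LinearMap.comp_smul,
      RingHom.id_apply]

/-- `R_x^*` is adjoint to right multiplication by `x`. -/
theorem leftReg_adjoint {om : HopfOps k Hm} {op : HopfOps k Hp} {b : Hm →ₗ[k] Hp →ₗ[k] k}
    (h : IsHopfPairing om op b) (x y : Hm) (a : Hp) :
    b y (leftReg op b x a) = b (om.mul y x) a := by
  rw [h.mul_left]
  change b y (TensorProduct.rid k Hp ((b x).lTensor Hp (op.comul a))) = _
  induction op.comul a using TensorProduct.induction_on with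
  | zero => simp
  | tmul u v => simp [tensorPairing, mul_comm]
  | add u v hu hv => simp only [map_add, hu, hv]

/-- `x ⊗ a ↦ ∑ R_{x₍₁₎}^*(a) ⊗ x₍₂₎`. -/
noncomputable def heisCross (om : HopfOps k Hm) (op : HopfOps k Hp) (b : Hm →ₗ[k] Hp →ₗ[k] k) :
    Hm ⊗[k] Hp →ₗ[k] Hp ⊗[k] Hm :=
  (TensorProduct.lift (leftReg op b)).rTensor Hm ∘ₗ
    (TensorProduct.rightComm k Hm Hm Hp).toLinearMap ∘ₗ om.comul.rTensor Hp

/-- The multiplication `(a # x)(b # y) = ∑ a R_{x₍₁₎}^*(b) # x₍₂₎ y` of the Heisenberg double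
`H⁺ ⊗ H⁻`. -/
noncomputable def heisMul (om : HopfOps k Hm) (op : HopfOps k Hp) (b : Hm →ₗ[k] Hp →ₗ[k] k) :
    Hp ⊗[k] Hm →ₗ[k] Hp ⊗[k] Hm →ₗ[k] Hp ⊗[k] Hm :=
  TensorProduct.curry
    (TensorProduct.map (TensorProduct.lift op.mul) (TensorProduct.lift om.mul) ∘ₗ
      (TensorProduct.tensorTensorTensorAssoc k Hp Hp Hm Hm).symm.toLinearMap ∘ₗ
      ((heisCross om op b).lTensor Hp).rTensor Hm ∘ₗ
      (TensorProduct.tensorTensorTensorAssoc k Hp Hm Hp Hm).toLinearMap)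

/-- The Fock space action `(a # x)(b) = a R_x^*(b)` of the Heisenberg double on `H⁺`. -/
noncomputable def fockAct (op : HopfOps k Hp) (b : Hm →ₗ[k] Hp →ₗ[k] k) :
    Hp ⊗[k] Hm →ₗ[k] Module.End k Hp :=
  TensorProduct.lift ((LinearMap.llcomp k Hp Hp Hp).compl₁₂ op.mul (leftReg op b))

theorem fockAct_tmul (op : HopfOps k Hp) (b : Hm →ₗ[k] Hp →ₗ[k] k) (a c : Hp) (x : Hm) :
    fockAct op b (a ⊗ₜ x) c = op.mul a (leftReg op b x c) := rfl

end Pairing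

/-- `(H⁺, H⁻)` is a dual pair: both are graded connected, and `⟨·,·⟩ : H⁻ × H⁺ → k` is a Hopf
pairing which identifies each with the graded dual of the other. -/
structure IsDualPair {V W : ℕ → Type*} [∀ n, AddCommGroup (V n)] [∀ n, Module k (V n)]
    [∀ n, AddCommGroup (W n)] [∀ n, Module k (W n)] (om : HopfOps k (⨁ n, V n))
    (op : HopfOps k (⨁ n, W n)) (b : (⨁ n, V n) →ₗ[k] (⨁ n, W n) →ₗ[k] k) : Prop where
  minus : om.IsGradedConnected
  plus : op.IsGradedConnected
  hopf : IsHopfPairing om op b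
  perfect : ∀ n, (b.compl₁₂ (lof k ℕ V n) (lof k ℕ W n)).IsPerfPair
  orthogonal : ∀ m n, m ≠ n → ∀ (x : V m) (a : W n), b (lof k ℕ V m x) (lof k ℕ W n a) = 0

end Hopf

/-! ### Towers of algebras -/

/-- Algebra homomorphisms `R_i → S_{g(i)}`. -/
def AlgFamHom.ofFam {ι κ : Type} {F : Type u} [Field F] {R : ι → Type u} [∀ i, Ring (R i)]
    [∀ i, Algebra F (R i)] {S : κ → Type u} [∀ i, Ring (S i)] [∀ i, Algebra F (S i)] (g : ι → κ)
    (fib : ∀ j, (g ⁻¹' {j}).Finite) (φ : ∀ i, R i →ₐ[F] S (g i)) : AlgFamHom F R S where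
  g := g
  fib := fib
  hom := fun {i _} h => h ▸ φ i

/-- A tower of algebras. The external multiplication `ρ_{m,n} : A_m ⊗ A_n → A_{m+n}` is given, for
every `k` with a proof of `m + n = k`, as a map to `A_k`. -/
structure Tower (F : Type u) [Field F] where
  A : ℕ → Type u
  [ring : ∀ n, Ring (A n)]
  [algebra : ∀ n, Algebra F (A n)]
  [finite : ∀ n, Module.Finite F (A n)]
  zero_iso : Nonempty (A 0 ≃ₐ[F] F)
  ρ : ∀ {m n k : ℕ}, m + n = k → (A m ⊗[F] A n →ₐ[F] A k)
  ρ_assoc : ∀ {a b c ab bc abc : ℕ} (h₁ : a + b = ab) (h₂ : ab + c = abc) (h₃ : b + c = bc)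
    (h₄ : a + bc = abc) (x : A a) (y : A b) (z : A c),
    ρ h₂ (ρ h₁ (x ⊗ₜ y) ⊗ₜ z) = ρ h₄ (x ⊗ₜ ρ h₃ (y ⊗ₜ z))
  ρ_one_left : ∀ {n : ℕ} (x : A n), ρ (Nat.zero_add n) ((1 : A 0) ⊗ₜ x) = x
  ρ_one_right : ∀ {n : ℕ} (x : A n), ρ (Nat.add_zero n) (x ⊗ₜ (1 : A 0)) = x
  left_projective : ∀ {m n k : ℕ} (h : m + n = k), LeftProjective (ρ h)
  right_projective : ∀ {m n k : ℕ} (h : m + n = k), RightProjective (ρ h)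
  perfect : ∀ n, (pairing F (A n)).IsPerfPair

namespace Tower

attribute [instance] Tower.ring Tower.algebra Tower.finite

variable {F : Type u} [Field F] (T : Tower F)

/-- The algebras `A_m ⊗ A_n`. -/
abbrev A₂ : ℕ × ℕ → Type u := Tens F T.A T.A

/-- The algebras `(A_a ⊗ A_b) ⊗ (A_c ⊗ A_d)`. -/
abbrev A₄ : (ℕ × ℕ) × (ℕ × ℕ) → Type u := Tens F T.A₂ T.A₂

/-- The direct sum of categories `A-mod = ⨁ n, A_n-mod`. -/
abbrev Md : Type (u + 1) := GrMod T.A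

/-- The direct sum of categories `A-mod^{⊗2}`. -/
abbrev Md₂ : Type (u + 1) := GrMod T.A₂

/-- The direct sum of categories `A-mod^{⊗4}`. -/
abbrev Md₄ : Type (u + 1) := GrMod T.A₄

theorem fib_add (k : ℕ) : ((fun p : ℕ × ℕ => p.1 + p.2) ⁻¹' {k}).Finite := by
  refine (Finset.HasAntidiagonal.antidiagonal k).finite_toSet.subset ?_
  intro p hp
  simpa using hp

/-- The external multiplications `A_m ⊗ A_n → A_{m+n}`. -/
noncomputable def mult : AlgFamHom F T.A₂ T.A where
  g p := p.1 + p.2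
  fib := fib_add
  hom h := T.ρ h

/-- The maps `ρ ⊗ ρ : (A_a ⊗ A_b) ⊗ (A_c ⊗ A_d) → A_{a+b} ⊗ A_{c+d}`. -/
noncomputable def mult₂ : AlgFamHom F T.A₄ T.A₂ where
  g p := (p.1.1 + p.1.2, p.2.1 + p.2.2)
  fib j := by
    refine ((fib_add j.1).prod (fib_add j.2)).subset ?_
    rintro p hp
    exact ⟨congrArg Prod.fst hp, congrArg Prod.snd hp⟩
  hom h := Algebra.TensorProduct.map (T.ρ (congrArg Prod.fst h)) (T.ρ (congrArg Prod.snd h))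

/-- The isomorphisms `(A_a ⊗ A_b) ⊗ (A_c ⊗ A_d) ≅ (A_a ⊗ A_c) ⊗ (A_b ⊗ A_d)`. -/
noncomputable def swap₂₃ : AlgFamHom F T.A₄ T.A₄ :=
  AlgFamHom.ofFam (fun p => ((p.1.1, p.2.1), (p.1.2, p.2.2)))
    (fun j => (Set.finite_singleton ((j.1.1, j.2.1), (j.1.2, j.2.2))).subset (by
      rintro p rfl
      rfl))
    (fun p => (Algebra.TensorProduct.tensorTensorTensorComm F F F F (T.A p.1.1) (T.A p.1.2)
      (T.A p.2.1) (T.A p.2.2)).toAlgHom)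

/-- `∇ : A-mod^{⊗2} → A-mod`, given by induction from `A_m ⊗ A_n` to `A_{m+n}`. -/
noncomputable def nabla : T.Md₂ ⥤ T.Md := grInd T.mult

/-- `Δ : A-mod → A-mod^{⊗2}`, given by restriction from `A_{k+l}` to `A_k ⊗ A_l`. -/
noncomputable def delta : T.Md ⥤ T.Md₂ := grRes T.mult

/-- `∇^{⊗2} : A-mod^{⊗4} → A-mod^{⊗2}`. -/
noncomputable def nabla₂ : T.Md₄ ⥤ T.Md₂ := grInd T.mult₂

/-- `Δ^{⊗2} : A-mod^{⊗2} → A-mod^{⊗4}`. -/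
noncomputable def delta₂ : T.Md₂ ⥤ T.Md₄ := grRes T.mult₂

/-- `S_{23} : A-mod^{⊗4} → A-mod^{⊗4}` interchanges the second and the third factor. -/
noncomputable def s₂₃ : T.Md₄ ⥤ T.Md₄ := grRes T.swap₂₃

/-- `M ⊗ -` as a functor `A-mod → A-mod^{⊗2}`. -/
noncomputable def ext (M : T.Md) : T.Md ⥤ T.Md₂ := grExt F M

/-- `Ind_M(N) = ∇(M ⊗ N)`. -/
noncomputable def Ind (M : T.Md) : T.Md ⥤ T.Md := T.ext M ⋙ T.nabla

/-- `Res_P(N) = ⨁ Hom_{A_p}(P_p, Res^{A_{k+p}}_{A_k ⊗ A_p} N_{k+p})`, in degree `k`. -/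
noncomputable def Res (P : T.Md) : T.Md ⥤ T.Md := T.delta ⋙ grHom P

/-- `Res_Q(X) = Hom(Q, S_{23} Δ^{⊗2} X)` for `Q` in `A-mod^{⊗2}`; for `X = M ⊗ N` its component over
`A_a ⊗ A_b` is
`⨁ Hom_{A_p ⊗ A_q}(Q_{p,q}, S_{23}(Res_{A_a ⊗ A_p} M_{a+p} ⊗ Res_{A_b ⊗ A_q} N_{b+q}))`. -/
noncomputable def Res₂ (Q : T.Md₂) : T.Md₂ ⥤ T.Md₂ := T.delta₂ ⋙ T.s₂₃ ⋙ grHom Q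

/-! ### Strong towers -/

section Conj

variable (ψ : ∀ n, T.A n ≃ₐ[F] T.A n)

/-- `Ψ`: the module `Ψ(M)` is `M` with the action of `a ∈ A_n` given by that of `ψ_n⁻¹(a)`. -/
noncomputable def twist : T.Md ⥤ T.Md :=
  grRes (AlgFamHom.ofFam id (fun j => Set.finite_singleton j) fun n => (ψ n).symm.toAlgHom)

/-- `Ψ⁻¹`. -/
noncomputable def twistInv : T.Md ⥤ T.Md :=
  grRes (AlgFamHom.ofFam id (fun j => Set.finite_singleton j) fun n => (ψ n).toAlgHom)

/-- `Ψ^{⊗2}`. -/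
noncomputable def twist₂ : T.Md₂ ⥤ T.Md₂ :=
  grRes (AlgFamHom.ofFam id (fun j => Set.finite_singleton j) fun p =>
    Algebra.TensorProduct.map (ψ p.1).symm.toAlgHom (ψ p.2).symm.toAlgHom)

/-- `Ψ^{⊗2} Δ Ψ⁻¹`. -/
noncomputable def conjDelta : T.Md ⥤ T.Md₂ := T.twistInv ψ ⋙ T.delta ⋙ T.twist₂ ψ

/-- The tower is strong with conjugation `Ψ`: induction `∇` is right adjoint to `Ψ^{⊗2} Δ Ψ⁻¹`, and
`Δ ∇ ≅ ∇^{⊗2} S_{23} Δ^{⊗2}`. -/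
structure IsStrongWith : Prop where
  adjoint : Nonempty (T.conjDelta ψ ⊣ T.nabla)
  mackey : Nonempty (T.nabla ⋙ T.delta ≅ T.delta₂ ⋙ T.s₂₃ ⋙ T.nabla₂)

end Conj

/-! ### The Hopf algebras `𝒢(A)` and `𝒦(A)` -/

/-- `⨁ n, Groth(A_n)`. -/
abbrev Gr (c : ModKind) : Type (u + 1) := ⨁ n, Groth c (T.A n)

/-- `⨁ (m, n), Groth(A_m ⊗ A_n)`. -/
abbrev Gr₂ (c : ModKind) : Type (u + 1) := ⨁ p, Groth c (T.A₂ p)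

/-- `𝒢(A) = ⨁ n, G₀(A_n)`. -/
abbrev G : Type (u + 1) := T.Gr .fg

/-- `𝒦(A) = ⨁ n, K₀(A_n)`. -/
abbrev K : Type (u + 1) := T.Gr .proj

/-- The map `[M] ⊗ [N] ↦ [M ⊗ N]`. -/
noncomputable def grothExt (c : ModKind) : T.Gr c ⊗[ℤ] T.Gr c →ₗ[ℤ] T.Gr₂ c :=
  DirectSum.lmap (fun p : ℕ × ℕ => TensorProduct.lift (Groth.ext F c (T.A p.1) (T.A p.2))) ∘ₗ
    (TensorProduct.directSum ℤ ℤ (fun n => Groth c (T.A n)) (fun n => Groth c (T.A n))).toLinearMap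

/-- The map induced by `∇`. -/
noncomputable def grothNabla (c : ModKind) : T.Gr₂ c →ₗ[ℤ] T.Gr c :=
  DirectSum.toModule ℤ (ℕ × ℕ) (T.Gr c) fun p =>
    lof ℤ ℕ (fun n => Groth c (T.A n)) (p.1 + p.2) ∘ₗ
      Groth.ind c (T.ρ (rfl : p.1 + p.2 = p.1 + p.2)) (T.right_projective rfl)

/-- The map induced by `Δ`. -/
noncomputable def grothDelta (c : ModKind) : T.Gr c →ₗ[ℤ] T.Gr₂ c :=
  DirectSum.toModule ℤ ℕ (T.Gr₂ c) fun n =>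
    ∑ p : {p : ℕ × ℕ // p ∈ Finset.HasAntidiagonal.antidiagonal n},
      lof ℤ (ℕ × ℕ) (fun p => Groth c (T.A₂ p)) p.1 ∘ₗ
        Groth.res c (T.ρ (Finset.HasAntidiagonal.mem_antidiagonal.1 p.2)) (T.left_projective _)

theorem isKind_regular (c : ModKind) : IsKind c (T.A 0) (ModuleCat.of (T.A 0) (T.A 0)) := by
  cases c
  · exact inferInstanceAs (Module.Finite (T.A 0) (T.A 0))
  · exact ⟨inferInstanceAs (Module.Finite (T.A 0) (T.A 0)),
      inferInstanceAs (Module.Projective (T.A 0) (T.A 0))⟩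

open Classical in
/-- The operations on `𝒢(A)` and `𝒦(A)` induced by `∇`, `Δ`, `η`, `ε`. The coproduct of `x` is the
element of the tensor square that corresponds to `Δ(x)` under the isomorphism
`[M] ⊗ [N] ↦ [M ⊗ N]`. -/
noncomputable def ops (c : ModKind) : HopfOps ℤ (T.Gr c) where
  mul := TensorProduct.curry (T.grothNabla c ∘ₗ T.grothExt c)
  one := lof ℤ ℕ (fun n => Groth c (T.A n)) 0 (Groth.mk _ (T.isKind_regular c))
  comul := if h : Function.Bijective (T.grothExt c) then
    (LinearEquiv.ofBijective (T.grothExt c) h).symm.toLinearMap ∘ₗ T.grothDelta c else 0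
  counit := Groth.dim F c (T.A 0) ∘ₗ DirectSum.component ℤ ℕ (fun n => Groth c (T.A n)) 0

/-- The pairing `⟨[P], [M]⟩ = dim Hom_{A_n}(P, M)` of `𝒦(A)` and `𝒢(A)`. -/
noncomputable def pair : T.K →ₗ[ℤ] T.G →ₗ[ℤ] ℤ :=
  DirectSum.toModule ℤ ℕ (T.G →ₗ[ℤ] ℤ) fun n =>
    (pairing F (T.A n)).compl₂ (DirectSum.component ℤ ℕ (fun n => G₀ (T.A n)) n)

/-- The tower is dualizing: `𝒦(A)` and `𝒢(A)` are dual Hopf algebras. -/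
def IsDualizing : Prop := IsDualPair (T.ops .proj) (T.ops .fg) T.pair

/-! ### Heisenberg doubles and Fock spaces -/

/-- The underlying group `𝒢(A) ⊗ 𝒦(A)` of the Heisenberg double `𝔥(A)`. -/
abbrev Heis : Type (u + 1) := T.G ⊗[ℤ] T.K

/-- The multiplication of `𝔥(A)`. -/
noncomputable def hMul : T.Heis →ₗ[ℤ] T.Heis →ₗ[ℤ] T.Heis :=
  heisMul (T.ops .proj) (T.ops .fg) T.pair

/-- The unit of `𝔥(A)`. -/
noncomputable def hOne : T.Heis := (T.ops .fg).one ⊗ₜ (T.ops .proj).one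

/-- The action of `𝒦(A)` on `𝒢(A)`, `x ↦ R_x^*`. -/
noncomputable def regAct : T.K →ₗ[ℤ] Module.End ℤ T.G := leftReg (T.ops .fg) T.pair

/-- The action of `𝔥(A)` on the lowest weight Fock space `ℱ(A) = 𝒢(A)`. -/
noncomputable def fock : T.Heis →ₗ[ℤ] Module.End ℤ T.G := fockAct (T.ops .fg) T.pair

/-- `𝒢_proj(A)`, the image of the Cartan map `𝒦(A) → 𝒢(A)`. It is the lowest weight Fock space of
`𝔥_proj(A)`. -/
noncomputable def Gproj : Submodule ℤ T.G :=
  LinearMap.range (DirectSum.lmap fun n => Groth.cartan (T.A n))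

/-- The projective Heisenberg double `𝔥_proj(A) = 𝒢_proj(A) # 𝒦(A)`, inside `𝔥(A)`. -/
noncomputable def HeisProj : Submodule ℤ T.Heis :=
  LinearMap.range (TensorProduct.map T.Gproj.subtype (LinearMap.id : T.K →ₗ[ℤ] T.K))

end Tower

section Classes

variable {ι : Type} [DecidableEq ι] {R : ι → Type u} [∀ i, Ring (R i)]

/-- The class `∑_i [X_i]` of an object all of whose components are of kind `c`. -/
noncomputable def grCls (c : ModKind) (X : GrMod R) (h : ∀ i, IsKind c (R i) (X.obj i)) :
    ⨁ i, Groth c (R i) :=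
  ∑ i ∈ X.property.2.toFinset, lof ℤ ι (fun i => Groth c (R i)) i (Groth.mk (X.obj i) (h i))

/-- The class `[X]₊`. -/
noncomputable def clsG (X : GrMod R) : ⨁ i, G₀ (R i) := grCls .fg X X.property.1

/-- The class `[X]₋` of an object with projective components. -/
noncomputable def clsK (X : GrMod R) (h : IsProj R X) : ⨁ i, K₀ (R i) :=
  grCls .proj X fun i => ⟨X.property.1 i, h i⟩

end Classes

namespace Tower

variable {F : Type u} [Field F] (T : Tower F)

/-- The functor `Φ` induces the endomorphism `f` of `𝒢(A)`. -/
def Induces (Φ : T.Md ⥤ T.Md) (f : Module.End ℤ T.G) : Prop :=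
  ∀ X : T.Md, clsG (Φ.obj X) = f (clsG X)

/-- The endomorphism `b ↦ ∇(R_{Δ(x)}^*(a ⊗ b))` of `𝒢(A)`. -/
noncomputable def crossAct (x : T.K) (a : T.G) : Module.End ℤ T.G :=
  TensorProduct.lift (T.ops .fg).mul ∘ₗ
    TensorProduct.map₂ T.regAct T.regAct ((T.ops .proj).comul x) ∘ₗ TensorProduct.mk ℤ T.G T.G a

/-- The functors `Ind_M` and `Res_P` on `A-mod`, with the isomorphisms `Ind_M Ind_N ≅ Ind_{∇(M ⊗ N)}`,
`Res_P Res_Q ≅ Res_{∇(P ⊗ Q)}` and `Res_P Ind_M ≅ ∇ Res_{Δ(P)}(M ⊗ -)`, categorify the lowest weight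
Fock space representation of `𝔥(A)`. -/
structure CategorifiesFock : Prop where
  /-- `ℱ(A)` is a representation of `𝔥(A)` -/
  fock_one : T.fock T.hOne = 1
  fock_mul : ∀ α β, T.fock (T.hMul α β) = T.fock α * T.fock β
  /-- the functors induce the action of `𝔥(A)` on `ℱ(A)` -/
  ind : ∀ M, T.Induces (T.Ind M) ((T.ops .fg).mul (clsG M))
  res : ∀ P (hP : IsProj T.A P), T.Induces (T.Res P) (T.regAct (clsK P hP))
  act : ∀ M P (hP : IsProj T.A P),
    T.Induces (T.Res P ⋙ T.Ind M) (T.fock (clsG M ⊗ₜ clsK P hP))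
  /-- the multiplication of `𝒢(A)` -/
  mul_G : ∀ M N, clsG (T.nabla.obj ((T.ext M).obj N)) = (T.ops .fg).mul (clsG M) (clsG N)
  iso_ind : ∀ M N, Nonempty (T.Ind N ⋙ T.Ind M ≅ T.Ind (T.nabla.obj ((T.ext M).obj N)))
  /-- the multiplication of `𝒦(A)` -/
  mul_K : ∀ P Q (hP : IsProj T.A P) (hQ : IsProj T.A Q),
    ∃ h : IsProj T.A (T.nabla.obj ((T.ext P).obj Q)),
      clsK _ h = (T.ops .proj).mul (clsK P hP) (clsK Q hQ)
  iso_res : ∀ P Q, IsProj T.A P → IsProj T.A Q →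
    Nonempty (T.Res Q ⋙ T.Res P ≅ T.Res (T.nabla.obj ((T.ext P).obj Q)))
  /-- the relation `R_x^* ∘ L_a = ∇(R_{Δ(x)}^*(a ⊗ -))` between `𝒢(A)` and `𝒦(A)` -/
  rel_cross : ∀ x a, T.regAct x * (T.ops .fg).mul a = T.crossAct x a
  comul_K : ∀ P (hP : IsProj T.A P), ∃ h : IsProj T.A₂ (T.delta.obj P),
    T.grothExt .proj ((T.ops .proj).comul (clsK P hP)) = clsK _ h
  cross : ∀ M P (hP : IsProj T.A P),
    T.Induces (T.ext M ⋙ T.Res₂ (T.delta.obj P) ⋙ T.nabla) (T.crossAct (clsK P hP) (clsG M))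
  iso_cross : ∀ M P, IsProj T.A P →
    Nonempty (T.Ind M ⋙ T.Res P ≅ T.ext M ⋙ T.Res₂ (T.delta.obj P) ⋙ T.nabla)

/-- The restrictions to `A-pmod` of the functors `Ind_M` and `Res_P`, for `M` and `P` in `A-pmod`,
with the same isomorphisms, categorify the lowest weight Fock space representation of
`𝔥_proj(A)`. -/
structure CategorifiesProjFock : Prop where
  /-- `𝔥_proj(A)` is a subalgebra of `𝔥(A)` that acts on `ℱ_proj(A) = 𝒢_proj(A)` -/
  one_mem : T.hOne ∈ T.HeisProj
  mul_mem : ∀ α ∈ T.HeisProj, ∀ β ∈ T.HeisProj, T.hMul α β ∈ T.HeisProj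
  fock_mem : ∀ α ∈ T.HeisProj, ∀ v ∈ T.Gproj, T.fock α v ∈ T.Gproj
  cls_mem : ∀ X, IsProj T.A X → clsG X ∈ T.Gproj
  /-- the functors preserve `A-pmod` -/
  proj_ind : ∀ M, IsProj T.A M → ∀ X, IsProj T.A X → IsProj T.A ((T.Ind M).obj X)
  proj_res : ∀ P, IsProj T.A P → ∀ X, IsProj T.A X → IsProj T.A ((T.Res P).obj X)
  proj_cross : ∀ M P, IsProj T.A M → IsProj T.A P → ∀ X, IsProj T.A X →
    IsProj T.A ((T.ext M ⋙ T.Res₂ (T.delta.obj P) ⋙ T.nabla).obj X)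
  /-- the functors induce the action of `𝔥_proj(A)` on `ℱ_proj(A)` -/
  act : ∀ M P (hM : IsProj T.A M) (hP : IsProj T.A P) (X : GrPMod T.A),
    clsG ((restrictProj (T.Res P) (proj_res P hP) ⋙
      restrictProj (T.Ind M) (proj_ind M hM)).obj X).obj =
      T.fock (clsG M ⊗ₜ clsK P hP) (clsG X.obj)
  /-- the isomorphisms of functors on `A-pmod` that lift the relations of `𝔥_proj(A)` -/
  iso_ind : ∀ M N (hM : IsProj T.A M) (hN : IsProj T.A N),
    Nonempty (restrictProj (T.Ind N) (proj_ind N hN) ⋙ restrictProj (T.Ind M) (proj_ind M hM) ≅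
      restrictProj (T.Ind (T.nabla.obj ((T.ext M).obj N))) (proj_ind _ (proj_ind M hM N hN)))
  iso_res : ∀ P Q (hP : IsProj T.A P) (hQ : IsProj T.A Q),
    Nonempty (restrictProj (T.Res Q) (proj_res Q hQ) ⋙ restrictProj (T.Res P) (proj_res P hP) ≅
      restrictProj (T.Res (T.nabla.obj ((T.ext P).obj Q))) (proj_res _ (proj_ind P hP Q hQ)))
  iso_cross : ∀ M P (hM : IsProj T.A M) (hP : IsProj T.A P),
    Nonempty (restrictProj (T.Ind M) (proj_ind M hM) ⋙ restrictProj (T.Res P) (proj_res P hP) ≅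
      restrictProj (T.ext M ⋙ T.Res₂ (T.delta.obj P) ⋙ T.nabla) (proj_cross M P hM hP))

end Tower

end TowerAlg

/-! The first two isomorphisms of functors are formal. Composing two inductions is associativity of
the tensor product: by `ρ_assoc`, the rule m ⊗ (n ⊗ x) ↦ (m ⊗ n) ⊗ x is well defined in both
directions (`assocEquiv`). Composing two restrictions is the adjunction of tensor product and Hom: a
family of maps P_j → Hom(Q_i, X) is a map out of the module induced from P_j ⊗ Q_i (`resCompEquiv`).

The functor Res_P Ind_M is Hom(P, Δ∇(M ⊗ -)), and the Mackey isomorphism turns Δ∇ into ∇^{⊗2} S₂₃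
Δ^{⊗2}. What remains is Hom(P, ∇^{⊗2} Y) ≅ ∇ Hom(Ψ^{⊗2}ΔΨ⁻¹(P), Y). The two inductions inside ∇^{⊗2}
play different roles. The one in the variable seen by P is moved onto P by the adjunction, with the
other index of Y held fixed (`adjMap_bijective`). The other one comes out of the Hom because P is
finitely generated projective (`homInd_bijective`).

On Grothendieck groups, Ind_M is multiplication by [M]. For projective P one has Hom(P, M ⊗ N) ≅ M^d
with d = dim Hom(P, N), so Res_P contracts the coproduct with [P], which is the operator R^*_{[P]}
(`clsG_res`). The Fock space relations are then identities in a dual pair of bialgebras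
(`leftReg_mul`, `leftReg_cross`, `fockAct_mul`).

To remove Ψ for a dualizing tower, compare Δ(P) with Ψ^{⊗2}ΔΨ⁻¹(P). The Hopf pairing gives ⟨Δ[P], z⟩
= ⟨[P], ∇z⟩, and the adjunction gives the same formula for the conjugated coproduct. Both modules
are projective and have Hom spaces of equal dimension into every finitely generated module. Over a
finite-dimensional algebra this determines a finitely generated projective module up to isomorphism
(`nonempty_linearEquiv_of_finrank_hom_eq`).

The projective version follows because Ind_M and Res_P preserve projectivity and the image of the
Cartan map is generated by the classes of projective objects. -/

namespace TowerAlg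

/-! ### Isomorphisms of graded modules and of functors, degree by degree -/

section GradedIso

variable {ι : Type} {R : ι → Type u} [∀ i, Ring (R i)]

/-- Degreewise linear equivalences give an isomorphism of graded modules. -/
noncomputable def gradedIso (X Y : GrMod R) (e : ∀ i, X.obj i ≃ₗ[R i] Y.obj i) : X ≅ Y :=
  ObjectProperty.isoMk _ (Pi.isoMk fun i => (e i).toModuleIso)

/-- An isomorphism of graded modules gives degreewise linear equivalences. -/
noncomputable def gradedLinearEquiv {X Y : GrMod R} (e : X ≅ Y) (i : ι) :
    X.obj i ≃ₗ[R i] Y.obj i :=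
  (Pi.isoApp ((IsFinFam R).ι.mapIso e) i).toLinearEquiv

/-- Natural degreewise linear equivalences give an isomorphism of functors. -/
theorem nonempty_natIso {C : Type*} [Category C] {Φ Ψ : C ⥤ GrMod R}
    (e : ∀ X i, (Φ.obj X).obj i ≃ₗ[R i] (Ψ.obj X).obj i)
    (h : ∀ {X Y : C} (f : X ⟶ Y) (i : ι) (x : (Φ.obj X).obj i),
      e Y i (((Φ.map f).hom i).hom x) = ((Ψ.map f).hom i).hom (e X i x)) :
    Nonempty (Φ ≅ Ψ) :=
  ⟨NatIso.ofComponents (fun X => gradedIso _ _ (e X)) fun f => by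
    apply ObjectProperty.hom_ext
    funext i
    apply ModuleCat.hom_ext
    ext x
    exact h f i x⟩

theorem nonempty_restrictProj_iso {κ : Type} {S : κ → Type u} [∀ i, Ring (S i)]
    {Φ Ψ : GrMod R ⥤ GrMod S} (hΦ : ∀ X, IsProj R X → IsProj S (Φ.obj X))
    (hΨ : ∀ X, IsProj R X → IsProj S (Ψ.obj X)) (e : Nonempty (Φ ≅ Ψ)) :
    Nonempty (restrictProj Φ hΦ ≅ restrictProj Ψ hΨ) := by
  obtain ⟨e⟩ := e
  exact ⟨NatIso.ofComponents (fun X => ObjectProperty.isoMk _ (e.app X.obj)) fun f => by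
    apply ObjectProperty.hom_ext
    exact e.hom.naturality f.hom⟩

theorem IsProj.of_iso {X Y : GrMod R} (e : X ≅ Y) (h : IsProj R X) : IsProj R Y := fun i =>
  have := h i
  Module.Projective.of_equiv (gradedLinearEquiv e i)

end GradedIso

/-! ### Universal properties of induction and of the external tensor product -/

section Ungraded

variable {F : Type u} [Field F]
variable {R S B : Type u} [Ring R] [Algebra F R] [Ring S] [Algebra F S] [Ring B] [Algebra F B]

theorem indTmul_add (φ : R →ₐ[F] S) {N : ModuleCat.{u} R} (s : S) (m n : N) :
    indTmul φ s (m + n) = indTmul φ s m + indTmul φ s n := by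
  simp only [indTmul, TensorProduct.tmul_add, Submodule.Quotient.mk_add]

theorem indTmul_add_left (φ : R →ₐ[F] S) {N : ModuleCat.{u} R} (s t : S) (n : N) :
    indTmul φ (s + t) n = indTmul φ s n + indTmul φ t n := by
  simp only [indTmul, TensorProduct.add_tmul, Submodule.Quotient.mk_add]

theorem smul_indTmul (φ : R →ₐ[F] S) {N : ModuleCat.{u} R} (t s : S) (n : N) :
    t • indTmul φ s n = indTmul φ (t * s) n := rfl

theorem indTmul_eq_smul (φ : R →ₐ[F] S) {N : ModuleCat.{u} R} (s : S) (n : N) :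
    indTmul φ s n = s • indTmul φ 1 n := by
  rw [smul_indTmul, mul_one]

/-- `n ↦ 1 ⊗ n`. -/
noncomputable def indUnit (φ : R →ₐ[F] S) (N : ModuleCat.{u} R) : N →+ IndMod φ N :=
  AddMonoidHom.mk' (indTmul φ 1) (indTmul_add φ 1)

/-- The linear map `S ⊗_R N → V` induced by a map `N → V` that is linear along `φ`. -/
noncomputable def indLift (φ : R →ₐ[F] S) {N : ModuleCat.{u} R} {V : Type*} [AddCommGroup V]
    [Module S V] (h : N →+ V) (hh : ∀ (r : R) n, h (r • n) = φ r • h n) : IndMod φ N →ₗ[S] V :=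
  -- Only an `S`-module structure on `V` is given; pulling it back to `F` allows a lift from the
  -- tensor product over `F`.
  letI : Module F V := Module.compHom V (algebraMap F S)
  haveI : IsScalarTower F S V := ⟨fun c s v => by
    rw [Algebra.smul_def, mul_smul]
    rfl⟩
  Submodule.liftQ _ (AlgebraTensorModule.lift
    { toFun := fun s =>
        { toFun := fun n => s • h n
          map_add' := fun m n => by rw [map_add, smul_add]
          map_smul' := fun c n => by
            have h1 : c • n = algebraMap F R c • n := rfl
            have h2 : c • (s • h n) = algebraMap F S c • (s • h n) := rfl
            rw [h1, hh, φ.commutes, RingHom.id_apply, h2, smul_smul, smul_smul,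
              Algebra.commutes] }
      map_add' := fun s t => by
        ext n
        exact add_smul _ _ _
      map_smul' := fun s t => by
        ext n
        exact mul_smul _ _ _ }) (by
    refine Submodule.span_le.2 ?_
    rintro _ ⟨s, r, n, rfl⟩
    change AlgebraTensorModule.lift _ _ = 0
    rw [map_sub]
    change (s * φ r) • h n - s • h (r • n) = 0
    rw [hh, mul_smul, sub_self])

@[simp] theorem indLift_tmul (φ : R →ₐ[F] S) {N : ModuleCat.{u} R} {V : Type*} [AddCommGroup V]
    [Module S V] (h : N →+ V) (hh : ∀ (r : R) n, h (r • n) = φ r • h n) (s : S) (n : N) :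
    indLift φ h hh (indTmul φ s n) = s • h n := rfl

/-- The elements 1 ⊗ n generate the induced module over `S`. -/
theorem indMod_linear_ext (φ : R →ₐ[F] S) {N : ModuleCat.{u} R} {V : Type*} [AddCommGroup V]
    [Module S V] {f g : IndMod φ N →ₗ[S] V} (h : ∀ n, f (indTmul φ 1 n) = g (indTmul φ 1 n)) :
    f = g :=
  LinearMap.toAddMonoidHom_injective (indMod_hom_ext φ fun s n => by
    change f _ = g _
    rw [indTmul_eq_smul, map_smul, map_smul, h])

theorem extTmul_add {M : ModuleCat.{u} R} {N : ModuleCat.{u} S} (m : M) (n n' : N) :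
    extTmul F m (n + n') = extTmul F m n + extTmul F m n' := TensorProduct.tmul_add _ _ _

theorem extTmul_add_left {M : ModuleCat.{u} R} {N : ModuleCat.{u} S} (m m' : M) (n : N) :
    extTmul F (m + m') n = extTmul F m n + extTmul F m' n := TensorProduct.add_tmul _ _ _

/-- The additive map on the external tensor product induced by a biadditive map that is
semilinear along `φ : R ⊗ S → B`. -/
noncomputable def extLift (φ : R ⊗[F] S →ₐ[F] B) {M : ModuleCat.{u} R} {N : ModuleCat.{u} S}
    {V : Type*} [AddCommGroup V] [Module B V] (β : M →+ N →+ V)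
    (hβ : ∀ (r : R) (s : S) m n, β (r • m) (s • n) = φ (r ⊗ₜ s) • β m n) :
    ExtTensor F M N →+ V :=
  TensorProduct.liftAddHom β fun c m n => by
    -- Moving a scalar c across the tensor sign is legitimate because c ⊗ 1 = 1 ⊗ c in `R ⊗ S`, and
    -- β sees c only through this element.
    have h1 := hβ (algebraMap F R c) 1 m n
    have h2 := hβ 1 (algebraMap F S c) m n
    rw [one_smul] at h1 h2
    have h3 : (algebraMap F R c ⊗ₜ (1 : S) : R ⊗[F] S) = 1 ⊗ₜ algebraMap F S c := by
      rw [Algebra.algebraMap_eq_smul_one, Algebra.algebraMap_eq_smul_one, TensorProduct.smul_tmul]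
    rw [h3, ← h2] at h1
    exact h1

@[simp] theorem extLift_tmul (φ : R ⊗[F] S →ₐ[F] B) {M : ModuleCat.{u} R} {N : ModuleCat.{u} S}
    {V : Type*} [AddCommGroup V] [Module B V] (β : M →+ N →+ V)
    (hβ : ∀ (r : R) (s : S) m n, β (r • m) (s • n) = φ (r ⊗ₜ s) • β m n) (m : M) (n : N) :
    extLift φ β hβ (extTmul F m n) = β m n := rfl

theorem extLift_smul (φ : R ⊗[F] S →ₐ[F] B) {M : ModuleCat.{u} R} {N : ModuleCat.{u} S}
    {V : Type*} [AddCommGroup V] [Module B V] (β : M →+ N →+ V)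
    (hβ : ∀ (r : R) (s : S) m n, β (r • m) (s • n) = φ (r ⊗ₜ s) • β m n) (a : R ⊗[F] S)
    (x : ExtTensor F M N) : extLift φ β hβ (a • x) = φ a • extLift φ β hβ x := by
  induction a using TensorProduct.induction_on with
  | zero => simp
  | add a b ha hb => simp only [add_smul, map_add, ha, hb]
  | tmul r s =>
    refine extTensor_induction (p := fun x => extLift φ β hβ ((r ⊗ₜ[F] s) • x) =
      φ (r ⊗ₜ[F] s) • extLift φ β hβ x) ?_ (fun m n => ?_) (fun x y hx hy => ?_) x
    · simp
    · rw [extTensor_smul_tmul, extLift_tmul, extLift_tmul, hβ]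
    · simp only [smul_add, map_add, hx, hy]

end Ungraded

theorem sum_comp_proj_single {B ι W : Type*} [Ring B] [Fintype ι] [DecidableEq ι] {V : ι → Type*}
    [∀ i, AddCommGroup (V i)] [∀ i, Module B (V i)] [AddCommGroup W] [Module B W]
    (f : ∀ i, V i →ₗ[B] W) (i : ι) (x : V i) :
    (∑ i, f i ∘ₗ LinearMap.proj i : (∀ i, V i) →ₗ[B] W) (Pi.single i x) = f i x := by
  rw [LinearMap.sum_apply, Finset.sum_eq_single i]
  · rw [LinearMap.comp_apply, LinearMap.proj_apply, Pi.single_eq_same]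
  · intro b _ hb
    rw [LinearMap.comp_apply, LinearMap.proj_apply, Pi.single_eq_of_ne hb, map_zero]
  · intro hn
    exact absurd (Finset.mem_univ _) hn

/-! ### Generators and universal property of graded induction -/

section GradedInduction

variable {ι κ : Type} {F : Type u} [Field F]
variable {R : ι → Type u} [∀ i, Ring (R i)] [∀ i, Algebra F (R i)] [∀ i, Module.Finite F (R i)]
variable {S : κ → Type u} [∀ i, Ring (S i)] [∀ i, Algebra F (S i)] [∀ i, Module.Finite F (S i)]

open Classical in
/-- The generator `1 ⊗ x` of the induced module. -/
noncomputable def grIndMk (φ : AlgFamHom F R S) {X : GrMod R} {i : ι} {j : κ} (h : φ.g i = j) :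
    X.obj i →+ ((grInd φ).obj X).obj j :=
  (AddMonoidHom.single (fun i : {i // φ.g i = j} => IndMod (φ.hom i.2) (X.obj i.1)) ⟨i, h⟩).comp
    (indUnit (φ.hom h) (X.obj i))

open Classical in
theorem grIndMk_apply (φ : AlgFamHom F R S) {X : GrMod R} {i : ι} {j : κ} (h : φ.g i = j)
    (x : X.obj i) : grIndMk φ h x =
      (Pi.single (⟨i, h⟩ : {i // φ.g i = j}) (indTmul (φ.hom h) 1 x) :
        ∀ i : {i // φ.g i = j}, IndMod (φ.hom i.2) (X.obj i.1)) := rfl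

theorem grIndMk_smul (φ : AlgFamHom F R S) {X : GrMod R} {i : ι} {j : κ} (h : φ.g i = j) (r : R i)
    (x : X.obj i) : grIndMk φ h (r • x) = φ.hom h r • grIndMk φ h x := by
  classical
  rw [grIndMk_apply, indTmul_smul, one_mul, indTmul_eq_smul]
  exact Pi.single_smul (f := fun i : {i // φ.g i = j} => IndMod (φ.hom i.2) (X.obj i.1))
    ⟨i, h⟩ (φ.hom h r) (indTmul (φ.hom h) 1 x)

theorem grInd_map_mk (φ : AlgFamHom F R S) {X Y : GrMod R} (f : X ⟶ Y) {i : ι} {j : κ}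
    (h : φ.g i = j) (x : X.obj i) :
    (((grInd φ).map f).hom j).hom (grIndMk φ h x) = grIndMk φ h ((f.hom i).hom x) := by
  classical
  refine funext fun i' : {i // φ.g i = j} => ?_
  change indMap (φ.hom i'.2) (f.hom i'.1).hom (Pi.single (M := fun i : {i // φ.g i = j} =>
    IndMod (φ.hom i.2) (X.obj i.1)) ⟨i, h⟩ (indTmul (φ.hom h) 1 x) i') = _
  rw [grIndMk_apply]
  by_cases hi : i' = ⟨i, h⟩
  · subst hi
    rw [Pi.single_eq_same, Pi.single_eq_same, indMap_tmul]
  · rw [Pi.single_eq_of_ne hi, Pi.single_eq_of_ne hi, map_zero]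

/-- The universal property of the induced module, in degree `j`. -/
noncomputable def grIndLift (φ : AlgFamHom F R S) {X : GrMod R} {j : κ} {V : Type*}
    [AddCommGroup V] [Module (S j) V] (β : ∀ i, φ.g i = j → (X.obj i →+ V))
    (hβ : ∀ i h (r : R i) x, β i h (r • x) = φ.hom h r • β i h x) :
    ((grInd φ).obj X).obj j →ₗ[S j] V :=
  letI : Fintype {i // φ.g i = j} := @Fintype.ofFinite _ (φ.fib j)
  (∑ i : {i // φ.g i = j}, indLift (φ.hom i.2) (β i.1 i.2) (hβ i.1 i.2) ∘ₗ LinearMap.proj i :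
    (∀ i : {i // φ.g i = j}, IndMod (φ.hom i.2) (X.obj i.1)) →ₗ[S j] V)

@[simp] theorem grIndLift_mk (φ : AlgFamHom F R S) {X : GrMod R} {j : κ} {V : Type*}
    [AddCommGroup V] [Module (S j) V] (β : ∀ i, φ.g i = j → (X.obj i →+ V))
    (hβ : ∀ i h (r : R i) x, β i h (r • x) = φ.hom h r • β i h x) {i : ι} (h : φ.g i = j)
    (x : X.obj i) : grIndLift φ β hβ (grIndMk φ h x) = β i h x := by
  classical
  let _ : Fintype {i // φ.g i = j} := @Fintype.ofFinite _ (φ.fib j)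
  refine (sum_comp_proj_single (V := fun i : {i // φ.g i = j} => IndMod (φ.hom i.2) (X.obj i.1))
    (fun i => indLift (φ.hom i.2) (β i.1 i.2) (hβ i.1 i.2)) ⟨i, h⟩
    (indTmul (φ.hom h) 1 x)).trans ?_
  rw [indLift_tmul, one_smul]

theorem grInd_hom_ext (φ : AlgFamHom F R S) {X : GrMod R} {j : κ} {V : Type*}
    [AddCommGroup V] [Module (S j) V] {f g : ((grInd φ).obj X).obj j →ₗ[S j] V}
    (h : ∀ i (h : φ.g i = j) (x : X.obj i), f (grIndMk φ h x) = g (grIndMk φ h x)) : f = g := by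
  classical
  have : Finite {i // φ.g i = j} := φ.fib j
  change (∀ i : {i // φ.g i = j}, IndMod (φ.hom i.2) (X.obj i.1)) →ₗ[S j] V at f g
  refine LinearMap.pi_ext' fun i => indMod_linear_ext _ fun n => ?_
  exact h i.1 i.2 n

end GradedInduction

/-! ### The generators m ⊗ x of Ind_M(X) -/

namespace Tower

variable {F : Type u} [Field F] (T : Tower F)

/-- The generators `1 ⊗ (m ⊗ x)` of `Ind_M(X)`. -/
noncomputable def gen {M X : T.Md} {a b k : ℕ} (h : a + b = k) :
    M.obj a →+ X.obj b →+ ((T.Ind M).obj X).obj k :=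
  AddMonoidHom.mk' (fun m => AddMonoidHom.mk'
      (fun x => grIndMk T.mult (X := (T.ext M).obj X) (i := (a, b)) h (extTmul F m x))
      (fun x y => by rw [extTmul_add]; exact map_add _ _ _))
    (fun m m' => AddMonoidHom.ext fun x => by
      change grIndMk T.mult (X := (T.ext M).obj X) (i := (a, b)) h (extTmul F (m + m') x) = _
      rw [extTmul_add_left]
      exact map_add (grIndMk T.mult (X := (T.ext M).obj X) (i := (a, b)) h) _ _)

theorem gen_smul {M X : T.Md} {a b k : ℕ} (h : a + b = k) (r : T.A a) (s : T.A b) (m : M.obj a)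
    (x : X.obj b) : T.gen h (r • m) (s • x) = T.ρ h (r ⊗ₜ s) • T.gen h m x := by
  change grIndMk T.mult (X := (T.ext M).obj X) (i := (a, b)) h (extTmul F (r • m) (s • x)) = _
  rw [← extTensor_smul_tmul]
  exact grIndMk_smul T.mult (X := (T.ext M).obj X) (i := (a, b)) h (r ⊗ₜ s) (extTmul F m x)

theorem gen_smul_left {M X : T.Md} {a b k : ℕ} (h : a + b = k) (r : T.A a) (m : M.obj a)
    (x : X.obj b) : T.gen h (r • m) x = T.ρ h (r ⊗ₜ 1) • T.gen h m x := by
  rw [← gen_smul, one_smul]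

theorem gen_smul_right {M X : T.Md} {a b k : ℕ} (h : a + b = k) (s : T.A b) (m : M.obj a)
    (x : X.obj b) : T.gen h m (s • x) = T.ρ h (1 ⊗ₜ s) • T.gen h m x := by
  rw [← gen_smul, one_smul]

theorem Ind_map_gen (M : T.Md) {X Y : T.Md} (f : X ⟶ Y) {a b k : ℕ} (h : a + b = k)
    (m : M.obj a) (x : X.obj b) :
    (((T.Ind M).map f).hom k).hom (T.gen h m x) = T.gen h m ((f.hom b).hom x) :=
  grInd_map_mk T.mult ((T.ext M).map f) (i := (a, b)) h (extTmul F m x)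

/-- The universal property of `Ind_M(X)`, in degree `k`. -/
noncomputable def genLift {M X : T.Md} {k : ℕ} {V : Type*} [AddCommGroup V] [Module (T.A k) V]
    (β : ∀ a b, a + b = k → (M.obj a →+ X.obj b →+ V))
    (hβ : ∀ a b h r s m x, β a b h (r • m) (s • x) = T.ρ h (r ⊗ₜ s) • β a b h m x) :
    ((T.Ind M).obj X).obj k →ₗ[T.A k] V :=
  grIndLift T.mult (X := (T.ext M).obj X)
    (fun i h => extLift (T.ρ h) (β i.1 i.2 h) (hβ i.1 i.2 h))
    (fun i h r x => extLift_smul (T.ρ h) (β i.1 i.2 h) (hβ i.1 i.2 h) r x)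

@[simp] theorem genLift_gen {M X : T.Md} {k : ℕ} {V : Type*} [AddCommGroup V] [Module (T.A k) V]
    (β : ∀ a b, a + b = k → (M.obj a →+ X.obj b →+ V))
    (hβ : ∀ a b h r s m x, β a b h (r • m) (s • x) = T.ρ h (r ⊗ₜ s) • β a b h m x)
    {a b : ℕ} (h : a + b = k) (m : M.obj a) (x : X.obj b) :
    T.genLift β hβ (T.gen h m x) = β a b h m x :=
  grIndLift_mk T.mult (X := (T.ext M).obj X) _ _ (i := (a, b)) h (extTmul F m x)

theorem gen_hom_ext {M X : T.Md} {k : ℕ} {V : Type*} [AddCommGroup V] [Module (T.A k) V]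
    {f g : ((T.Ind M).obj X).obj k →ₗ[T.A k] V}
    (h : ∀ a b (h : a + b = k) (m : M.obj a) (x : X.obj b), f (T.gen h m x) = g (T.gen h m x)) :
    f = g := by
  refine grInd_hom_ext T.mult (X := (T.ext M).obj X) fun i hi x => ?_
  exact DFunLike.congr_fun (extTensor_hom_ext (F := F) (M := M.obj i.1) (N := X.obj i.2)
    (f := AddMonoidHom.comp f.toAddMonoidHom (grIndMk T.mult (X := (T.ext M).obj X) hi))
    (g := AddMonoidHom.comp g.toAddMonoidHom (grIndMk T.mult (X := (T.ext M).obj X) hi))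
    (fun m n => h i.1 i.2 hi m n)) x

end Tower

/-- Multiplication by `s`, as an additive map. -/
noncomputable def smulHom {B : Type u} [Ring B] (V : ModuleCat.{u} B) (s : B) : V →+ V :=
  DistribSMul.toAddMonoidHom V s

/-- A version for maps that are merely additive, such as those depending on a further variable.
Without linearity, all multiples of the generators have to be tested. -/
theorem grInd_addHom_ext {ι κ : Type} {F : Type u} [Field F] {R : ι → Type u} [∀ i, Ring (R i)]
    [∀ i, Algebra F (R i)] [∀ i, Module.Finite F (R i)] {S : κ → Type u} [∀ i, Ring (S i)]
    [∀ i, Algebra F (S i)] [∀ i, Module.Finite F (S i)] (φ : AlgFamHom F R S) {X : GrMod R} {j : κ}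
    {V : Type*} [AddCommGroup V] {f g : ((grInd φ).obj X).obj j →+ V}
    (h : ∀ i (h : φ.g i = j) (s : S j) (x : X.obj i),
      f (s • grIndMk φ h x) = g (s • grIndMk φ h x)) : f = g := by
  classical
  have : Finite {i // φ.g i = j} := φ.fib j
  change (∀ i : {i // φ.g i = j}, IndMod (φ.hom i.2) (X.obj i.1)) →+ V at f g
  refine AddMonoidHom.functions_ext'
    (M := fun i : {i // φ.g i = j} => IndMod (φ.hom i.2) (X.obj i.1)) V f g fun i => ?_
  refine indMod_hom_ext (N := X.obj i.1) (φ.hom i.2) fun s n => ?_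
  have := h i.1 i.2 s n
  rw [grIndMk_apply] at this
  have h2 : (s • Pi.single i (indTmul (φ.hom i.2) 1 n) :
      ∀ i : {i // φ.g i = j}, IndMod (φ.hom i.2) (X.obj i.1)) =
      Pi.single i (indTmul (φ.hom i.2) s n) := by
    rw [indTmul_eq_smul _ s]
    exact (Pi.single_smul (f := fun i : {i // φ.g i = j} => IndMod (φ.hom i.2) (X.obj i.1))
      i s (indTmul (φ.hom i.2) 1 n)).symm
  exact (congrArg f h2).symm.trans (this.trans (congrArg g h2))

namespace Tower

variable {F : Type u} [Field F] (T : Tower F)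

theorem gen_addHom_ext {M X : T.Md} {k : ℕ} {V : Type*} [AddCommGroup V]
    {f g : ((T.Ind M).obj X).obj k →+ V}
    (h : ∀ a b (h : a + b = k) (s : T.A k) (m : M.obj a) (x : X.obj b),
      f (s • T.gen h m x) = g (s • T.gen h m x)) : f = g := by
  refine grInd_addHom_ext T.mult (X := (T.ext M).obj X) fun i hi s x => ?_
  exact DFunLike.congr_fun (extTensor_hom_ext (F := F) (M := M.obj i.1) (N := X.obj i.2)
    (f := (f.comp (smulHom (((T.Ind M).obj X).obj k) s)).comp
      (grIndMk T.mult (X := (T.ext M).obj X) hi))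
    (g := (g.comp (smulHom (((T.Ind M).obj X).obj k) s)).comp
      (grIndMk T.mult (X := (T.ext M).obj X) hi))
    (fun m n => h i.1 i.2 hi s m n)) x

/-- The map `A_n → A_k`, `a ↦ 1 · a`. -/
noncomputable abbrev ρR {m n k : ℕ} (h : m + n = k) : T.A n →ₐ[F] T.A k :=
  (T.ρ h).comp Algebra.TensorProduct.includeRight

/-- The map `A_m → A_k`, `a ↦ a · 1`. -/
noncomputable abbrev ρL {m n k : ℕ} (h : m + n = k) : T.A m →ₐ[F] T.A k :=
  (T.ρ h).comp Algebra.TensorProduct.includeLeft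

theorem ρ_mul {m n k : ℕ} (h : m + n = k) (r r' : T.A m) (s s' : T.A n) :
    T.ρ h (r ⊗ₜ s) * T.ρ h (r' ⊗ₜ s') = T.ρ h ((r * r') ⊗ₜ (s * s')) := by
  rw [← map_mul, Algebra.TensorProduct.tmul_mul_tmul]

/-! ### Associativity of induction: Ind_M ∘ Ind_N -/

section Assoc

variable {M N X : T.Md}

/-- The map `y ↦ (m ⊗ y)` from `Ind_N(X)` to `Ind_{Ind_M(N)}(X)`. -/
noncomputable def assocAux {a b k : ℕ} (h : a + b = k) (m : M.obj a) :
    ((T.Ind N).obj X).obj b →ₗ[T.A b]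
      (resF (T.ρR h)).obj (((T.Ind ((T.Ind M).obj N)).obj X).obj k) :=
  T.genLift (fun c d h' => (T.gen (show a + c + d = k by omega)).comp (T.gen rfl m))
    fun c d h' r s n x => by
      change T.gen (k := k) _ (T.gen rfl m (r • n)) (s • x) = T.ρ h (1 ⊗ₜ T.ρ h' (r ⊗ₜ s)) •
        T.gen (k := k) _ (T.gen rfl m n) x
      -- Semilinearity is the identity ρ(1 ⊗ ρ(r ⊗ s)) = ρ(ρ(1 ⊗ r) ⊗ s).
      rw [gen_smul_right _ _ r, gen_smul, T.ρ_assoc]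

theorem assocAux_gen {a b k : ℕ} (h : a + b = k) (m : M.obj a) {c d : ℕ} (h' : c + d = b)
    (n : N.obj c) (x : X.obj d) : T.assocAux (N := N) (X := X) h m (T.gen h' n x) =
      T.gen (show a + c + d = k by omega) (T.gen (M := M) (X := N) rfl m n) x :=
  T.genLift_gen _ _ h' n x

theorem assocAux_smul_gen {a b k : ℕ} (h : a + b = k) (m : M.obj a) {c d : ℕ} (h' : c + d = b)
    (s : T.A b) (n : N.obj c) (x : X.obj d) :
    T.assocAux (N := N) (X := X) h m (s • T.gen h' n x) =
      (T.ρ h (1 ⊗ₜ s) • T.gen (show a + c + d = k by omega)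
        (T.gen (M := M) (X := N) rfl m n) x : ((T.Ind ((T.Ind M).obj N)).obj X).obj k) :=
  (map_smul (T.assocAux (N := N) (X := X) h m) s _).trans
    (congrArg (smulHom (((T.Ind ((T.Ind M).obj N)).obj X).obj k) (T.ρ h (1 ⊗ₜ s)))
      (T.assocAux_gen h m h' n x))

variable (M N X) in
/-- The map `m ⊗ (n ⊗ x) ↦ (m ⊗ n) ⊗ x`. -/
noncomputable def assocHom (k : ℕ) : ((T.Ind M).obj ((T.Ind N).obj X)).obj k →ₗ[T.A k]
    ((T.Ind ((T.Ind M).obj N)).obj X).obj k :=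
  T.genLift (fun a b h => AddMonoidHom.mk' (fun m => (T.assocAux h m).toAddMonoidHom)
    (fun m m' => T.gen_addHom_ext fun c d h' s n x => by
      change T.assocAux h (m + m') _ = T.assocAux h m _ + T.assocAux h m' _
      rw [assocAux_smul_gen, assocAux_smul_gen, assocAux_smul_gen]
      rw [map_add, AddMonoidHom.add_apply, map_add, AddMonoidHom.add_apply]
      exact map_add (smulHom (((T.Ind ((T.Ind M).obj N)).obj X).obj k) (T.ρ h (1 ⊗ₜ s))) _ _))
    fun a b h r s m y => by
      revert y
      refine DFunLike.congr_fun (f := (T.assocAux h (r • m)).toAddMonoidHom.comp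
        (smulHom (((T.Ind N).obj X).obj b) s))
        (g := (smulHom (((T.Ind ((T.Ind M).obj N)).obj X).obj k)
          (T.ρ h (r ⊗ₜ s))).comp (T.assocAux h m).toAddMonoidHom) ?_
      refine T.gen_addHom_ext fun c d h' t n x => ?_
      change T.assocAux h (r • m) (s • t • T.gen h' n x) =
        T.ρ h (r ⊗ₜ s) • (show ((T.Ind ((T.Ind M).obj N)).obj X).obj k from
          T.assocAux h m (t • T.gen h' n x))
      -- Both sides become ρ(r ⊗ st) times the same generator: the scalar r leaves the inner
      -- generator as ρ(ρ(r ⊗ 1) ⊗ 1), which is ρ(r ⊗ 1) by associativity.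
      rw [smul_smul, assocAux_smul_gen, assocAux_smul_gen, smul_smul, ρ_mul,
        gen_smul_left, gen_smul_left, smul_smul, T.ρ_assoc (h₃ := h') (h₄ := h),
        ρ_mul, ← Algebra.TensorProduct.one_def, map_one, mul_one, one_mul, mul_one]

theorem assocHom_gen {a b k : ℕ} (h : a + b = k) (m : M.obj a) (y : ((T.Ind N).obj X).obj b) :
    T.assocHom M N X k (T.gen h m y) = T.assocAux h m y :=
  T.genLift_gen _ _ h m y

/-- The map `y ↦ (y ⊗ x)` from `Ind_M(N)` to `Ind_M(Ind_N(X))`. -/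
noncomputable def assocInvAux {e d k : ℕ} (h : e + d = k) (x : X.obj d) :
    ((T.Ind M).obj N).obj e →ₗ[T.A e]
      (resF (T.ρL h)).obj (((T.Ind M).obj ((T.Ind N).obj X)).obj k) :=
  T.genLift (fun a c h' => AddMonoidHom.mk' (fun m =>
      (T.gen (show a + (c + d) = k by omega) m).comp ((T.gen rfl).flip x)) (fun m m' => by
        ext n
        simp
        rfl))
    fun a c h' r s m n => by
      change T.gen (k := k) _ (r • m) (T.gen rfl (s • n) x) = T.ρ h (T.ρ h' (r ⊗ₜ s) ⊗ₜ 1) •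
        T.gen (k := k) _ m (T.gen rfl n x)
      rw [gen_smul_left _ _ s, gen_smul, T.ρ_assoc]

theorem assocInvAux_gen {e d k : ℕ} (h : e + d = k) (x : X.obj d) {a c : ℕ} (h' : a + c = e)
    (m : M.obj a) (n : N.obj c) : T.assocInvAux (M := M) (N := N) h x (T.gen h' m n) =
      T.gen (show a + (c + d) = k by omega) m (T.gen (M := N) (X := X) rfl n x) :=
  T.genLift_gen _ _ h' m n

theorem assocInvAux_smul_gen {e d k : ℕ} (h : e + d = k) (x : X.obj d) {a c : ℕ} (h' : a + c = e)
    (s : T.A e) (m : M.obj a) (n : N.obj c) :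
    T.assocInvAux (M := M) (N := N) h x (s • T.gen h' m n) =
      (T.ρ h (s ⊗ₜ 1) • T.gen (show a + (c + d) = k by omega) m
        (T.gen (M := N) (X := X) rfl n x) : ((T.Ind M).obj ((T.Ind N).obj X)).obj k) :=
  (map_smul (T.assocInvAux (M := M) (N := N) h x) s _).trans
    (congrArg (smulHom (((T.Ind M).obj ((T.Ind N).obj X)).obj k) (T.ρ h (s ⊗ₜ 1)))
      (T.assocInvAux_gen h x h' m n))

variable (M N X) in
/-- The map `(m ⊗ n) ⊗ x ↦ m ⊗ (n ⊗ x)`. -/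
noncomputable def assocInv (k : ℕ) : ((T.Ind ((T.Ind M).obj N)).obj X).obj k →ₗ[T.A k]
    ((T.Ind M).obj ((T.Ind N).obj X)).obj k :=
  T.genLift (fun e d h => (AddMonoidHom.mk' (fun x => (T.assocInvAux h x).toAddMonoidHom)
    (fun x x' => T.gen_addHom_ext fun a c h' s m n => by
      change T.assocInvAux h (x + x') _ = T.assocInvAux h x _ + T.assocInvAux h x' _
      rw [assocInvAux_smul_gen, assocInvAux_smul_gen, assocInvAux_smul_gen]
      rw [map_add, map_add]
      exact map_add (smulHom (((T.Ind M).obj ((T.Ind N).obj X)).obj k) (T.ρ h (s ⊗ₜ 1))) _ _)).flip)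
    fun e d h r s y x => by
      revert y
      refine DFunLike.congr_fun (f := (T.assocInvAux h (s • x)).toAddMonoidHom.comp
        (smulHom (((T.Ind M).obj N).obj e) r))
        (g := (smulHom (((T.Ind M).obj ((T.Ind N).obj X)).obj k)
          (T.ρ h (r ⊗ₜ s))).comp (T.assocInvAux h x).toAddMonoidHom) ?_
      refine T.gen_addHom_ext fun a c h' t m n => ?_
      change T.assocInvAux h (s • x) (r • t • T.gen h' m n) =
        T.ρ h (r ⊗ₜ s) • (show ((T.Ind M).obj ((T.Ind N).obj X)).obj k from
          T.assocInvAux h x (t • T.gen h' m n))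
      rw [smul_smul, assocInvAux_smul_gen, assocInvAux_smul_gen, smul_smul, ρ_mul,
        gen_smul_right, gen_smul_right, smul_smul, ← T.ρ_assoc (h₁ := h') (h₂ := h),
        ρ_mul, ← Algebra.TensorProduct.one_def, map_one, mul_one, one_mul, mul_one]

theorem assocInv_gen {e d k : ℕ} (h : e + d = k) (y : ((T.Ind M).obj N).obj e) (x : X.obj d) :
    T.assocInv M N X k (T.gen h y x) = T.assocInvAux h x y :=
  T.genLift_gen _ _ h y x

theorem assocHom_gen_gen {a b c d k : ℕ} (h : a + b = k) (h' : c + d = b) (h'' : a + c + d = k)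
    (m : M.obj a) (n : N.obj c) (x : X.obj d) :
    T.assocHom M N X k (T.gen h m (T.gen h' n x)) = T.gen h'' (T.gen rfl m n) x :=
  (T.assocHom_gen h m (T.gen h' n x)).trans (T.assocAux_gen h m h' n x)

theorem assocInv_gen_gen {a c d e k : ℕ} (h : e + d = k) (h' : a + c = e) (h'' : a + (c + d) = k)
    (m : M.obj a) (n : N.obj c) (x : X.obj d) :
    T.assocInv M N X k (T.gen h (T.gen h' m n) x) = T.gen h'' m (T.gen rfl n x) :=
  (T.assocInv_gen h (T.gen h' m n) x).trans (T.assocInvAux_gen h x h' m n)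

/-- As y is spanned by multiples s(m ⊗ n), it suffices to pull s out of the left variable and apply
the two formulas on generators. -/
theorem assocHom_assocInvAux {e d k : ℕ} (h : e + d = k) (y : ((T.Ind M).obj N).obj e)
    (x : X.obj d) : T.assocHom M N X k (T.assocInvAux h x y) = T.gen h y x := by
  revert y
  refine DFunLike.congr_fun (f := (T.assocHom M N X k).toAddMonoidHom.comp
    (T.assocInvAux h x).toAddMonoidHom) (g := (T.gen h).flip x) ?_
  refine T.gen_addHom_ext fun a c h' s m n => ?_
  subst h'
  change T.assocHom M N X k (T.assocInvAux h x (s • T.gen rfl m n)) =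
    T.gen h (s • T.gen rfl m n) x
  rw [assocInvAux_smul_gen, map_smul, gen_smul_left]
  rw [assocHom_gen_gen]

theorem assocInv_assocAux {a b k : ℕ} (h : a + b = k) (m : M.obj a) (y : ((T.Ind N).obj X).obj b) :
    T.assocInv M N X k (T.assocAux h m y) = T.gen h m y := by
  revert y
  refine DFunLike.congr_fun (f := (T.assocInv M N X k).toAddMonoidHom.comp
    (T.assocAux h m).toAddMonoidHom) (g := T.gen h m) ?_
  refine T.gen_addHom_ext fun c d h' s n x => ?_
  subst h'
  change T.assocInv M N X k (T.assocAux h m (s • T.gen rfl n x)) =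
    T.gen h m (s • T.gen rfl n x)
  rw [assocAux_smul_gen, map_smul, gen_smul_right]
  rw [assocInv_gen_gen]

variable (M N X) in
/-- Associativity of induction. -/
noncomputable def assocEquiv (k : ℕ) : ((T.Ind M).obj ((T.Ind N).obj X)).obj k ≃ₗ[T.A k]
    ((T.Ind ((T.Ind M).obj N)).obj X).obj k :=
  LinearEquiv.ofLinearMap (T.assocHom M N X k) (T.assocInv M N X k)
    (T.gen_hom_ext (f := T.assocHom M N X k ∘ₗ T.assocInv M N X k) fun e d h y x => by
      rw [LinearMap.comp_apply, assocInv_gen, assocHom_assocInvAux, LinearMap.id_apply])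
    (T.gen_hom_ext (f := T.assocInv M N X k ∘ₗ T.assocHom M N X k) fun a b h m y => by
      rw [LinearMap.comp_apply, assocHom_gen, assocInv_assocAux, LinearMap.id_apply])

end Assoc

/-- `Ind_M ∘ Ind_N ≅ Ind_{∇(M ⊗ N)}`. -/
theorem nonempty_ind_comp_iso (M N : T.Md) :
    Nonempty (T.Ind N ⋙ T.Ind M ≅ T.Ind (T.nabla.obj ((T.ext M).obj N))) := by
  refine nonempty_natIso (Φ := T.Ind N ⋙ T.Ind M) (Ψ := T.Ind ((T.Ind M).obj N))
    (fun X k => T.assocEquiv M N X k) fun {X Y} f k y => ?_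
  refine LinearMap.congr_fun (f := (T.assocHom M N Y k) ∘ₗ
    (((T.Ind M).map ((T.Ind N).map f)).hom k).hom)
    (g := (((T.Ind ((T.Ind M).obj N)).map f).hom k).hom ∘ₗ (T.assocHom M N X k)) ?_ y
  refine T.gen_hom_ext fun a b h m y => ?_
  revert y
  refine DFunLike.congr_fun (f := (((T.assocHom M N Y k) ∘ₗ
    (((T.Ind M).map ((T.Ind N).map f)).hom k).hom).toAddMonoidHom.comp (T.gen h m)))
    (g := ((((T.Ind ((T.Ind M).obj N)).map f).hom k).hom ∘ₗ
      (T.assocHom M N X k)).toAddMonoidHom.comp (T.gen h m)) ?_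
  refine T.gen_addHom_ext fun c d h' s n x => ?_
  change T.assocHom M N Y k ((((T.Ind M).map ((T.Ind N).map f)).hom k).hom
      (T.gen h m (s • T.gen h' n x))) =
    (((T.Ind ((T.Ind M).obj N)).map f).hom k).hom
      (T.assocHom M N X k (T.gen h m (s • T.gen h' n x)))
  rw [Ind_map_gen, map_smul, Ind_map_gen]
  -- The value on a multiple of a generator is the same expression in z for every `Z`, and this is
  -- what makes the map natural.
  have key : ∀ (Z : T.Md) (z : Z.obj d), T.assocHom M N Z k (T.gen h m (s • T.gen h' n z)) =
      T.ρ h (1 ⊗ₜ s) • T.gen (show a + c + d = k by omega)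
        (T.gen (M := M) (X := N) rfl m n) z := fun Z z =>
    (T.assocHom_gen h m (s • T.gen h' n z)).trans (T.assocAux_smul_gen h m h' s n z)
  rw [key, key, map_smul, Ind_map_gen]

end Tower

/-! ### Composition of restrictions: Res_P ∘ Res_Q -/

namespace Tower

variable {F : Type u} [Field F] (T : Tower F)

/-- Transport along an equality of degrees. -/
noncomputable def cst (X : T.Md) {a b : ℕ} (h : a = b) : X.obj a →+ X.obj b :=
  h ▸ AddMonoidHom.id _

theorem cst_cst (X : T.Md) {a b : ℕ} (h : a = b) (h' : b = a) (x : X.obj a) :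
    T.cst X h' (T.cst X h x) = x := by
  subst h
  rfl

/-- Scalars cross a change of degree only in the form ρ(r). Since `ρ` is available with every target
degree, no scalar is ever transported. -/
theorem cst_ρ_smul (X : T.Md) {m n a b : ℕ} (h₁ : m + n = a) (h₂ : m + n = b) (h : a = b)
    (r : T.A m ⊗[F] T.A n) (x : X.obj a) :
    T.cst X h (T.ρ h₁ r • x) = T.ρ h₂ r • T.cst X h x := by
  subst h
  rfl

theorem map_cst {X Y : T.Md} (f : X ⟶ Y) {a b : ℕ} (h : a = b) (x : X.obj a) :
    (f.hom b).hom (T.cst X h x) = T.cst Y h ((f.hom a).hom x) := by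
  subst h
  rfl

/-- The maps `P_j → X_{k+j}` given by an element of `Res_P(X)_k`. -/
noncomputable def resApp {P X : T.Md} {k : ℕ} (x : ((T.Res P).obj X).obj k) (j : ℕ) :
    P.obj j →+ X.obj (k + j) :=
  (show PHom (P.obj j) ((T.delta.obj X).obj (k, j)) from
    (show ∀ j, PHom (P.obj j) ((T.delta.obj X).obj (k, j)) from x) j).toAddMonoidHom

/-- The element of `Res_P(X)_k` given by maps `P_j → X_{k+j}`. -/
noncomputable def resMk {P X : T.Md} {k : ℕ} (f : ∀ j, P.obj j →+ X.obj (k + j))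
    (hf : ∀ j (s : T.A j) p, f j (s • p) = T.ρ rfl ((1 : T.A k) ⊗ₜ s) • f j p) : ((T.Res P).obj X).obj k :=
  show ∀ j, PHom (P.obj j) ((T.delta.obj X).obj (k, j)) from fun j =>
    { toFun := f j
      map_add' := map_add _
      map_smul' := hf j }

theorem resApp_ext {P X : T.Md} {k : ℕ} {x y : ((T.Res P).obj X).obj k}
    (h : ∀ j p, T.resApp x j p = T.resApp y j p) : x = y :=
  funext fun j => LinearMap.ext fun p => h j p

theorem resApp_add {P X : T.Md} {k : ℕ} (x y : ((T.Res P).obj X).obj k) (j : ℕ) (p : P.obj j) :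
    T.resApp (x + y) j p = T.resApp x j p + T.resApp y j p := rfl

theorem resApp_smul {P X : T.Md} {k : ℕ} (r : T.A k) (x : ((T.Res P).obj X).obj k) (j : ℕ)
    (p : P.obj j) : T.resApp (r • x) j p = T.ρ rfl (r ⊗ₜ (1 : T.A j)) • T.resApp x j p := rfl

theorem resApp_smul_right {P X : T.Md} {k : ℕ} (x : ((T.Res P).obj X).obj k) (j : ℕ)
    (s : T.A j) (p : P.obj j) :
    T.resApp x j (s • p) = T.ρ rfl ((1 : T.A k) ⊗ₜ s) • T.resApp x j p :=
  LinearMap.map_smulₛₗ (show PHom (P.obj j) ((T.delta.obj X).obj (k, j)) from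
    (show ∀ j, PHom (P.obj j) ((T.delta.obj X).obj (k, j)) from x) j) s p

theorem Res_map_app (P : T.Md) {X Y : T.Md} (f : X ⟶ Y) {k : ℕ} (x : ((T.Res P).obj X).obj k)
    (j : ℕ) (p : P.obj j) :
    T.resApp ((((T.Res P).map f).hom k).hom x) j p = (f.hom (k + j)).hom (T.resApp x j p) := rfl

section ResComp

variable {P Q X : T.Md}

/-- The biadditive map `P_j × Q_i → X_{k+n}` given by an element of `Res_P(Res_Q(X))_k`. -/
noncomputable def resBi {k : ℕ} (x : ((T.Res P).obj ((T.Res Q).obj X)).obj k) {j i n : ℕ}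
    (h : j + i = n) : P.obj j →+ Q.obj i →+ X.obj (k + n) :=
  AddMonoidHom.mk' (fun p => (T.cst X (show k + j + i = k + n by omega)).comp
    (T.resApp (T.resApp x j p) i)) (fun p p' => AddMonoidHom.ext fun q => by
      rw [AddMonoidHom.comp_apply, map_add, resApp_add, map_add]
      rfl)

theorem resBi_apply {k : ℕ} (x : ((T.Res P).obj ((T.Res Q).obj X)).obj k) {j i n : ℕ}
    (h : j + i = n) (p : P.obj j) (q : Q.obj i) : T.resBi x h p q =
      T.cst X (show k + j + i = k + n by omega) (T.resApp (T.resApp x j p) i q) := rfl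

/-- The two actions combine by ρ(ρ(1 ⊗ r) ⊗ s) = ρ(1 ⊗ ρ(r ⊗ s)). Hence the biadditive map factors
through the module induced from P_j ⊗ Q_i. -/
theorem resBi_smul {k : ℕ} (x : ((T.Res P).obj ((T.Res Q).obj X)).obj k) {j i n : ℕ}
    (h : j + i = n) (r : T.A j) (s : T.A i) (p : P.obj j) (q : Q.obj i) :
    T.resBi x h (r • p) (s • q) =
      T.ρ rfl ((1 : T.A k) ⊗ₜ T.ρ h (r ⊗ₜ s)) • T.resBi x h p q := by
  rw [resBi_apply, resBi_apply, resApp_smul_right T x j r p, resApp_smul, resApp_smul_right,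
    smul_smul,
    ρ_mul, one_mul, mul_one, T.ρ_assoc rfl rfl h (show k + n = k + j + i by omega), cst_ρ_smul]

/-- The linear map `Ind_P(Q)_n → X_{k+n}` given by an element of `Res_P(Res_Q(X))_k`. -/
noncomputable def resLift {k : ℕ} (x : ((T.Res P).obj ((T.Res Q).obj X)).obj k) (n : ℕ) :
    ((T.Ind P).obj Q).obj n →ₗ[T.A n] (resF (T.ρR (rfl : k + n = k + n))).obj (X.obj (k + n)) :=
  T.genLift (fun _ _ h => T.resBi x h) (fun _ _ h => T.resBi_smul x h)

theorem resLift_gen {k : ℕ} (x : ((T.Res P).obj ((T.Res Q).obj X)).obj k) {j i n : ℕ}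
    (h : j + i = n) (p : P.obj j) (q : Q.obj i) :
    T.resLift x n (T.gen h p q) = T.resBi x h p q :=
  T.genLift_gen (V := (resF (T.ρR (rfl : k + n = k + n))).obj (X.obj (k + n))) _ _ h p q

theorem resLift_smul_gen {k : ℕ} (x : ((T.Res P).obj ((T.Res Q).obj X)).obj k) {j i n : ℕ}
    (h : j + i = n) (s : T.A n) (p : P.obj j) (q : Q.obj i) :
    T.resLift x n (s • T.gen h p q) =
      (T.ρ rfl ((1 : T.A k) ⊗ₜ s) • T.resBi x h p q : X.obj (k + n)) :=
  (map_smul (T.resLift x n) s _).trans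
    (congrArg (smulHom (X.obj (k + n)) (T.ρ rfl ((1 : T.A k) ⊗ₜ s))) (T.resLift_gen x h p q))

/-- The element of `Res_{Ind_P(Q)}(X)_k` corresponding to an element of `Res_P(Res_Q(X))_k`. -/
noncomputable def resComp {k : ℕ} (x : ((T.Res P).obj ((T.Res Q).obj X)).obj k) :
    ((T.Res ((T.Ind P).obj Q)).obj X).obj k :=
  T.resMk (fun n => (T.resLift x n).toAddMonoidHom) (fun n s y => map_smul (T.resLift x n) s y)

theorem resComp_ext {k : ℕ} {y z : ((T.Res ((T.Ind P).obj Q)).obj X).obj k}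
    (h : ∀ n j i (h : j + i = n) (s : T.A n) (p : P.obj j) (q : Q.obj i),
      T.resApp y n (s • T.gen h p q) = T.resApp z n (s • T.gen h p q)) : y = z :=
  T.resApp_ext fun n => DFunLike.congr_fun (T.gen_addHom_ext fun j i h' s p q => h n j i h' s p q)

theorem resComp_app {k : ℕ} (x : ((T.Res P).obj ((T.Res Q).obj X)).obj k) {j i n : ℕ}
    (h : j + i = n) (s : T.A n) (p : P.obj j) (q : Q.obj i) :
    T.resApp (T.resComp x) n (s • T.gen h p q) =
      T.ρ rfl ((1 : T.A k) ⊗ₜ s) • T.resBi x h p q :=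
  T.resLift_smul_gen x h s p q

/-- The maps `Q_i → X_{k+j+i}` given by an element of `Res_{Ind_P(Q)}(X)_k` and an element of
`P_j`. -/
noncomputable def resUncompAux {k : ℕ} (y : ((T.Res ((T.Ind P).obj Q)).obj X).obj k) {j : ℕ}
    (p : P.obj j) : ((T.Res Q).obj X).obj (k + j) :=
  T.resMk (fun i => (T.cst X (show k + (j + i) = k + j + i by omega)).comp
    ((T.resApp y (j + i)).comp (T.gen rfl p))) (fun i s q => by
      change T.cst X _ (T.resApp y (j + i) (T.gen rfl p (s • q))) =
        T.ρ rfl (1 ⊗ₜ s) • T.cst X _ (T.resApp y (j + i) (T.gen rfl p q))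
      rw [gen_smul_right, resApp_smul_right,
        ← T.ρ_assoc rfl (show k + j + i = k + (j + i) by omega) rfl rfl, cst_ρ_smul T X _ rfl,
        ← Algebra.TensorProduct.one_def, map_one])

theorem resUncompAux_app {k : ℕ} (y : ((T.Res ((T.Ind P).obj Q)).obj X).obj k) {j : ℕ}
    (p : P.obj j) (i : ℕ) (q : Q.obj i) : T.resApp (T.resUncompAux y p) i q =
      T.cst X (show k + (j + i) = k + j + i by omega) (T.resApp y (j + i) (T.gen rfl p q)) := rfl

/-- The element of `Res_P(Res_Q(X))_k` corresponding to an element of `Res_{Ind_P(Q)}(X)_k`. -/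
noncomputable def resUncomp {k : ℕ} (y : ((T.Res ((T.Ind P).obj Q)).obj X).obj k) :
    ((T.Res P).obj ((T.Res Q).obj X)).obj k :=
  T.resMk (fun j => AddMonoidHom.mk' (fun p => T.resUncompAux y p) (fun p p' =>
      T.resApp_ext fun i q => by
        rw [resApp_add, resUncompAux_app, resUncompAux_app, resUncompAux_app, map_add,
          AddMonoidHom.add_apply, map_add, map_add]))
    (fun j s p => T.resApp_ext fun i q => by
      change T.resApp (T.resUncompAux y (s • p)) i q =
        T.resApp (T.ρ rfl (1 ⊗ₜ s) • T.resUncompAux y p) i q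
      rw [resApp_smul, resUncompAux_app, resUncompAux_app, gen_smul_left, resApp_smul_right,
        ← cst_ρ_smul T X (show k + j + i = k + (j + i) by omega), T.ρ_assoc rfl _ rfl rfl])

theorem resUncomp_app {k : ℕ} (y : ((T.Res ((T.Ind P).obj Q)).obj X).obj k) {j : ℕ}
    (p : P.obj j) (i : ℕ) (q : Q.obj i) : T.resApp (T.resApp (T.resUncomp y) j p) i q =
      T.cst X (show k + (j + i) = k + j + i by omega) (T.resApp y (j + i) (T.gen rfl p q)) := rfl

variable (P Q X) in
/-- `Res_P(Res_Q(X)) ≅ Res_{Ind_P(Q)}(X)`. -/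
noncomputable def resCompEquiv (k : ℕ) : ((T.Res P).obj ((T.Res Q).obj X)).obj k ≃ₗ[T.A k]
    ((T.Res ((T.Ind P).obj Q)).obj X).obj k where
  toFun := T.resComp
  map_add' x y := T.resComp_ext fun n j i h s p q => by
    rw [resApp_add, resComp_app, resComp_app, resComp_app, ← smul_add]
    rw [resBi_apply, resApp_add, resApp_add, map_add]
    rfl
  map_smul' r x := T.resComp_ext fun n j i h s p q => by
    rw [RingHom.id_apply, resApp_smul, resComp_app, resComp_app, smul_smul, ρ_mul, one_mul,
      mul_one, resBi_apply, resApp_smul, resApp_smul, resBi_apply,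
      T.ρ_assoc rfl rfl h (show k + n = k + j + i by omega),
      cst_ρ_smul T X _ (rfl : k + n = k + n), smul_smul, ρ_mul, ← Algebra.TensorProduct.one_def,
      map_one, mul_one, one_mul]
  invFun := T.resUncomp
  left_inv x := T.resApp_ext fun j p => T.resApp_ext fun i q => by
    rw [resUncomp_app]
    -- The formula for `resComp` concerns multiples of generators; the coefficient 1 gives the
    -- generator itself.
    have := T.resComp_app x rfl 1 p q
    rw [one_smul, ← Algebra.TensorProduct.one_def, map_one, one_smul] at this
    rw [this, resBi_apply, cst_cst]
  right_inv y := T.resComp_ext fun n j i h s p q => by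
    -- The inverse evaluates in degree j + i on the nose, so n is replaced by j + i.
    subst h
    rw [resComp_app, resBi_apply, resUncomp_app, cst_cst, resApp_smul_right]

end ResComp

/-- `Res_P ∘ Res_Q ≅ Res_{∇(P ⊗ Q)}`. -/
theorem nonempty_res_comp_iso (P Q : T.Md) :
    Nonempty (T.Res Q ⋙ T.Res P ≅ T.Res (T.nabla.obj ((T.ext P).obj Q))) := by
  refine nonempty_natIso (Φ := T.Res Q ⋙ T.Res P) (Ψ := T.Res ((T.Ind P).obj Q))
    (fun X k => T.resCompEquiv P Q X k) fun {X Y} f k x => ?_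
  refine T.resComp_ext (y := T.resComp ((((T.Res P).map ((T.Res Q).map f)).hom k).hom x))
    (z := (((T.Res ((T.Ind P).obj Q)).map f).hom k).hom (T.resComp x)) fun n j i h s p q => ?_
  rw [resComp_app, Res_map_app, resComp_app, map_smul, resBi_apply, resBi_apply, map_cst,
    Res_map_app, Res_map_app]

end Tower

/-! ### Additive maps out of an induced module, and dual bases -/

section IndAddLift

variable {F : Type u} [Field F]
variable {R S : Type u} [Ring R] [Algebra F R] [Ring S] [Algebra F S]

/-- The additive map on `S ⊗_R N` induced by a balanced biadditive map. -/
noncomputable def indAddLift (φ : R →ₐ[F] S) {N : ModuleCat.{u} R} {V : Type*} [AddCommGroup V]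
    (g : S →+ N →+ V) (hg : ∀ s r n, g (s * φ r) n = g s (r • n)) : IndMod φ N →+ V :=
  QuotientAddGroup.lift (indRel φ N).toAddSubgroup
    (TensorProduct.liftAddHom g fun c s n => by
      have : c • s = s * φ (algebraMap F R c) := by
        rw [φ.commutes, ← Algebra.commutes, Algebra.smul_def]
      rw [this, hg]
      rfl) (by
    intro x hx
    -- The relations form an `S`-submodule while the map is only additive, so vanishing is proved
    -- for all multiples t • x at once; otherwise the induction on the span fails at scalar
    -- multiples.
    have key : ∀ t : S, TensorProduct.liftAddHom g (fun c s n => by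
      have : c • s = s * φ (algebraMap F R c) := by
        rw [φ.commutes, ← Algebra.commutes, Algebra.smul_def]
      rw [this, hg]
      rfl) (t • x) = 0 := by
      have hx' : x ∈ indRel φ N := hx
      unfold indRel at hx'
      clear hx
      induction hx' using Submodule.span_induction with
      | zero => simp
      | add x y _ _ h1 h2 => exact fun t => by rw [smul_add, map_add, h1, h2, add_zero]
      | smul t x _ h1 => exact fun t' => by rw [smul_smul]; exact h1 _
      | mem x hx =>
        obtain ⟨s, r, n, rfl⟩ := hx
        intro t
        rw [smul_sub, TensorProduct.smul_tmul', TensorProduct.smul_tmul', smul_eq_mul, smul_eq_mul,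
          map_sub, ← mul_assoc]
        exact sub_eq_zero.2 (hg _ _ _)
    simpa using key 1)

end IndAddLift

/-- `P` is a retract of some Bⁿ: the e_t are the images of the standard basis, and the d_t are the
coordinates of a section. -/
theorem exists_dual_basis {B : Type u} [Ring B] (P : ModuleCat.{u} B) (h1 : Module.Finite B P)
    (h2 : Module.Projective B P) :
    ∃ (n : ℕ) (e : Fin n → P) (d : Fin n → P →ₗ[B] B), ∀ p, ∑ t, d t p • e t = p := by
  obtain ⟨n, f, g, -, -, hfg⟩ := Module.Finite.exists_comp_eq_id_of_projective B P
  refine ⟨n, fun t => f (Pi.single t 1), fun t => LinearMap.proj t ∘ₗ g, fun p => ?_⟩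
  have h3 : f (g p) = p := LinearMap.congr_fun hfg p
  conv_rhs => rw [← h3, ← LinearMap.sum_single_apply (φ := fun _ : Fin n => B) (g p), map_sum]
  refine Finset.sum_congr rfl fun t _ => ?_
  rw [← map_smul]
  congr 1
  ext t'
  by_cases h : t' = t
  · subst h
    simp
  · simp [h]

/-! ### Hom from a finitely generated projective module commutes with induction in the other
variable -/

section HomInd

variable {F : Type u} [Field F]
variable {R S A B : Type u} [Ring R] [Algebra F R] [Ring S] [Algebra F S] [Ring A] [Algebra F A]
  [Ring B] [Algebra F B]

/-- An `(R ⊗ S)`-module as an `S`-module. -/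
noncomputable abbrev slice (Y : ModuleCat.{u} (R ⊗[F] S)) : ModuleCat.{u} S :=
  (resF (Algebra.TensorProduct.includeRight : S →ₐ[F] R ⊗[F] S)).obj Y

/-- The action of `R` on an `(R ⊗ S)`-module by `S`-linear maps. -/
noncomputable def sliceAct (Y : ModuleCat.{u} (R ⊗[F] S)) : R →+* Module.End S (slice Y) where
  toFun r :=
    { toFun := fun y => ((r ⊗ₜ[F] (1 : S)) • (show Y from y) : Y)
      map_add' := fun x y => smul_add (r ⊗ₜ[F] (1 : S)) (show Y from x) (show Y from y)
      map_smul' := fun s y => by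
        change (r ⊗ₜ[F] (1 : S)) • ((1 : R) ⊗ₜ[F] s) • (show Y from y) =
          ((1 : R) ⊗ₜ[F] s) • (r ⊗ₜ[F] (1 : S)) • (show Y from y)
        rw [smul_smul, smul_smul]
        simp }
  map_one' := LinearMap.ext fun y => one_smul (R ⊗[F] S) (show Y from y)
  map_mul' r r' := LinearMap.ext fun y => by
    change ((r * r') ⊗ₜ[F] (1 : S)) • (show Y from y) =
      (r ⊗ₜ[F] (1 : S)) • (r' ⊗ₜ[F] (1 : S)) • (show Y from y)
    rw [smul_smul]
    simp
  map_zero' := LinearMap.ext fun y => by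
    change ((0 : R) ⊗ₜ[F] (1 : S)) • (show Y from y) = 0
    rw [TensorProduct.zero_tmul, zero_smul]
  map_add' r r' := LinearMap.ext fun y => by
    change ((r + r') ⊗ₜ[F] (1 : S)) • (show Y from y) =
      (r ⊗ₜ[F] (1 : S)) • (show Y from y) + (r' ⊗ₜ[F] (1 : S)) • (show Y from y)
    rw [TensorProduct.add_tmul, add_smul]

theorem indMap_add (φ : R →ₐ[F] S) {N N' : ModuleCat.{u} R} (f g : N →ₗ[R] N') :
    indMap φ (f + g) = indMap φ f + indMap φ g :=
  indMod_linear_ext φ fun n => by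
    rw [LinearMap.add_apply, indMap_tmul, indMap_tmul, indMap_tmul, LinearMap.add_apply,
      indTmul_add]

/-- Induction on endomorphism rings. -/
noncomputable def indEnd (φ : R →ₐ[F] S) (N : ModuleCat.{u} R) :
    Module.End R N →+* Module.End S (IndMod φ N) where
  toFun f := indMap φ f
  map_one' := indMod_linear_ext φ fun n => rfl
  map_mul' f g := indMod_linear_ext φ fun n => rfl
  map_zero' := indMod_linear_ext φ fun n => by
    rw [indMap_tmul, LinearMap.zero_apply, LinearMap.zero_apply]
    exact map_zero (indUnit φ N)
  map_add' := indMap_add φ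

/-- `Hom_B(P, B ⊗_S Y)` for an `(R ⊗ S)`-module `Y`, as an `R`-module. -/
noncomputable def indHom (β : S →ₐ[F] B) (P : ModuleCat.{u} B) (Y : ModuleCat.{u} (R ⊗[F] S)) :
    ModuleCat.{u} R :=
  letI : Module R (P →ₗ[B] IndMod β (slice Y)) :=
    Module.compHom _ ((indEnd β (slice Y)).comp (sliceAct Y))
  ModuleCat.of R (P →ₗ[B] IndMod β (slice Y))

/-- The value at `p` of an element of `Hom_B(P, B ⊗_S Y)`. -/
noncomputable def indHomApp {β : S →ₐ[F] B} {P : ModuleCat.{u} B} {Y : ModuleCat.{u} (R ⊗[F] S)}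
    (f : indHom β P Y) : P →ₗ[B] IndMod β (slice Y) := f

theorem indHomApp_smul {β : S →ₐ[F] B} {P : ModuleCat.{u} B} {Y : ModuleCat.{u} (R ⊗[F] S)}
    (r : R) (f : indHom β P Y) (p : P) :
    indHomApp (r • f) p = indMap β (sliceAct Y r) (indHomApp f p) := rfl

/-- `α ⊗ β`. -/
noncomputable abbrev algMap (α : R →ₐ[F] A) (β : S →ₐ[F] B) : R ⊗[F] S →ₐ[F] A ⊗[F] B :=
  Algebra.TensorProduct.map α β

/-- The map `b ⊗ y ↦ (1 ⊗ b) ⊗ y`. -/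
noncomputable def indJoin (α : R →ₐ[F] A) (β : S →ₐ[F] B) (Y : ModuleCat.{u} (R ⊗[F] S)) :
    IndMod β (slice Y) →ₗ[B] slice ((indF (algMap α β)).obj Y) :=
  indLift β (indUnit (algMap α β) Y) fun s y => by
    change indTmul (algMap α β) 1 (((1 : R) ⊗ₜ[F] s) • (show Y from y)) =
      ((1 : A) ⊗ₜ[F] β s) • indTmul (algMap α β) 1 (show Y from y)
    rw [indTmul_smul, smul_indTmul, mul_one, one_mul, Algebra.TensorProduct.map_tmul, map_one]

theorem indJoin_tmul (α : R →ₐ[F] A) (β : S →ₐ[F] B) (Y : ModuleCat.{u} (R ⊗[F] S)) (b : B)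
    (y : Y) : indJoin α β Y (indTmul β b (show slice Y from y)) =
      indTmul (algMap α β) ((1 : A) ⊗ₜ b) y := by
  change ((1 : A) ⊗ₜ[F] b) • indTmul (algMap α β) 1 y = _
  rw [smul_indTmul, mul_one]

/-- In (A ⊗ B) ⊗ Y the element r ⊗ 1 can be moved from Y to the left factor, where it becomes α(r) ⊗
1. This is the semilinearity along α that `homInd` requires. -/
theorem indJoin_act (α : R →ₐ[F] A) (β : S →ₐ[F] B) (Y : ModuleCat.{u} (R ⊗[F] S)) (r : R)
    (w : IndMod β (slice Y)) : indJoin α β Y (indMap β (sliceAct Y r) w) =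
      ((α r ⊗ₜ[F] (1 : B)) • (show (indF (algMap α β)).obj Y from indJoin α β Y w) :
        (indF (algMap α β)).obj Y) := by
  revert w
  refine DFunLike.congr_fun (f := (indJoin α β Y ∘ₗ indMap β (sliceAct Y r)).toAddMonoidHom)
    (g := (smulHom ((indF (algMap α β)).obj Y) (α r ⊗ₜ[F] (1 : B))).comp
      (indJoin α β Y).toAddMonoidHom) (indMod_hom_ext β fun b y => ?_)
  change indJoin α β Y (indMap β (sliceAct Y r) (indTmul β b y)) = (α r ⊗ₜ[F] (1 : B)) •
    (show (indF (algMap α β)).obj Y from indJoin α β Y (indTmul β b y))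
  rw [indMap_tmul]
  refine (indJoin_tmul α β Y b _).trans ?_
  refine Eq.trans ?_ (congrArg (smulHom ((indF (algMap α β)).obj Y) (α r ⊗ₜ[F] (1 : B)))
    (indJoin_tmul α β Y b y)).symm
  change indTmul (algMap α β) (1 ⊗ₜ[F] b) ((r ⊗ₜ[F] (1 : S)) • (show Y from y)) =
    (α r ⊗ₜ[F] (1 : B)) • indTmul (algMap α β) (1 ⊗ₜ[F] b) (show Y from y)
  rw [indTmul_smul, smul_indTmul]
  simp

/-- The canonical map `A ⊗_R Hom_B(P, B ⊗_S Y) → Hom_B(P, (A ⊗ B) ⊗_{R ⊗ S} Y)`. -/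
noncomputable def homInd (α : R →ₐ[F] A) (β : S →ₐ[F] B) (P : ModuleCat.{u} B)
    (Y : ModuleCat.{u} (R ⊗[F] S)) :
    IndMod α (indHom β P Y) →ₗ[A] PHom P ((indF (algMap α β)).obj Y) :=
  indLift α (AddMonoidHom.mk' (fun f =>
    ({ toFun := fun p => indJoin α β Y (indHomApp f p)
       map_add' := fun p q => by rw [map_add, map_add]; rfl
       map_smul' := fun b p => by
        rw [map_smul, map_smul]
        rfl } : PHom P ((indF (algMap α β)).obj Y))) (fun f g => LinearMap.ext fun p =>
          map_add (indJoin α β Y) (indHomApp f p) (indHomApp g p)))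
    fun r f => LinearMap.ext fun p => indJoin_act α β Y r (indHomApp f p)

theorem homInd_tmul (α : R →ₐ[F] A) (β : S →ₐ[F] B) (P : ModuleCat.{u} B)
    (Y : ModuleCat.{u} (R ⊗[F] S)) (a : A) (f : indHom β P Y) (p : P) :
    homInd α β P Y (indTmul α a f) p = ((a ⊗ₜ[F] (1 : B)) •
      (show (indF (algMap α β)).obj Y from indJoin α β Y (indHomApp f p)) :
        (indF (algMap α β)).obj Y) := rfl

/-- The map `p ↦ d(p) w`. -/
noncomputable def rankOne (β : S →ₐ[F] B) (P : ModuleCat.{u} B) (Y : ModuleCat.{u} (R ⊗[F] S))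
    (d : P →ₗ[B] B) (w : IndMod β (slice Y)) : indHom β P Y :=
  show P →ₗ[B] IndMod β (slice Y) from d.smulRight w

theorem rankOne_app (β : S →ₐ[F] B) (P : ModuleCat.{u} B) (Y : ModuleCat.{u} (R ⊗[F] S))
    (d : P →ₗ[B] B) (w : IndMod β (slice Y)) (p : P) :
    indHomApp (rankOne β P Y d w) p = d p • w := rfl

theorem indHom_ext {β : S →ₐ[F] B} {P : ModuleCat.{u} B} {Y : ModuleCat.{u} (R ⊗[F] S)}
    {f g : indHom β P Y} (h : ∀ p, indHomApp f p = indHomApp g p) : f = g :=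
  LinearMap.ext h

theorem smul_rankOne (β : S →ₐ[F] B) (P : ModuleCat.{u} B) (Y : ModuleCat.{u} (R ⊗[F] S))
    (d : P →ₗ[B] B) (r : R) (b : B) (y : Y) :
    r • rankOne β P Y d (indTmul β b (show slice Y from y)) =
      rankOne β P Y d (indTmul β b (show slice Y from (r ⊗ₜ[F] (1 : S)) • y)) :=
  indHom_ext fun p => by
    rw [indHomApp_smul, rankOne_app, rankOne_app, map_smul, indMap_tmul]
    rfl

theorem rankOne_mul (β : S →ₐ[F] B) (P : ModuleCat.{u} B) (Y : ModuleCat.{u} (R ⊗[F] S))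
    (d : P →ₗ[B] B) (s : S) (b : B) (y : Y) :
    rankOne β P Y d (indTmul β (b * β s) (show slice Y from y)) =
      rankOne β P Y d (indTmul β b (show slice Y from ((1 : R) ⊗ₜ[F] s) • y)) :=
  congrArg (rankOne β P Y d) (indTmul_smul β b s (show slice Y from y)).symm

theorem rankOne_add (β : S →ₐ[F] B) (P : ModuleCat.{u} B) (Y : ModuleCat.{u} (R ⊗[F] S))
    (d : P →ₗ[B] B) (w w' : IndMod β (slice Y)) :
    rankOne β P Y d (w + w') = rankOne β P Y d w + rankOne β P Y d w' :=
  indHom_ext fun _ => smul_add _ _ _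

/-- The triadditive map `(a, b, y) ↦ a ⊗ (p ↦ d(p) b ⊗ y)`. -/
noncomputable def homIndInvPre (α : R →ₐ[F] A) (β : S →ₐ[F] B) (P : ModuleCat.{u} B)
    (Y : ModuleCat.{u} (R ⊗[F] S)) (d : P →ₗ[B] B) :
    A →+ B →+ Y →+ IndMod α (indHom β P Y) :=
  AddMonoidHom.mk' (fun a => AddMonoidHom.mk' (fun b => AddMonoidHom.mk'
    (fun y => indTmul α a (rankOne β P Y d (indTmul β b (show slice Y from y))))
      (fun y y' => by
        rw [← indTmul_add, ← rankOne_add]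
        exact congrArg _ (congrArg _ (indTmul_add (N := slice Y) β b y y')))) (fun b b' => by
      ext y
      simp only [AddMonoidHom.mk'_apply, AddMonoidHom.add_apply]
      rw [← indTmul_add, ← rankOne_add]
      exact congrArg _ (congrArg _ (indTmul_add_left (N := slice Y) β b b' y)))) (fun a a' => by
      ext b y
      simp only [AddMonoidHom.mk'_apply, AddMonoidHom.add_apply]
      rw [indTmul_add_left])

/-- Together, `smul_rankOne` and `rankOne_mul` say that the triadditive map is balanced over `R ⊗
S`, so that it descends to the induced module. -/
theorem homIndInvPre_smul (α : R →ₐ[F] A) (β : S →ₐ[F] B) (P : ModuleCat.{u} B)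
    (Y : ModuleCat.{u} (R ⊗[F] S)) (d : P →ₗ[B] B) (a : A) (b : B) (r : R) (s : S) (y : Y) :
    homIndInvPre α β P Y d (a * α r) (b * β s) y =
      homIndInvPre α β P Y d a b ((r ⊗ₜ[F] s) • y) := by
  change indTmul α (a * α r) (rankOne β P Y d (indTmul β (b * β s) (show slice Y from y))) =
    indTmul α a (rankOne β P Y d (indTmul β b (show slice Y from (r ⊗ₜ[F] s) • y)))
  rw [← indTmul_smul, rankOne_mul, smul_rankOne, smul_smul]
  simp

/-- The biadditive map `(a ⊗ b, y) ↦ a ⊗ (p ↦ d(p) b ⊗ y)`. -/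
noncomputable def homIndInvMid (α : R →ₐ[F] A) (β : S →ₐ[F] B) (P : ModuleCat.{u} B)
    (Y : ModuleCat.{u} (R ⊗[F] S)) (d : P →ₗ[B] B) :
    A ⊗[F] B →+ (Y →+ IndMod α (indHom β P Y)) :=
  TensorProduct.liftAddHom (homIndInvPre α β P Y d) fun c a b => by
    ext y
    -- In either tensor factor the scalar c is right multiplication by its image in `R` or `S`, and
    -- on Y these two actions agree.
    have h1 : c • a = a * α (algebraMap F R c) := by
      rw [α.commutes, ← Algebra.commutes, Algebra.smul_def]
    have h2 : c • b = b * β (algebraMap F S c) := by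
      rw [β.commutes, ← Algebra.commutes, Algebra.smul_def]
    have h3 := homIndInvPre_smul α β P Y d a b (algebraMap F R c) 1 y
    have h4 := homIndInvPre_smul α β P Y d a b 1 (algebraMap F S c) y
    rw [map_one, mul_one] at h3 h4
    rw [h1, h2, h3, h4, Algebra.algebraMap_eq_smul_one, Algebra.algebraMap_eq_smul_one,
      TensorProduct.smul_tmul]

theorem homIndInvMid_tmul (α : R →ₐ[F] A) (β : S →ₐ[F] B) (P : ModuleCat.{u} B)
    (Y : ModuleCat.{u} (R ⊗[F] S)) (d : P →ₗ[B] B) (a : A) (b : B) :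
    homIndInvMid α β P Y d (a ⊗ₜ b) = homIndInvPre α β P Y d a b := rfl

theorem homIndInvMid_mul (α : R →ₐ[F] A) (β : S →ₐ[F] B) (P : ModuleCat.{u} B)
    (Y : ModuleCat.{u} (R ⊗[F] S)) (d : P →ₗ[B] B) (u : A ⊗[F] B) (v : R ⊗[F] S) (y : Y) :
    homIndInvMid α β P Y d (u * algMap α β v) y = homIndInvMid α β P Y d u (v • y) := by
  induction u using TensorProduct.induction_on with
  | zero => rw [zero_mul, map_zero, AddMonoidHom.zero_apply, AddMonoidHom.zero_apply]
  | add u u' hu hu' =>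
    rw [add_mul, map_add, map_add, AddMonoidHom.add_apply, AddMonoidHom.add_apply, hu, hu']
  | tmul a b =>
    induction v using TensorProduct.induction_on with
    | zero => rw [map_zero, mul_zero, zero_smul, map_zero, map_zero, AddMonoidHom.zero_apply]
    | add v v' hv hv' =>
      rw [map_add, mul_add, map_add, AddMonoidHom.add_apply, hv, hv', add_smul, map_add]
    | tmul r s =>
      rw [Algebra.TensorProduct.map_tmul, Algebra.TensorProduct.tmul_mul_tmul, homIndInvMid_tmul,
        homIndInvMid_tmul]
      exact homIndInvPre_smul α β P Y d a b r s y

/-- The map `(a ⊗ b) ⊗ y ↦ a ⊗ (p ↦ d(p) b ⊗ y)`. -/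
noncomputable def homIndInv (α : R →ₐ[F] A) (β : S →ₐ[F] B) (P : ModuleCat.{u} B)
    (Y : ModuleCat.{u} (R ⊗[F] S)) (d : P →ₗ[B] B) :
    IndMod (algMap α β) Y →+ IndMod α (indHom β P Y) :=
  indAddLift (algMap α β) (homIndInvMid α β P Y d) (homIndInvMid_mul α β P Y d)

theorem homIndInv_tmul (α : R →ₐ[F] A) (β : S →ₐ[F] B) (P : ModuleCat.{u} B)
    (Y : ModuleCat.{u} (R ⊗[F] S)) (d : P →ₗ[B] B) (a : A) (b : B) (y : Y) :
    homIndInv α β P Y d (indTmul (algMap α β) (a ⊗ₜ b) y) =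
      indTmul α a (rankOne β P Y d (indTmul β b (show slice Y from y))) := rfl

/-- Computes one summand of the composite of `homInd` with its inverse: a ⊗ f evaluated at e_t
returns a ⊗ (p ↦ d(p) f(e_t)). -/
theorem homIndInv_join (α : R →ₐ[F] A) (β : S →ₐ[F] B) (P : ModuleCat.{u} B)
    (Y : ModuleCat.{u} (R ⊗[F] S)) (d : P →ₗ[B] B) (a : A) (w : IndMod β (slice Y)) :
    homIndInv α β P Y d ((a ⊗ₜ[F] (1 : B)) • (show (indF (algMap α β)).obj Y from
      indJoin α β Y w)) = indTmul α a (rankOne β P Y d w) := by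
  revert w
  refine DFunLike.congr_fun (f := (homIndInv α β P Y d).comp
    ((smulHom ((indF (algMap α β)).obj Y) (a ⊗ₜ[F] (1 : B))).comp
      (indJoin α β Y).toAddMonoidHom))
    (g := AddMonoidHom.mk' (fun w => indTmul α a (rankOne β P Y d w)) fun w w' => by
      rw [rankOne_add, indTmul_add]) (indMod_hom_ext β fun b y => ?_)
  have h : smulHom ((indF (algMap α β)).obj Y) (a ⊗ₜ[F] (1 : B))
      (indJoin α β Y (indTmul β b (show slice Y from y))) =
      indTmul (algMap α β) (a ⊗ₜ[F] b) (show Y from y) := by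
    refine (congrArg _ (indJoin_tmul α β Y b y)).trans ?_
    change indTmul (algMap α β) ((a ⊗ₜ[F] (1 : B)) * ((1 : A) ⊗ₜ[F] b)) (show Y from y) = _
    simp
  exact (congrArg (homIndInv α β P Y d) h).trans (homIndInv_tmul α β P Y d a b y)

/-- This is one summand of the composite in the other order; summed over a dual basis with w =
f(e_t) it yields Σ d_t(p) f(e_t) = f(p). -/
theorem homInd_homIndInv (α : R →ₐ[F] A) (β : S →ₐ[F] B) (P : ModuleCat.{u} B)
    (Y : ModuleCat.{u} (R ⊗[F] S)) (d : P →ₗ[B] B) (w : IndMod (algMap α β) Y) (p : P) :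
    homInd α β P Y (homIndInv α β P Y d w) p =
      (((1 : A) ⊗ₜ[F] d p) • (show (indF (algMap α β)).obj Y from w) :
        (indF (algMap α β)).obj Y) := by
  revert w
  refine DFunLike.congr_fun (f := (AddMonoidHom.mk' (fun f : PHom P _ => f p)
      (fun f g => rfl)).comp ((homInd α β P Y).toAddMonoidHom.comp (homIndInv α β P Y d)))
    (g := smulHom ((indF (algMap α β)).obj Y) ((1 : A) ⊗ₜ[F] d p))
    (indMod_hom_ext (algMap α β) fun u y => ?_)
  induction u using TensorProduct.induction_on with
  | zero =>
    have : indTmul (algMap α β) 0 y = 0 := by simp [indTmul]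
    rw [this]
    exact (map_zero _).trans (map_zero _).symm
  | add u u' hu hu' =>
    rw [indTmul_add_left]
    exact (map_add _ _ _).trans ((congrArg₂ _ hu hu').trans (map_add _ _ _).symm)
  | tmul a b =>
    change homInd α β P Y (homIndInv α β P Y d (indTmul (algMap α β) (a ⊗ₜ b) y)) p =
      indTmul (algMap α β) (((1 : A) ⊗ₜ[F] d p) * (a ⊗ₜ b)) y
    rw [homIndInv_tmul, homInd_tmul, rankOne_app, smul_indTmul]
    refine (congrArg (smulHom ((indF (algMap α β)).obj Y) (a ⊗ₜ[F] (1 : B)))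
      (indJoin_tmul α β Y _ y)).trans ?_
    change indTmul (algMap α β) ((a ⊗ₜ[F] (1 : B)) * ((1 : A) ⊗ₜ[F] (d p * b))) y = _
    simp

/-- For P = B both sides are (A ⊗ B) ⊗ Y, and the property passes to retracts of Bⁿ. A dual basis
(e_t, d_t) makes the inverse explicit: f ↦ Σ_t `homIndInv` (d_t) (f(e_t)). -/
theorem homInd_bijective (α : R →ₐ[F] A) (β : S →ₐ[F] B) (P : ModuleCat.{u} B)
    (h1 : Module.Finite B P) (h2 : Module.Projective B P) (Y : ModuleCat.{u} (R ⊗[F] S)) :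
    Function.Bijective (homInd α β P Y) := by
  obtain ⟨n, e, d, hd⟩ := exists_dual_basis P h1 h2
  let ν : PHom P ((indF (algMap α β)).obj Y) →+ IndMod α (indHom β P Y) :=
    ∑ t, (homIndInv α β P Y (d t)).comp (AddMonoidHom.mk' (fun f : PHom P _ => f (e t))
      (fun f g => rfl))
  have hν : ∀ f, ν f = ∑ t, homIndInv α β P Y (d t) (f (e t)) := fun f => by
    simp only [ν, AddMonoidHom.finsetSum_apply]
    rfl
  refine Function.bijective_iff_has_inverse.2 ⟨ν, ?_, ?_⟩
  · refine DFunLike.congr_fun (f := ν.comp (homInd α β P Y).toAddMonoidHom)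
      (g := AddMonoidHom.id _) (indMod_hom_ext α fun a f => ?_)
    change ν (homInd α β P Y (indTmul α a f)) = indTmul α a f
    rw [hν]
    have : ∀ t, homIndInv α β P Y (d t) (homInd α β P Y (indTmul α a f) (e t)) =
        indTmul α a (rankOne β P Y (d t) (indHomApp f (e t))) := fun t => by
      rw [homInd_tmul, homIndInv_join]
    rw [Finset.sum_congr rfl fun t _ => this t]
    let g : indHom β P Y →+ IndMod α (indHom β P Y) :=
      AddMonoidHom.mk' (indTmul α a) (indTmul_add α a)
    refine (map_sum g (fun t => rankOne β P Y (d t) (indHomApp f (e t))) Finset.univ).symm.trans ?_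
    -- By linearity f is the sum of the maps p ↦ d_t(p) f(e_t).
    refine congrArg (indTmul α a) (indHom_ext fun p => ?_)
    have h3 : indHomApp (∑ t, rankOne β P Y (d t) (indHomApp f (e t))) p =
        ∑ t, indHomApp (rankOne β P Y (d t) (indHomApp f (e t))) p :=
      map_sum (AddMonoidHom.mk' (fun f : indHom β P Y => indHomApp f p) fun _ _ => rfl) _ _
    rw [h3]
    conv_rhs => rw [← hd p, map_sum]
    refine Finset.sum_congr rfl fun t _ => ?_
    rw [rankOne_app, map_smul]
  · intro f
    refine LinearMap.ext fun p => ?_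
    rw [hν, map_sum, LinearMap.sum_apply]
    conv_rhs => rw [← hd p, map_sum]
    refine Finset.sum_congr rfl fun t _ => ?_
    exact (homInd_homIndInv α β P Y (d t) (f (e t)) p).trans
      (LinearMap.map_smulₛₗ f (d t p) (e t)).symm

section Naturality

variable {Y Y' : ModuleCat.{u} (R ⊗[F] S)} (g : Y →ₗ[R ⊗[F] S] Y')

/-- An `(R ⊗ S)`-linear map as an `S`-linear map. -/
noncomputable abbrev sliceMap : slice Y →ₗ[S] slice Y' :=
  ((resF (Algebra.TensorProduct.includeRight : S →ₐ[F] R ⊗[F] S)).map (ModuleCat.ofHom g)).hom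

theorem sliceMap_act (r : R) (y : slice Y) :
    sliceMap g (sliceAct Y r y) = sliceAct Y' r (sliceMap g y) :=
  map_smul g (r ⊗ₜ[F] (1 : S)) (show Y from y)

/-- The map of `Hom_B(P, B ⊗_S Y)` induced by a map of `Y`. -/
noncomputable def indHomMap (β : S →ₐ[F] B) (P : ModuleCat.{u} B) :
    indHom β P Y →ₗ[R] indHom β P Y' where
  toFun f := show P →ₗ[B] IndMod β (slice Y') from indMap β (sliceMap g) ∘ₗ indHomApp f
  map_add' f f' := LinearMap.comp_add _ _ _
  map_smul' r f := LinearMap.ext fun p => by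
    change (indMap β (sliceMap g) ∘ₗ indMap β (sliceAct Y r)) (indHomApp f p) =
      (indMap β (sliceAct Y' r) ∘ₗ indMap β (sliceMap g)) (indHomApp f p)
    congr 1
    refine indMod_linear_ext β fun y => ?_
    rw [LinearMap.comp_apply, LinearMap.comp_apply, indMap_tmul, indMap_tmul, indMap_tmul,
      indMap_tmul, sliceMap_act]

theorem indHomMap_app (β : S →ₐ[F] B) (P : ModuleCat.{u} B) (f : indHom β P Y) (p : P) :
    indHomApp (indHomMap g β P f) p = indMap β (sliceMap g) (indHomApp f p) := rfl

theorem indJoin_natural (α : R →ₐ[F] A) (β : S →ₐ[F] B) (w : IndMod β (slice Y)) :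
    indJoin α β Y' (indMap β (sliceMap g) w) = indMap (algMap α β) g (indJoin α β Y w) := by
  revert w
  refine DFunLike.congr_fun (f := (indJoin α β Y' ∘ₗ indMap β (sliceMap g)).toAddMonoidHom)
    (g := (indMap (algMap α β) g).toAddMonoidHom.comp (indJoin α β Y).toAddMonoidHom)
    (indMod_hom_ext β fun b y => ?_)
  change indJoin α β Y' (indMap β (sliceMap g) (indTmul β b y)) =
    indMap (algMap α β) g (indJoin α β Y (indTmul β b y))
  rw [indMap_tmul]
  refine (indJoin_tmul α β Y' b _).trans ?_
  exact (congrArg (indMap (algMap α β) g) (indJoin_tmul α β Y b y)).symm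

theorem homInd_natural (α : R →ₐ[F] A) (β : S →ₐ[F] B) (P : ModuleCat.{u} B)
    (z : IndMod α (indHom β P Y)) (p : P) :
    homInd α β P Y' (indMap α (indHomMap g β P) z) p =
      indMap (algMap α β) g (homInd α β P Y z p) := by
  revert z
  refine DFunLike.congr_fun (f := (AddMonoidHom.mk' (fun f : PHom P _ => f p)
      (fun f g => rfl)).comp
      (homInd α β P Y' ∘ₗ indMap α (indHomMap g β P)).toAddMonoidHom)
    (g := (indMap (algMap α β) g).toAddMonoidHom.comp ((AddMonoidHom.mk' (fun f : PHom P _ => f p)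
      (fun f g => rfl)).comp (homInd α β P Y).toAddMonoidHom))
    (indMod_hom_ext α fun a f => ?_)
  change homInd α β P Y' (indMap α (indHomMap g β P) (indTmul α a f)) p =
    indMap (algMap α β) g (homInd α β P Y (indTmul α a f) p)
  rw [indMap_tmul, homInd_tmul, indHomMap_app, indJoin_natural, homInd_tmul]
  exact (map_smul (indMap (algMap α β) g) _ _).symm

end Naturality

end HomInd

/-! ### Induction and products with finitely many nonzero factors -/

section PiInd

variable {F : Type u} [Field F] {R A : Type u} [Ring R] [Algebra F R] [Ring A] [Algebra F A]

theorem indMap_comp_apply (φ : R →ₐ[F] A) {N N' N'' : ModuleCat.{u} R} (g : N' →ₗ[R] N'')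
    (f : N →ₗ[R] N') (z : IndMod φ N) : indMap φ g (indMap φ f z) = indMap φ (g ∘ₗ f) z :=
  LinearMap.congr_fun (f := indMap φ g ∘ₗ indMap φ f) (g := indMap φ (g ∘ₗ f))
    (indMod_linear_ext φ fun _ => rfl) z

theorem indMap_zero (φ : R →ₐ[F] A) (N N' : ModuleCat.{u} R) :
    indMap φ (0 : N →ₗ[R] N') = 0 :=
  indMod_linear_ext φ fun n => by
    rw [indMap_tmul, LinearMap.zero_apply, LinearMap.zero_apply]
    exact map_zero (indUnit φ N')

theorem indMap_id (φ : R →ₐ[F] A) (N : ModuleCat.{u} R) :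
    indMap φ (LinearMap.id : N →ₗ[R] N) = LinearMap.id :=
  indMod_linear_ext φ fun _ => rfl

theorem indMap_sum (φ : R →ₐ[F] A) {N N' : ModuleCat.{u} R} {σ : Type*} (s : Finset σ)
    (f : σ → N →ₗ[R] N') : indMap φ (∑ t ∈ s, f t) = ∑ t ∈ s, indMap φ (f t) :=
  map_sum (AddMonoidHom.mk' (fun f : N →ₗ[R] N' => indMap φ f) (indMap_add φ)) f s

/-- Induction commutes with direct products with finitely many nonzero factors. -/
theorem indMap_pi_bijective (φ : R →ₐ[F] A) {σ : Type*} (H : σ → ModuleCat.{u} R)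
    (D : ModuleCat.{u} R) (π : ∀ t, D →ₗ[R] H t) (hfin : {t | Nontrivial (H t)}.Finite)
    (hbij : Function.Bijective (LinearMap.pi π)) :
    Function.Bijective (LinearMap.pi fun t => indMap φ (π t)) := by
  classical
  let e := LinearEquiv.ofBijective (LinearMap.pi π) hbij
  -- The inclusions of the factors into `D`. The relations π_t κ_t = 1, π_t κ_t' = 0 for t ≠ t' and
  -- Σ κ_t π_t = 1 are preserved by the additive functor Ind, and they exhibit the induced module as
  -- a product again.
  let κ : ∀ t, H t →ₗ[R] D := fun t => e.symm.toLinearMap ∘ₗ LinearMap.single R (fun t => H t) t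
  have he : ∀ d t, e d t = π t d := fun d t => rfl
  have h1 : ∀ t, π t ∘ₗ κ t = LinearMap.id := fun t => by
    ext x
    rw [LinearMap.comp_apply, ← he]
    simp [κ]
  have h2 : ∀ t t', t ≠ t' → π t ∘ₗ κ t' = 0 := fun t t' h => by
    ext x
    rw [LinearMap.comp_apply, ← he]
    simp [κ, h]
  have h3 : ∑ t ∈ hfin.toFinset, κ t ∘ₗ π t = LinearMap.id := by
    ext d
    apply e.injective
    rw [LinearMap.sum_apply, map_sum]
    funext t
    rw [Finset.sum_apply]
    by_cases ht : Nontrivial (H t)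
    · rw [Finset.sum_eq_single t]
      · rw [he, LinearMap.comp_apply]
        exact LinearMap.congr_fun (h1 t) (π t d)
      · intro b _ hb
        rw [he, LinearMap.comp_apply]
        exact LinearMap.congr_fun (h2 t b hb.symm) (π b d)
      · intro hn
        exact absurd (hfin.mem_toFinset.2 ht) hn
    · have := not_nontrivial_iff_subsingleton.1 ht
      exact Subsingleton.elim _ _
  refine Function.bijective_iff_has_inverse.2
    ⟨fun w => ∑ t ∈ hfin.toFinset, indMap φ (κ t) (w t), fun z => ?_, fun w => ?_⟩
  · change ∑ t ∈ hfin.toFinset, indMap φ (κ t) (indMap φ (π t) z) = z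
    have : ∀ t, indMap φ (κ t) (indMap φ (π t) z) = indMap φ (κ t ∘ₗ π t) z := fun t =>
      indMap_comp_apply φ _ _ z
    rw [Finset.sum_congr rfl fun t _ => this t, ← LinearMap.sum_apply, ← indMap_sum, h3, indMap_id]
    rfl
  · funext t
    change indMap φ (π t) (∑ t ∈ hfin.toFinset, indMap φ (κ t) (w t)) = w t
    rw [map_sum]
    have h4 : ∀ t', indMap φ (π t) (indMap φ (κ t') (w t')) = indMap φ (π t ∘ₗ κ t') (w t') :=
      fun t' => indMap_comp_apply φ _ _ _
    by_cases ht : Nontrivial (H t)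
    · rw [Finset.sum_eq_single t]
      · rw [h4, h1, indMap_id]
        rfl
      · intro b _ hb
        rw [h4, h2 t b hb.symm, indMap_zero]
        rfl
      · intro hn
        exact absurd (hfin.mem_toFinset.2 ht) hn
    · have := subsingleton_ind φ (H t) (not_nontrivial_iff_subsingleton.1 ht)
      exact Subsingleton.elim _ _

end PiInd

/-! ### The adjunction applied with one index of Y held fixed -/

namespace Tower

variable {F : Type u} [Field F] (T : Tower F)

section Cross

/-- The component `Y_{i,-}` of an object of `A-mod^{⊗4}`, as an object of `A-mod^{⊗2}`. -/
noncomputable def sliceG (Y : T.Md₄) (i : ℕ × ℕ) : T.Md₂ :=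
  ⟨fun j => slice (Y.obj (i, j)), fun j => finite_resF _ _ (Y.property.1 (i, j)),
    (Y.property.2.preimage (f := fun j => (i, j)) (fun _ _ _ _ h => congrArg Prod.snd h)).subset
      fun _ hj => hj⟩

variable {ψ : ∀ n, T.A n ≃ₐ[F] T.A n} (adj : T.conjDelta ψ ⊣ T.nabla)

/-- The module `Hom(Q, Y)_i`. -/
noncomputable abbrev homObj (Q : T.Md₂) (Y : T.Md₄) (i : ℕ × ℕ) : ModuleCat.{u} (T.A₂ i) :=
  ModuleCat.of (T.A₂ i) (∀ j, (homF (F := F) (R := T.A₂ i) (Q.obj j)).obj (Y.obj (i, j)))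

/-- The components of an element of `Hom(Q, Y)_i`. -/
noncomputable def homObjApp {Q : T.Md₂} {Y : T.Md₄} {i : ℕ × ℕ} (f : T.homObj Q Y i)
    (j : ℕ × ℕ) : Q.obj j →ₗ[T.A₂ j] slice (Y.obj (i, j)) :=
  let g : PHom (Q.obj j) (Y.obj (i, j)) := f j
  { toFun := fun x => g x
    map_add' := map_add g
    map_smul' := fun s x => LinearMap.map_smulₛₗ g s x }

/-- The morphism `Q → Y_{i,-}` given by an element of `Hom(Q, Y)_i`. -/
noncomputable def homObjHom {Q : T.Md₂} {Y : T.Md₄} {i : ℕ × ℕ} (f : T.homObj Q Y i) :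
    Q ⟶ T.sliceG Y i :=
  ObjectProperty.homMk fun j =>
    ModuleCat.ofHom (X := Q.obj j) (Y := slice (Y.obj (i, j))) (T.homObjApp f j)

/-- In this form, as morphisms of A-mod^{⊗2}, the elements of Hom(Q, Y)_i are accessible to the
adjunction. -/
theorem homObjHom_bijective (Q : T.Md₂) (Y : T.Md₄) (i : ℕ × ℕ) :
    Function.Bijective (T.homObjHom (Q := Q) (Y := Y) (i := i)) := by
  constructor
  · intro f g h
    refine funext fun j => LinearMap.ext fun x => ?_
    exact congrArg (fun q : Q ⟶ T.sliceG Y i => (q.hom j).hom x) h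
  · intro g
    refine ⟨fun j => show PHom (Q.obj j) (Y.obj (i, j)) from
      { toFun := fun x => (g.hom j).hom x
        map_add' := map_add (g.hom j).hom
        map_smul' := fun s x => map_smul (g.hom j).hom s x }, rfl⟩

/-- The indices `(p, j)` with `j₁ + j₂ = p`. -/
abbrev CrossIdx : Type := Σ p : ℕ, {j : ℕ × ℕ // T.mult.g j = p}

/-- The module `Hom(P_p, Ind(Y_{i,j}))`. -/
noncomputable abbrev adjObj (P : T.Md) (Y : T.Md₄) (i : ℕ × ℕ) (t : T.CrossIdx) :
    ModuleCat.{u} (T.A₂ i) :=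
  indHom (T.mult.hom t.2.2) (P.obj t.1) (Y.obj (i, t.2.1))

/-- The value at `P` of the unit of the adjunction, in degree `(p, j)`. -/
noncomputable def unitApp (P : T.Md) (t : T.CrossIdx) :
    P.obj t.1 →ₗ[T.A t.1] IndMod (T.mult.hom t.2.2) (((T.conjDelta ψ).obj P).obj t.2.1) :=
  (LinearMap.proj t.2 : (∀ j : {j // T.mult.g j = t.1},
    IndMod (T.mult.hom j.2) (((T.conjDelta ψ).obj P).obj j.1)) →ₗ[T.A t.1] _) ∘ₗ
      ((adj.unit.app P).hom t.1).hom

/-- The components of the isomorphism `Hom(Ψ^{⊗2}ΔΨ⁻¹(P), Y_{i,-}) ≅ Hom(P, ∇(Y_{i,-}))`. -/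
noncomputable def adjMap (P : T.Md) (Y : T.Md₄) (i : ℕ × ℕ) (t : T.CrossIdx) :
    T.homObj ((T.conjDelta ψ).obj P) Y i →ₗ[T.A₂ i] T.adjObj P Y i t where
  toFun f := show P.obj t.1 →ₗ[T.A t.1] IndMod (T.mult.hom t.2.2) (slice (Y.obj (i, t.2.1))) from
    indMap (T.mult.hom t.2.2) (T.homObjApp f t.2.1) ∘ₗ T.unitApp adj P t
  map_add' f g := by
    have : T.homObjApp (f + g) t.2.1 = T.homObjApp f t.2.1 + T.homObjApp g t.2.1 := rfl
    rw [this, indMap_add]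
    rfl
  map_smul' r f := indHom_ext fun x => by
    have : T.homObjApp (r • f) t.2.1 = sliceAct (Y.obj (i, t.2.1)) r ∘ₗ T.homObjApp f t.2.1 := rfl
    change indMap (T.mult.hom t.2.2) (T.homObjApp (r • f) t.2.1) (T.unitApp adj P t x) =
      indMap (T.mult.hom t.2.2) (sliceAct (Y.obj (i, t.2.1)) r)
        (indMap (T.mult.hom t.2.2) (T.homObjApp f t.2.1) (T.unitApp adj P t x))
    rw [this, indMap_comp_apply]

/-- `adjMap` is built from the unit, so that its linearity over `T.A₂ i` is visible; bijectivity is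
inherited from `homEquiv` through this comparison. -/
theorem adjMap_eq (P : T.Md) (Y : T.Md₄) (i : ℕ × ℕ) (t : T.CrossIdx)
    (f : T.homObj ((T.conjDelta ψ).obj P) Y i) (x : P.obj t.1) :
    indHomApp (T.adjMap adj P Y i t f) x =
      (show ∀ j : {j // T.mult.g j = t.1}, IndMod (T.mult.hom j.2) (slice (Y.obj (i, j.1))) from
        ((adj.homEquiv P (T.sliceG Y i) (T.homObjHom f)).hom t.1).hom x) t.2 := by
  rw [Adjunction.homEquiv_unit]
  rfl

/-- The degree p part of ∇(Y_{i,-}) is a product over the j above p. Hence a family indexed by all t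
= (p, j) is the same as a morphism P → ∇(Y_{i,-}), to which the adjunction bijection applies. -/
theorem adjMap_bijective (P : T.Md) (Y : T.Md₄) (i : ℕ × ℕ) :
    Function.Bijective (LinearMap.pi (T.adjMap adj P Y i)) := by
  constructor
  · intro f g h
    apply (T.homObjHom_bijective _ _ _).1
    apply (adj.homEquiv P (T.sliceG Y i)).injective
    apply ObjectProperty.hom_ext
    funext p
    apply ModuleCat.hom_ext
    ext x
    refine funext fun j : {j // T.mult.g j = p} => ?_
    have h1 := congrArg (fun q : T.adjObj P Y i ⟨p, j⟩ => indHomApp q x) (congrFun h ⟨p, j⟩)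
    exact (T.adjMap_eq adj P Y i ⟨p, j⟩ f x).symm.trans
      (h1.trans (T.adjMap_eq adj P Y i ⟨p, j⟩ g x))
  · intro w
    let g : P ⟶ T.nabla.obj (T.sliceG Y i) := ObjectProperty.homMk fun p =>
      ModuleCat.ofHom (LinearMap.pi fun j : {j // T.mult.g j = p} => indHomApp (w ⟨p, j⟩))
    obtain ⟨f, hf⟩ := (T.homObjHom_bijective _ _ _).2 ((adj.homEquiv P (T.sliceG Y i)).symm g)
    refine ⟨f, funext fun t => indHom_ext fun x => ?_⟩
    refine (T.adjMap_eq adj P Y i t f x).trans ?_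
    rw [hf, Equiv.apply_symm_apply]
    rfl

theorem adjMap_natural (P : T.Md) {Y Y' : T.Md₄} (g : Y ⟶ Y') (i : ℕ × ℕ) (t : T.CrossIdx)
    (f : T.homObj ((T.conjDelta ψ).obj P) Y i) :
    T.adjMap adj P Y' i t ((((grHom ((T.conjDelta ψ).obj P)).map g).hom i).hom f) =
      indHomMap (g.hom (i, t.2.1)).hom _ _ (T.adjMap adj P Y i t f) :=
  indHom_ext fun x => by
    have h : T.homObjApp ((((grHom ((T.conjDelta ψ).obj P)).map g).hom i).hom f) t.2.1 =
      sliceMap (g.hom (i, t.2.1)).hom ∘ₗ T.homObjApp f t.2.1 := rfl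
    change indMap (T.mult.hom t.2.2)
        (T.homObjApp ((((grHom ((T.conjDelta ψ).obj P)).map g).hom i).hom f) t.2.1)
        (T.unitApp adj P t x) =
      indMap (T.mult.hom t.2.2) (sliceMap (g.hom (i, t.2.1)).hom)
        (indMap (T.mult.hom t.2.2) (T.homObjApp f t.2.1) (T.unitApp adj P t x))
    rw [h, indMap_comp_apply]

end Cross

end Tower

/-! ### The crossing isomorphism for Res_P ∘ Ind_M -/

namespace Tower

variable {F : Type u} [Field F] (T : Tower F)
variable {ψ : ∀ n, T.A n ≃ₐ[F] T.A n} (adj : T.conjDelta ψ ⊣ T.nabla)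

/-- The map `Ind(Hom(Ψ^{⊗2}ΔΨ⁻¹(P), Y)_i) → Hom(P_p, Ind(Y_{i,j}))`. -/
noncomputable def crossComp (P : T.Md) (Y : T.Md₄) {k : ℕ} {i : ℕ × ℕ} (h : T.mult.g i = k)
    (t : T.CrossIdx) : IndMod (T.mult.hom h) (T.homObj ((T.conjDelta ψ).obj P) Y i) →ₗ[T.A k]
      PHom (P.obj t.1) ((indF (algMap (T.mult.hom h) (T.mult.hom t.2.2))).obj
        (Y.obj (i, t.2.1))) :=
  homInd (T.mult.hom h) (T.mult.hom t.2.2) (P.obj t.1) (Y.obj (i, t.2.1)) ∘ₗ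
    indMap (T.mult.hom h) (T.adjMap adj P Y i t)

/-- Induction is applied to the product decomposition of `adjMap_bijective` and commutes with it; on
each factor `homInd_bijective` then uses the projectivity of P. -/
theorem crossComp_bijective (P : T.Md) (hP : IsProj T.A P) (Y : T.Md₄) {k : ℕ} {i : ℕ × ℕ}
    (h : T.mult.g i = k) :
    Function.Bijective (fun z t => T.crossComp adj P Y h t z) := by
  have h1 : Function.Bijective (LinearMap.pi fun t =>
      indMap (T.mult.hom h) (T.adjMap adj P Y i t)) := by
    refine indMap_pi_bijective (T.mult.hom h) (T.adjObj P Y i) _ (T.adjMap adj P Y i) ?_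
      (T.adjMap_bijective adj P Y i)
    -- Only finitely many indices t contribute: P has finitely many nonzero degrees p, and each has
    -- finitely many decompositions j.
    have hfin : (⋃ p ∈ {p | Nontrivial (P.obj p)},
        Set.range (fun j : {j // T.mult.g j = p} => (⟨p, j⟩ : T.CrossIdx))).Finite :=
      P.property.2.biUnion fun p _ => by
        have : Finite {j // T.mult.g j = p} := T.mult.fib p
        exact Set.finite_range _
    refine hfin.subset fun t ht => ?_
    refine Set.mem_biUnion (x := t.1) ?_ ⟨t.2, rfl⟩
    by_contra hne
    have hs : Subsingleton (P.obj t.1) := not_nontrivial_iff_subsingleton.1 hne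
    refine not_nontrivial_iff_subsingleton.2 ?_ ht
    refine ⟨fun f g => indHom_ext fun p => ?_⟩
    rw [Subsingleton.elim p 0, map_zero, map_zero]
  have h2 := Function.Bijective.piMap fun t : T.CrossIdx =>
    homInd_bijective (T.mult.hom h) (T.mult.hom t.2.2) (P.obj t.1) (P.property.1 _) (hP _)
      (Y.obj (i, t.2.1))
  exact h2.comp h1

/-- The canonical map `∇ Hom(Ψ^{⊗2}ΔΨ⁻¹(P), Y) → Hom(P, ∇^{⊗2} Y)`, in degree `k`. -/
noncomputable def crossHom (P : T.Md) (Y : T.Md₄) (k : ℕ) :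
    (T.nabla.obj ((grHom ((T.conjDelta ψ).obj P)).obj Y)).obj k →ₗ[T.A k]
      ((grHom P).obj (T.nabla₂.obj Y)).obj k where
  toFun z := show ∀ p, PHom (P.obj p) ((T.nabla₂.obj Y).obj (k, p)) from fun p =>
    { toFun := fun x => show ∀ q : {q // T.mult₂.g q = (k, p)}, IndMod (T.mult₂.hom q.2)
          (Y.obj q.1) from fun q =>
        T.crossComp adj P Y (congrArg Prod.fst q.2) ⟨p, ⟨q.1.2, congrArg Prod.snd q.2⟩⟩
          ((show ∀ i : {i // T.mult.g i = k}, IndMod (T.mult.hom i.2)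
            (T.homObj ((T.conjDelta ψ).obj P) Y i.1) from z) ⟨q.1.1, congrArg Prod.fst q.2⟩) x
      map_add' := fun x y => funext fun _ => map_add _ x y
      map_smul' := fun s x => funext fun q => LinearMap.map_smulₛₗ
        (T.crossComp adj P Y (congrArg Prod.fst q.2) ⟨p, ⟨q.1.2, congrArg Prod.snd q.2⟩⟩
          ((show ∀ i : {i // T.mult.g i = k}, IndMod (T.mult.hom i.2)
            (T.homObj ((T.conjDelta ψ).obj P) Y i.1) from z) ⟨q.1.1, congrArg Prod.fst q.2⟩)) s x }
  map_add' z w := funext fun p => LinearMap.ext fun x => funext fun q => LinearMap.congr_fun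
    (map_add (T.crossComp adj P Y (congrArg Prod.fst q.2) ⟨p, ⟨q.1.2, congrArg Prod.snd q.2⟩⟩)
      ((show ∀ i : {i // T.mult.g i = k}, IndMod (T.mult.hom i.2)
        (T.homObj ((T.conjDelta ψ).obj P) Y i.1) from z) ⟨q.1.1, congrArg Prod.fst q.2⟩)
      ((show ∀ i : {i // T.mult.g i = k}, IndMod (T.mult.hom i.2)
        (T.homObj ((T.conjDelta ψ).obj P) Y i.1) from w) ⟨q.1.1, congrArg Prod.fst q.2⟩)) x
  map_smul' r z := funext fun p => LinearMap.ext fun x => funext fun q => LinearMap.congr_fun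
    (map_smul (T.crossComp adj P Y (congrArg Prod.fst q.2) ⟨p, ⟨q.1.2, congrArg Prod.snd q.2⟩⟩) r
      ((show ∀ i : {i // T.mult.g i = k}, IndMod (T.mult.hom i.2)
        (T.homObj ((T.conjDelta ψ).obj P) Y i.1) from z) ⟨q.1.1, congrArg Prod.fst q.2⟩)) x

/-- The components of an element of `∇ Hom(Q, Y)`. -/
noncomputable def crossSrc {Q : T.Md₂} {Y : T.Md₄} {k : ℕ}
    (z : (T.nabla.obj ((grHom Q).obj Y)).obj k) {i : ℕ × ℕ} (h : T.mult.g i = k) :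
    IndMod (T.mult.hom h) (T.homObj Q Y i) :=
  (show ∀ i : {i // T.mult.g i = k}, IndMod (T.mult.hom i.2) (T.homObj Q Y i.1) from z) ⟨i, h⟩

/-- The components of an element of `Hom(P, ∇^{⊗2} Y)`. -/
noncomputable def crossTgt {P : T.Md} {Y : T.Md₄} {k : ℕ}
    (w : ((grHom P).obj (T.nabla₂.obj Y)).obj k) {i : ℕ × ℕ} (h : T.mult.g i = k)
    (t : T.CrossIdx) : PHom (P.obj t.1)
      ((indF (algMap (T.mult.hom h) (T.mult.hom t.2.2))).obj (Y.obj (i, t.2.1))) where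
  toFun x := (show ∀ q : {q // T.mult₂.g q = (k, t.1)}, IndMod (T.mult₂.hom q.2) (Y.obj q.1) from
    (show PHom (P.obj t.1) ((T.nabla₂.obj Y).obj (k, t.1)) from
      (show ∀ p, PHom (P.obj p) ((T.nabla₂.obj Y).obj (k, p)) from w) t.1) x)
        ⟨(i, t.2.1), Prod.ext h t.2.2⟩
  map_add' x y := congrFun (f := (show ∀ q : {q // T.mult₂.g q = (k, t.1)},
    IndMod (T.mult₂.hom q.2) (Y.obj q.1) from _)) (map_add
    (show PHom (P.obj t.1) ((T.nabla₂.obj Y).obj (k, t.1)) from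
      (show ∀ p, PHom (P.obj p) ((T.nabla₂.obj Y).obj (k, p)) from w) t.1) x y) _
  map_smul' s x := congrFun (f := (show ∀ q : {q // T.mult₂.g q = (k, t.1)},
    IndMod (T.mult₂.hom q.2) (Y.obj q.1) from _)) (LinearMap.map_smulₛₗ
    (show PHom (P.obj t.1) ((T.nabla₂.obj Y).obj (k, t.1)) from
      (show ∀ p, PHom (P.obj p) ((T.nabla₂.obj Y).obj (k, p)) from w) t.1) s x) _

theorem crossTgt_ext {P : T.Md} {Y : T.Md₄} {k : ℕ}
    {w w' : ((grHom P).obj (T.nabla₂.obj Y)).obj k}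
    (h : ∀ i (h : T.mult.g i = k) t x, T.crossTgt w h t x = T.crossTgt w' h t x) : w = w' :=
  funext fun p => LinearMap.ext fun x => funext fun q : {q // T.mult₂.g q = (k, p)} =>
    h q.1.1 (congrArg Prod.fst q.2) ⟨p, ⟨q.1.2, congrArg Prod.snd q.2⟩⟩ x

theorem crossTgt_crossHom (P : T.Md) (Y : T.Md₄) (k : ℕ)
    (z : (T.nabla.obj ((grHom ((T.conjDelta ψ).obj P)).obj Y)).obj k) {i : ℕ × ℕ}
    (h : T.mult.g i = k) (t : T.CrossIdx) :
    T.crossTgt (T.crossHom adj P Y k z) h t = T.crossComp adj P Y h t (T.crossSrc z h) := rfl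

/-- An index of `mult₂` above (k, p) is a pair consisting of an i above k and a j above p. Up to
this reindexing the map is the product over i of the bijections in `crossComp_bijective`. -/
theorem crossHom_bijective (P : T.Md) (hP : IsProj T.A P) (Y : T.Md₄) (k : ℕ) :
    Function.Bijective (T.crossHom adj P Y k) := by
  constructor
  · intro z z' hz
    refine funext fun i : {i // T.mult.g i = k} => ?_
    refine (T.crossComp_bijective adj P hP Y i.2).1 (funext fun t => ?_)
    exact congrArg (fun w => T.crossTgt w i.2 t) hz
  · intro w
    choose z hz using fun i : {i // T.mult.g i = k} =>
      (T.crossComp_bijective adj P hP Y i.2).2 (fun t => T.crossTgt w i.2 t)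
    refine ⟨z, T.crossTgt_ext fun i h t x => ?_⟩
    exact DFunLike.congr_fun (congrFun (hz ⟨i, h⟩) t) x

theorem crossComp_natural (P : T.Md) {Y Y' : T.Md₄} (g : Y ⟶ Y') {k : ℕ} {i : ℕ × ℕ}
    (h : T.mult.g i = k) (t : T.CrossIdx)
    (z : IndMod (T.mult.hom h) (T.homObj ((T.conjDelta ψ).obj P) Y i)) (x : P.obj t.1) :
    T.crossComp adj P Y' h t (indMap (T.mult.hom h)
      (((grHom ((T.conjDelta ψ).obj P)).map g).hom i).hom z) x =
      indMap (algMap (T.mult.hom h) (T.mult.hom t.2.2)) (g.hom (i, t.2.1)).hom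
        (T.crossComp adj P Y h t z x) := by
  have h3 : T.adjMap adj P Y' i t ∘ₗ (((grHom ((T.conjDelta ψ).obj P)).map g).hom i).hom =
      indHomMap (g.hom (i, t.2.1)).hom (T.mult.hom t.2.2) (P.obj t.1) ∘ₗ T.adjMap adj P Y i t :=
    LinearMap.ext fun f => T.adjMap_natural adj P g i t f
  have h4 := homInd_natural (g.hom (i, t.2.1)).hom (T.mult.hom h) (T.mult.hom t.2.2) (P.obj t.1)
    (indMap (T.mult.hom h) (T.adjMap adj P Y i t) z) x
  have h5 := (indMap_comp_apply (T.mult.hom h) (T.adjMap adj P Y' i t)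
    (((grHom ((T.conjDelta ψ).obj P)).map g).hom i).hom z).trans
    ((congrArg (fun f => indMap (T.mult.hom h) f z) h3).trans
      (indMap_comp_apply (T.mult.hom h) _ (T.adjMap adj P Y i t) z).symm)
  exact (congrArg (fun w => homInd (T.mult.hom h) (T.mult.hom t.2.2) (P.obj t.1)
    (Y'.obj (i, t.2.1)) w x) h5).trans h4

theorem crossTgt_map (P : T.Md) {Y Y' : T.Md₄} (g : Y ⟶ Y') {k : ℕ}
    (w : ((grHom P).obj (T.nabla₂.obj Y)).obj k) {i : ℕ × ℕ} (h : T.mult.g i = k)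
    (t : T.CrossIdx) (x : P.obj t.1) :
    T.crossTgt ((((grHom P).map (T.nabla₂.map g)).hom k).hom w) h t x =
      indMap (algMap (T.mult.hom h) (T.mult.hom t.2.2)) (g.hom (i, t.2.1)).hom
        (T.crossTgt w h t x) := rfl

theorem crossSrc_map (Q : T.Md₂) {Y Y' : T.Md₄} (g : Y ⟶ Y') {k : ℕ}
    (z : (T.nabla.obj ((grHom Q).obj Y)).obj k) {i : ℕ × ℕ} (h : T.mult.g i = k) :
    T.crossSrc (((T.nabla.map ((grHom Q).map g)).hom k).hom z) h =
      indMap (T.mult.hom h) (((grHom Q).map g).hom i).hom (T.crossSrc z h) := rfl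

theorem crossHom_natural (P : T.Md) {Y Y' : T.Md₄} (g : Y ⟶ Y') (k : ℕ)
    (z : (T.nabla.obj ((grHom ((T.conjDelta ψ).obj P)).obj Y)).obj k) :
    T.crossHom adj P Y' k (((T.nabla.map ((grHom ((T.conjDelta ψ).obj P)).map g)).hom k).hom z) =
      ((((grHom P).map (T.nabla₂.map g)).hom k).hom (T.crossHom adj P Y k z)) :=
  T.crossTgt_ext fun i h t x => by
    rw [crossTgt_crossHom, crossSrc_map, crossTgt_map, crossTgt_crossHom]
    exact T.crossComp_natural adj P g h t _ x

/-- `Res_P ∘ Ind_M ≅ ∇ Res_{Ψ^{⊗2}ΔΨ⁻¹(P)}(M ⊗ -)`. -/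
theorem nonempty_cross_iso (hT : T.IsStrongWith ψ) (M P : T.Md) (hP : IsProj T.A P) :
    Nonempty (T.Ind M ⋙ T.Res P ≅ T.ext M ⋙ T.Res₂ ((T.conjDelta ψ).obj P) ⋙ T.nabla) := by
  obtain ⟨adj⟩ := hT.adjoint
  obtain ⟨mac⟩ := hT.mackey
  obtain ⟨e⟩ := nonempty_natIso
    (Φ := grHom ((T.conjDelta ψ).obj P) ⋙ T.nabla) (Ψ := T.nabla₂ ⋙ grHom P)
    (fun Y k => LinearEquiv.ofBijective (T.crossHom adj P Y k) (T.crossHom_bijective adj P hP Y k))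
    (fun g k z => T.crossHom_natural adj P g k z)
  -- The Mackey isomorphism is applied inside Hom(P, -), followed by the inverse of `e` at Y = S₂₃
  -- Δ^{⊗2}(M ⊗ -).
  exact ⟨Functor.isoWhiskerLeft (T.ext M) (Functor.isoWhiskerRight mac (grHom P)) ≪≫
    Functor.isoWhiskerLeft (T.ext M ⋙ T.delta₂ ⋙ T.s₂₃) e.symm⟩

end Tower

/-! ### The Heisenberg double and its Fock space, for a dual pair -/

section HopfLemmas

variable {k : Type*} [CommRing k]
variable {Hm Hp : Type*} [AddCommGroup Hm] [Module k Hm] [AddCommGroup Hp] [Module k Hp]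
variable {om : HopfOps k Hm} {op : HopfOps k Hp} {b : Hm →ₗ[k] Hp →ₗ[k] k}

/-- The contraction `u ⊗ v ↦ ⟨x, v⟩ u`. -/
noncomputable def contract (b : Hm →ₗ[k] Hp →ₗ[k] k) (x : Hm) : Hp ⊗[k] Hp →ₗ[k] Hp :=
  (TensorProduct.rid k Hp).toLinearMap ∘ₗ (b x).lTensor Hp

@[simp] theorem contract_tmul (x : Hm) (u v : Hp) : contract b x (u ⊗ₜ v) = b x v • u := by
  simp [contract]

theorem leftReg_apply (x : Hm) (a : Hp) : leftReg op b x a = contract b x (op.comul a) := rfl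

theorem leftReg_one (hop : op.IsBialgebra) (h : IsHopfPairing om op b) :
    leftReg op b om.one = LinearMap.id := by
  ext a
  have h1 : b om.one = op.counit := LinearMap.ext h.one_left
  rw [leftReg_apply, contract, h1, LinearMap.comp_apply, hop.lTensor_counit]
  simp

/-- Coassociativity, with ⟨xy, c⟩ = ⟨x ⊗ y, Δc⟩: both sides pair x ⊗ y with the last two factors of
the iterated coproduct of a. Being adjoint to right multiplications, these operators compose without
reversing the order. -/
theorem leftReg_mul (hop : op.IsBialgebra) (h : IsHopfPairing om op b) (x y : Hm) :
    leftReg op b (om.mul x y) = leftReg op b x ∘ₗ leftReg op b y := by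
  ext a
  let ξ : Hp ⊗[k] (Hp ⊗[k] Hp) →ₗ[k] Hp :=
    (TensorProduct.rid k Hp).toLinearMap ∘ₗ (tensorPairing b (x ⊗ₜ y)).lTensor Hp
  have h1 : b (om.mul x y) = tensorPairing b (x ⊗ₜ y) ∘ₗ op.comul :=
    LinearMap.ext fun c => h.mul_left x y c
  have h2 : leftReg op b (om.mul x y) a = ξ (op.comul.lTensor Hp (op.comul a)) := by
    rw [leftReg_apply, contract, h1, LinearMap.lTensor_comp]
    rfl
  have h3 : ∀ s : Hp ⊗[k] Hp, leftReg op b x (contract b y s) =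
      ξ (TensorProduct.assoc k Hp Hp Hp (op.comul.rTensor Hp s)) := fun s => by
    induction s using TensorProduct.induction_on with
    | zero => simp
    | add s t hs ht => simp only [map_add, hs, ht]
    | tmul u w =>
      rw [contract_tmul, map_smul, leftReg_apply, LinearMap.rTensor_tmul]
      induction op.comul u using TensorProduct.induction_on with
      | zero => simp
      | add s t hs ht => simp only [map_add, smul_add, TensorProduct.add_tmul, hs, ht]
      | tmul u v =>
        rw [contract_tmul, TensorProduct.assoc_tmul]
        simp [ξ, tensorPairing, smul_smul, mul_comm]
  rw [LinearMap.comp_apply, leftReg_apply y, h3, hop.coassoc, h2]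

/-- The coproduct of a product is the product of the coproducts, and contracting a product with x
uses ⟨x, vv'⟩ = ⟨Δx, v ⊗ v'⟩. -/
theorem leftReg_cross (hop : op.IsBialgebra) (h : IsHopfPairing om op b) (x : Hm) (a c : Hp) :
    leftReg op b x (op.mul a c) = TensorProduct.lift op.mul
      (TensorProduct.map₂ (leftReg op b) (leftReg op b) (om.comul x) (a ⊗ₜ c)) := by
  let C : Hm →ₗ[k] Hp ⊗[k] Hp →ₗ[k] Hp :=
    { toFun := contract b
      map_add' := fun x y => TensorProduct.ext' fun u v => by simp [add_smul]
      map_smul' := fun r x => TensorProduct.ext' fun u v => by simp [mul_smul] }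
  have hC : ∀ y s, C y s = contract b y s := fun _ _ => rfl
  -- The coproducts of a and c are replaced by arbitrary tensors s and t, so that the identity can
  -- be checked on pure tensors.
  have h1 : ∀ s t : Hp ⊗[k] Hp, contract b x (TensorProduct.map₂ op.mul op.mul s t) =
      TensorProduct.lift op.mul (TensorProduct.map₂ C C (om.comul x) (s ⊗ₜ t)) := fun s t => by
    induction s using TensorProduct.induction_on with
    | zero => simp
    | add s s' hs hs' =>
      simp only [map_add, LinearMap.add_apply, TensorProduct.add_tmul, hs, hs']
    | tmul u v =>
      induction t using TensorProduct.induction_on with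
      | zero => simp
      | add s s' hs hs' => simp only [map_add, TensorProduct.tmul_add, hs, hs']
      | tmul u' v' =>
        rw [TensorProduct.map₂_apply_tmul, TensorProduct.map_tmul, contract_tmul, h.mul_right]
        induction om.comul x using TensorProduct.induction_on with
        | zero => simp
        | add s t hs ht => simp only [map_add, LinearMap.add_apply, add_smul, hs, ht]
        | tmul y z =>
          rw [TensorProduct.map₂_apply_tmul, TensorProduct.map_tmul, hC, hC, contract_tmul,
            contract_tmul]
          simp [tensorPairing, smul_smul, mul_comm]
  rw [leftReg_apply, hop.comul_mul, h1]
  induction om.comul x using TensorProduct.induction_on with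
  | zero => simp
  | add s t hs ht => simp only [map_add, LinearMap.add_apply, hs, ht]
  | tmul y z => rfl

/-- This form is linear in the coproduct of x, which later proofs replace by pure tensors. -/
theorem heisMul_tmul (a c : Hp) (x y : Hm) : heisMul om op b (a ⊗ₜ x) (c ⊗ₜ y) =
    TensorProduct.map (op.mul a ∘ₗ (leftReg op b).flip c) (om.mul.flip y) (om.comul x) := by
  change TensorProduct.map (TensorProduct.lift op.mul) (TensorProduct.lift om.mul)
    ((TensorProduct.tensorTensorTensorAssoc k Hp Hp Hm Hm).symm
      ((a ⊗ₜ ((TensorProduct.lift (leftReg op b)).rTensor Hm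
        (TensorProduct.rightComm k Hm Hm Hp (om.comul x ⊗ₜ c)))) ⊗ₜ y)) = _
  induction om.comul x using TensorProduct.induction_on with
  | zero => simp
  | add s t hs ht => simp only [map_add, TensorProduct.add_tmul, TensorProduct.tmul_add, hs, ht]
  | tmul u v => simp

theorem fockAct_one (hop : op.IsBialgebra) (h : IsHopfPairing om op b) :
    fockAct op b (op.one ⊗ₜ om.one) = 1 := by
  ext a
  rw [fockAct_tmul, leftReg_one hop h, hop.one_mul]
  rfl

/-- Acting on d, the composite is a R_x^*(c R_y^*(d)). Expanding R_x^* of the product by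
`leftReg_cross` and merging R_{x₍₂₎}^* R_y^* by `leftReg_mul` gives the action of the product. -/
theorem fockAct_mul (hop : op.IsBialgebra) (h : IsHopfPairing om op b) (α β : Hp ⊗[k] Hm) :
    fockAct op b (heisMul om op b α β) = fockAct op b α * fockAct op b β := by
  induction α using TensorProduct.induction_on with
  | zero => simp
  | add s t hs ht => simp only [map_add, LinearMap.add_apply, add_mul, hs, ht]
  | tmul a x =>
    induction β using TensorProduct.induction_on with
    | zero => simp
    | add s t hs ht => simp only [map_add, mul_add, hs, ht]
    | tmul c y =>
      ext d
      rw [Module.End.mul_apply, fockAct_tmul, fockAct_tmul, leftReg_cross hop h, heisMul_tmul]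
      induction om.comul x using TensorProduct.induction_on with
      | zero => simp
      | add s t hs ht => simp only [map_add, LinearMap.add_apply, hs, ht]
      | tmul u v =>
        rw [TensorProduct.map_tmul, fockAct_tmul]
        simp [leftReg_mul hop h, hop.mul_assoc]

end HopfLemmas

/-! ### Classes of zero modules, isomorphic modules and finite products -/

section GrothLemmas

variable {c : ModKind} {B : Type u} [Ring B]

/-- If X = 0, then 0 → X → X → X → 0 is exact, so [X] = [X] + [X]. -/
theorem Groth.mk_subsingleton {X : ModuleCat.{u} B} (hX : IsKind c B X) (h : Subsingleton X) :
    Groth.mk X hX = 0 := by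
  have : Groth.mk X hX = Groth.mk X hX + Groth.mk X hX :=
    Groth.mk_ses hX hX hX 0 0 ⟨fun _ _ _ => Subsingleton.elim _ _,
      fun y => ⟨fun _ => ⟨0, Subsingleton.elim _ _⟩, fun _ => Subsingleton.elim _ _⟩,
      fun y => ⟨0, Subsingleton.elim _ _⟩⟩
  simpa using this

theorem isKind_punit (c : ModKind) (B : Type u) [Ring B] :
    IsKind c B (ModuleCat.of B PUnit.{u+1}) := by
  cases c
  · exact inferInstanceAs (Module.Finite B PUnit.{u+1})
  · exact ⟨inferInstanceAs (Module.Finite B PUnit.{u+1}),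
      inferInstanceAs (Module.Projective B PUnit.{u+1})⟩

/-- An isomorphism is a short exact sequence with third term zero. -/
theorem Groth.mk_congr {X Y : ModuleCat.{u} B} (hX : IsKind c B X) (hY : IsKind c B Y)
    (e : X ≃ₗ[B] Y) : Groth.mk X hX = Groth.mk Y hY := by
  have h0 := isKind_punit c B
  have hs : Subsingleton (ModuleCat.of B PUnit.{u+1}) := inferInstanceAs (Subsingleton PUnit.{u+1})
  have := Groth.mk_ses hX hY h0 (ModuleCat.ofHom e.toLinearMap) (ModuleCat.ofHom 0)
    ⟨e.injective, fun y => ⟨fun _ => e.surjective y, fun _ => Subsingleton.elim _ _⟩,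
      fun y => ⟨0, Subsingleton.elim _ _⟩⟩
  rw [this, Groth.mk_subsingleton h0 hs, add_zero]

theorem IsKind.of_split {X Y : ModuleCat.{u} B} (hX : IsKind c B X) (i : Y →ₗ[B] X)
    (p : X →ₗ[B] Y) (h : p ∘ₗ i = LinearMap.id) : IsKind c B Y := by
  have hp : Function.Surjective p := fun y => ⟨i y, LinearMap.congr_fun h y⟩
  have hf : Module.Finite B Y := by
    have := hX.finite
    exact Module.Finite.of_surjective p hp
  cases c
  · exact hf
  · have := hX.2
    exact ⟨hf, Module.Projective.of_split i p h⟩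

/-- The families supported in `s`. -/
def piSupported {σ : Type} (V : σ → ModuleCat.{u} B) (s : Finset σ) : Submodule B (∀ t, V t) where
  carrier := {f | ∀ t, t ∉ s → f t = 0}
  add_mem' {f g} hf hg t ht := by rw [Pi.add_apply, hf t ht, hg t ht, add_zero]
  zero_mem' _ _ := rfl
  smul_mem' b f hf t ht := by rw [Pi.smul_apply, hf t ht, smul_zero]

open Classical in
/-- The projection to the families supported in `s`. -/
noncomputable def piRestrict {σ : Type} (V : σ → ModuleCat.{u} B) (s : Finset σ) :
    (∀ t, V t) →ₗ[B] piSupported V s where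
  toFun f := ⟨fun t => if t ∈ s then f t else 0, fun t ht => if_neg ht⟩
  map_add' f g := by
    ext t
    by_cases h : t ∈ s <;> simp [h]
  map_smul' b f := by
    ext t
    by_cases h : t ∈ s <;> simp [h]

theorem piRestrict_comp {σ : Type} (V : σ → ModuleCat.{u} B) (s : Finset σ) :
    piRestrict V s ∘ₗ (piSupported V s).subtype = LinearMap.id := by
  ext f t
  by_cases h : t ∈ s
  · simp [piRestrict, h]
  · simp [piRestrict, h, f.2 t h]

theorem isKind_piSupported {σ : Type} (V : σ → ModuleCat.{u} B)
    (hV : IsKind c B (ModuleCat.of B (∀ t, V t))) (s : Finset σ) :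
    IsKind c B (ModuleCat.of B (piSupported V s)) :=
  hV.of_split (Y := ModuleCat.of B (piSupported V s)) (piSupported V s).subtype (piRestrict V s)
    (piRestrict_comp V s)

/-- One index is added at a time: the families supported in s, those supported in s ∪ {a}, and V_a
form a short exact sequence. All of its terms have kind c, being retracts of the full product or
factors of it. -/
theorem Groth.mk_piSupported {σ : Type} (V : σ → ModuleCat.{u} B) (h : ∀ t, IsKind c B (V t))
    (hV : IsKind c B (ModuleCat.of B (∀ t, V t))) (s : Finset σ) :
    Groth.mk (ModuleCat.of B (piSupported V s)) (isKind_piSupported V hV s) =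
      ∑ t ∈ s, Groth.mk (V t) (h t) := by
  classical
  induction s using Finset.induction_on with
  | empty =>
    rw [Finset.sum_empty]
    refine Groth.mk_subsingleton _ ⟨fun f g => Subtype.ext (funext fun t => ?_)⟩
    exact (f.2 t (by simp)).trans (g.2 t (by simp)).symm
  | insert a s ha ih =>
    rw [Finset.sum_insert ha, ← ih, add_comm]
    have hle : piSupported V s ≤ piSupported V (insert a s) := fun f hf t ht =>
      hf t fun h => ht (Finset.mem_insert_of_mem h)
    refine Groth.mk_ses _ _ _ (ModuleCat.ofHom (Submodule.inclusion hle))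
      (ModuleCat.ofHom (LinearMap.proj a ∘ₗ (piSupported V (insert a s)).subtype))
      ⟨Submodule.inclusion_injective hle, fun f => ?_, fun x => ?_⟩
    · constructor
      · intro hf
        refine ⟨⟨f.1, fun t ht => ?_⟩, rfl⟩
        by_cases hta : t = a
        · subst hta
          exact hf
        · exact f.2 t (by simp [hta, ht])
      · rintro ⟨g, rfl⟩
        exact g.2 a ha
    · refine ⟨⟨Pi.single a x, fun t ht => ?_⟩, ?_⟩
      · exact Pi.single_eq_of_ne (fun h : t = a => ht (by rw [h]; exact Finset.mem_insert_self _ _)) _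
      · exact Pi.single_eq_same (M := fun t => V t) a x

theorem Groth.mk_pi {σ : Type} (V : σ → ModuleCat.{u} B) (h : ∀ t, IsKind c B (V t))
    (hV : IsKind c B (ModuleCat.of B (∀ t, V t))) (s : Finset σ)
    (hs : ∀ t, t ∉ s → Subsingleton (V t)) :
    Groth.mk (ModuleCat.of B (∀ t, V t)) hV = ∑ t ∈ s, Groth.mk (V t) (h t) := by
  rw [← Groth.mk_piSupported V h hV s]
  refine Groth.mk_congr _ _ (LinearEquiv.ofBijective (piRestrict V s) ⟨fun f g hfg => ?_, fun f =>
    ⟨f.1, LinearMap.congr_fun (piRestrict_comp V s) f⟩⟩)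
  funext t
  by_cases ht : t ∈ s
  · have : (piRestrict V s f).1 t = (piRestrict V s g).1 t := by rw [hfg]
    simpa [piRestrict, ht] using this
  · have := hs t ht
    exact Subsingleton.elim _ _

/-- The product is a retract of the product over the finitely many nonzero factors, which is a
direct sum. -/
theorem projective_pi {σ : Type} {V : σ → Type u} [∀ t, AddCommGroup (V t)] [∀ t, Module B (V t)]
    (h : ∀ t, Module.Projective B (V t)) (hs : {t | Nontrivial (V t)}.Finite) :
    Module.Projective B (∀ t, V t) := by
  classical
  have hft : Fintype {t | Nontrivial (V t)} := hs.fintype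
  have h1 : Module.Projective B (∀ t : {t | Nontrivial (V t)}, V t.1) :=
    Module.Projective.of_equiv
      (DFinsupp.linearEquivFunOnFintype (R := B) (M := fun t : {t | Nontrivial (V t)} => V t.1))
  refine Module.Projective.of_split (LinearMap.pi fun t : {t | Nontrivial (V t)} => LinearMap.proj t.1)
    (LinearMap.pi fun t => if h : Nontrivial (V t) then
      LinearMap.proj (⟨t, h⟩ : {t | Nontrivial (V t)}) else 0) ?_
  ext f t
  by_cases ht : Nontrivial (V t)
  · simp [ht]
  · have := not_nontrivial_iff_subsingleton.1 ht
    exact Subsingleton.elim _ _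

end GrothLemmas

/-! ### Classes of graded objects -/

section ClassLemmas

variable {ι : Type} {R : ι → Type u} [∀ i, Ring (R i)] {c : ModKind}

theorem mk_eq_zero_of_notMem {X : GrMod R} (h : ∀ i, IsKind c (R i) (X.obj i)) {i : ι}
    (hi : i ∉ X.property.2.toFinset) : Groth.mk (X.obj i) (h i) = 0 :=
  Groth.mk_subsingleton _ (not_nontrivial_iff_subsingleton.1 fun hn =>
    hi (X.property.2.mem_toFinset.2 hn))

variable [DecidableEq ι]

theorem grCls_eq_sum {X : GrMod R} (h : ∀ i, IsKind c (R i) (X.obj i)) (s : Finset ι)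
    (hs : X.property.2.toFinset ⊆ s) : grCls c X h =
      ∑ i ∈ s, lof ℤ ι (fun i => Groth c (R i)) i (Groth.mk (X.obj i) (h i)) :=
  Finset.sum_subset hs fun i _ hi => by rw [mk_eq_zero_of_notMem h hi, map_zero]

theorem component_grCls {X : GrMod R} (h : ∀ i, IsKind c (R i) (X.obj i)) (i : ι) :
    DirectSum.component ℤ ι (fun i => Groth c (R i)) i (grCls c X h) =
      Groth.mk (X.obj i) (h i) := by
  rw [grCls_eq_sum h (insert i X.property.2.toFinset) (Finset.subset_insert _ _), map_sum,
    Finset.sum_eq_single i]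
  · exact DirectSum.component.lof_self _ _ _
  · intro j _ hj
    rw [DirectSum.component.of, dif_neg hj]
  · intro hn
    exact absurd (Finset.mem_insert_self _ _) hn

theorem grCls_ext {X : GrMod R} (h : ∀ i, IsKind c (R i) (X.obj i)) {x : ⨁ i, Groth c (R i)}
    (hx : ∀ i, DirectSum.component ℤ ι (fun i => Groth c (R i)) i x = Groth.mk (X.obj i) (h i)) :
    x = grCls c X h :=
  DirectSum.ext_component ℤ fun i => by rw [hx, component_grCls]

theorem grCls_congr {X Y : GrMod R} (hX : ∀ i, IsKind c (R i) (X.obj i))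
    (hY : ∀ i, IsKind c (R i) (Y.obj i)) (e : X ≅ Y) : grCls c X hX = grCls c Y hY :=
  grCls_ext hY fun i => by rw [component_grCls, Groth.mk_congr (hX i) (hY i) (gradedLinearEquiv e i)]

end ClassLemmas

/-! ### The maps on Grothendieck groups induced by ∇, Δ and ⊗ -/

namespace Tower

variable {F : Type u} [Field F] (T : Tower F) {c : ModKind}

theorem isKind_ext {M N : T.Md} (hM : ∀ i, IsKind c (T.A i) (M.obj i))
    (hN : ∀ i, IsKind c (T.A i) (N.obj i)) (p : ℕ × ℕ) :
    IsKind c (T.A₂ p) (((T.ext M).obj N).obj p) := (hM p.1).ext (hN p.2)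

theorem isKind_nabla {Z : T.Md₂} (hZ : ∀ i, IsKind c (T.A₂ i) (Z.obj i)) (k : ℕ) :
    IsKind c (T.A k) ((T.nabla.obj Z).obj k) := by
  have hf := (T.nabla.obj Z).property.1 k
  cases c
  · exact hf
  · refine ⟨hf, projective_pi (σ := {i // T.mult.g i = k})
      (V := fun i => IndMod (T.mult.hom i.2) (Z.obj i.1))
      (fun i => projective_indF _ _ (hZ i.1).2) ?_⟩
    have : Finite {i // T.mult.g i = k} := T.mult.fib k
    exact Set.toFinite _

theorem isKind_delta {X : T.Md} (hX : ∀ i, IsKind c (T.A i) (X.obj i)) (p : ℕ × ℕ) :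
    IsKind c (T.A₂ p) ((T.delta.obj X).obj p) :=
  (hX (p.1 + p.2)).resF (T.left_projective rfl)

theorem grothExt_tmul_lof {i j : ℕ} (x : Groth c (T.A i)) (y : Groth c (T.A j)) :
    T.grothExt c (lof ℤ ℕ (fun n => Groth c (T.A n)) i x ⊗ₜ
      lof ℤ ℕ (fun n => Groth c (T.A n)) j y) =
      lof ℤ (ℕ × ℕ) (fun p => Groth c (T.A₂ p)) (i, j) (Groth.ext F c (T.A i) (T.A j) x y) := by
  refine Eq.trans (congrArg (DirectSum.lmap (fun p : ℕ × ℕ => TensorProduct.lift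
    (Groth.ext F c (T.A p.1) (T.A p.2)))) (TensorProduct.directSum_lof_tmul_lof (R := ℤ) (S := ℤ) (M₁ := fun n => Groth c (T.A n))
    (M₂ := fun n => Groth c (T.A n)) i x j y)) ?_
  exact DirectSum.lmap_lof _ _ _

theorem grothExt_grCls {M N : T.Md} (hM : ∀ i, IsKind c (T.A i) (M.obj i))
    (hN : ∀ i, IsKind c (T.A i) (N.obj i)) :
    T.grothExt c (grCls c M hM ⊗ₜ grCls c N hN) =
      grCls c ((T.ext M).obj N) (T.isKind_ext hM hN) := by
  rw [grCls_eq_sum (T.isKind_ext hM hN) (M.property.2.toFinset ×ˢ N.property.2.toFinset)]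
  · rw [grCls, grCls, TensorProduct.sum_tmul, map_sum, Finset.sum_product]
    refine Finset.sum_congr rfl fun i _ => ?_
    rw [TensorProduct.tmul_sum, map_sum]
    refine Finset.sum_congr rfl fun j _ => ?_
    rw [grothExt_tmul_lof]
    rfl
  · intro p hp
    rw [Set.Finite.mem_toFinset] at hp
    by_contra hne
    rw [Finset.mem_product, Set.Finite.mem_toFinset, Set.Finite.mem_toFinset, not_and_or] at hne
    refine not_nontrivial_iff_subsingleton.2 (subsingleton_ext (F := F) (M.obj p.1) (N.obj p.2) ?_) hp
    exact hne.imp not_nontrivial_iff_subsingleton.1 not_nontrivial_iff_subsingleton.1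

/-- In degree k both sides are the sum of the classes of Ind(Z_p) over the pairs p with p₁ + p₂ = k.
-/
theorem grothNabla_grCls {Z : T.Md₂} (hZ : ∀ i, IsKind c (T.A₂ i) (Z.obj i)) :
    T.grothNabla c (grCls c Z hZ) = grCls c (T.nabla.obj Z) (T.isKind_nabla hZ) := by
  classical
  refine grCls_ext _ fun k => ?_
  -- Extension by zero off the fibre over k makes the sum over the support of Z comparable with the
  -- sum over the fibre.
  let f : ℕ × ℕ → Groth c (T.A k) := fun p => if h : p.1 + p.2 = k then
    Groth.mk ((indF (T.ρ h)).obj (Z.obj p)) ((hZ p).indF _) else 0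
  have h1 : ∀ p, DirectSum.component ℤ ℕ (fun n => Groth c (T.A n)) k (T.grothNabla c
      (lof ℤ (ℕ × ℕ) (fun p => Groth c (T.A₂ p)) p (Groth.mk (Z.obj p) (hZ p)))) = f p := by
    intro p
    rw [grothNabla, DirectSum.toModule_lof, LinearMap.comp_apply]
    by_cases h : p.1 + p.2 = k
    · subst h
      rw [DirectSum.component.lof_self]
      simp only [f, dite_true]
      rfl
    · rw [DirectSum.component.of, dif_neg h]
      simp only [f, dif_neg h]
  have h2 : ∀ p, p ∉ Z.property.2.toFinset → f p = 0 := fun p hp => by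
    simp only [f]
    split_ifs with h
    · refine Groth.mk_subsingleton _ (subsingleton_ind _ _ ?_)
      exact not_nontrivial_iff_subsingleton.1 fun hn => hp (Z.property.2.mem_toFinset.2 hn)
    · rfl
  have hfib : Fintype {i // T.mult.g i = k} := @Fintype.ofFinite _ (T.mult.fib k)
  have h3 := Groth.mk_pi (c := c) (fun i : {i // T.mult.g i = k} =>
    (indF (T.mult.hom i.2)).obj (Z.obj i.1)) (fun i => (hZ i.1).indF _) (T.isKind_nabla hZ k)
    Finset.univ (fun t ht => absurd (Finset.mem_univ t) ht)
  refine Eq.trans ?_ h3.symm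
  rw [grCls, map_sum, map_sum, Finset.sum_congr rfl fun p _ => h1 p]
  have h4 : ∀ i : {i // T.mult.g i = k}, Groth.mk ((indF (T.mult.hom i.2)).obj (Z.obj i.1))
      ((hZ i.1).indF _) = f i.1 := fun i => by
    simp only [f]
    rw [dif_pos (show i.1.1 + i.1.2 = k from i.2)]
    rfl
  rw [Finset.sum_congr rfl fun i _ => h4 i]
  refine Eq.trans ?_
    (Finset.sum_subtype (p := fun x => T.mult.g x = k) (F := hfib) (T.mult.fib k).toFinset
      (fun x => (T.mult.fib k).mem_toFinset) f)
  -- Both sums are enlarged to the union of the support and the fibre: f vanishes off the support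
  -- since Z_p = 0, and off the fibre by definition.
  rw [Finset.sum_subset (Finset.subset_union_left (s₂ := (T.mult.fib k).toFinset))
    fun p _ hp => h2 p hp]
  refine (Finset.sum_subset Finset.subset_union_right fun p _ hp => dif_neg fun h => hp ?_).symm
  exact (T.mult.fib k).mem_toFinset.2 h

theorem grothDelta_grCls {X : T.Md} (hX : ∀ i, IsKind c (T.A i) (X.obj i)) :
    T.grothDelta c (grCls c X hX) = grCls c (T.delta.obj X) (T.isKind_delta hX) := by
  classical
  refine grCls_ext _ fun p => ?_
  have h1 : ∀ n, DirectSum.component ℤ (ℕ × ℕ) (fun p => Groth c (T.A₂ p)) p (T.grothDelta c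
      (lof ℤ ℕ (fun n => Groth c (T.A n)) n (Groth.mk (X.obj n) (hX n)))) =
      if h : p.1 + p.2 = n then Groth.mk ((resF (T.ρ h)).obj (X.obj n))
        ((hX n).resF (T.left_projective h)) else 0 := by
    intro n
    rw [grothDelta, DirectSum.toModule_lof, LinearMap.sum_apply, map_sum]
    split_ifs with h
    · rw [Finset.sum_eq_single ⟨p, Finset.HasAntidiagonal.mem_antidiagonal.2 h⟩]
      · rw [LinearMap.comp_apply, DirectSum.component.lof_self]
        rfl
      · intro q _ hq
        rw [LinearMap.comp_apply, DirectSum.component.of, dif_neg fun h => hq (Subtype.ext h)]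
      · intro hn
        exact absurd (Finset.mem_univ _) hn
    · refine Finset.sum_eq_zero fun q _ => ?_
      rw [LinearMap.comp_apply, DirectSum.component.of, dif_neg]
      rintro rfl
      exact h (Finset.HasAntidiagonal.mem_antidiagonal.1 q.2)
  -- The degree p₁ + p₂ is inserted because X may vanish there; it is the only one contributing to
  -- the component p.
  rw [grCls_eq_sum hX (insert (p.1 + p.2) X.property.2.toFinset) (Finset.subset_insert _ _), map_sum,
    map_sum, Finset.sum_congr rfl fun n _ => h1 n, Finset.sum_eq_single (p.1 + p.2)]
  · rw [dif_pos rfl]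
    rfl
  · intro n _ hn
    exact dif_neg hn.symm
  · intro hn
    exact absurd (Finset.mem_insert_self _ _) hn

theorem mul_grCls {M N : T.Md} (hM : ∀ i, IsKind c (T.A i) (M.obj i))
    (hN : ∀ i, IsKind c (T.A i) (N.obj i)) :
    (T.ops c).mul (grCls c M hM) (grCls c N hN) =
      grCls c ((T.Ind M).obj N) (T.isKind_nabla (T.isKind_ext hM hN)) := by
  change T.grothNabla c (T.grothExt c (grCls c M hM ⊗ₜ grCls c N hN)) = _
  rw [grothExt_grCls, grothNabla_grCls]
  rfl

end Tower

/-! ### Hom(P, M ⊗ N) as a power of M -/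

section HomTensor

variable {F : Type u} [Field F] {R S : Type u} [Ring R] [Algebra F R] [Ring S] [Algebra F S]

theorem one_tmul_smul_extTmul {M : ModuleCat.{u} R} {N : ModuleCat.{u} S} (s : S) (m : M) (n : N) :
    ((1 : R) ⊗ₜ[F] s) • extTmul F m n = extTmul F m (s • n) :=
  (extTensor_smul_tmul (1 : R) s m n).trans
    (congrArg (fun m' => extTmul F m' (s • n)) (one_smul R m))

theorem tmul_one_smul_extTmul {M : ModuleCat.{u} R} {N : ModuleCat.{u} S} (r : R) (m : M) (n : N) :
    (r ⊗ₜ[F] (1 : S)) • extTmul F m n = extTmul F (r • m) n :=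
  (extTensor_smul_tmul r (1 : S) m n).trans
    (congrArg (fun n' => extTmul F (r • m) n') (one_smul S n))

/-- The homomorphism `p ↦ m ⊗ f(p)`. -/
noncomputable def tmulHom {P N : ModuleCat.{u} S} (M : ModuleCat.{u} R) (m : M) (f : P →ₗ[S] N) :
    PHom (F := F) P ((extF (F := F) M).obj N) where
  toFun p := extTmul F m (f p)
  map_add' p q := by
    rw [map_add]
    exact TensorProduct.tmul_add m (f p) (f q)
  map_smul' s p := by
    rw [map_smul]
    exact (one_tmul_smul_extTmul s m (f p)).symm

/-- The map `(m_i) ↦ ∑ m_i ⊗ f_i` to `Hom_S(P, M ⊗ N)`. -/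
noncomputable def sumTmulHom {ι : Type} [Fintype ι] {P N : ModuleCat.{u} S} (M : ModuleCat.{u} R)
    (f : ι → (P ⟶ N)) : (ι → M) →ₗ[R] PHom (F := F) P ((extF (F := F) M).obj N) where
  toFun m := ∑ i, tmulHom M (m i) (f i).hom
  map_add' m m' := by
    rw [← Finset.sum_add_distrib]
    refine Finset.sum_congr rfl fun i _ => LinearMap.ext fun p => ?_
    exact TensorProduct.add_tmul (m i) (m' i) ((f i).hom p)
  map_smul' r m := by
    rw [RingHom.id_apply, Finset.smul_sum]
    refine Finset.sum_congr rfl fun i _ => LinearMap.ext fun p => ?_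
    exact (tmul_one_smul_extTmul r (m i) ((f i).hom p)).symm

theorem sumTmulHom_apply {ι : Type} [Fintype ι] {P N : ModuleCat.{u} S} (M : ModuleCat.{u} R)
    (f : ι → (P ⟶ N)) (m : ι → M) (p : P) :
    sumTmulHom (F := F) M f m p = ∑ i, extTmul F (m i) ((f i).hom p) :=
  LinearMap.sum_apply _ _ _

theorem tmulHom_sum {ι : Type} [Fintype ι] {P N : ModuleCat.{u} S} (M : ModuleCat.{u} R)
    (f : ι → (P ⟶ N)) (m : M) (c : ι → F) :
    tmulHom (F := F) M m (∑ i, c i • f i : P ⟶ N).hom = sumTmulHom M f fun i => c i • m := by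
  refine LinearMap.ext fun p => ?_
  rw [sumTmulHom_apply]
  have h : (∑ i, c i • f i : P ⟶ N).hom p = ∑ i, c i • (f i).hom p := by
    rw [ModuleCat.hom_sum, LinearMap.sum_apply]
    rfl
  refine Eq.trans (congrArg (extTmul F m) h) ((TensorProduct.tmul_sum m _ _).trans ?_)
  exact Finset.sum_congr rfl fun i _ => (TensorProduct.smul_tmul (c i) m ((f i).hom p)).symm

/-- This is M ⊗ Hom(P, N) ≅ Hom(P, M ⊗ N) for P finitely generated projective, with a basis of
Hom(P, N) chosen so that the left side becomes a power of M. -/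
theorem sumTmulHom_bijective {ι : Type} [Fintype ι] {P N : ModuleCat.{u} S} (M : ModuleCat.{u} R)
    (hPf : Module.Finite S P) (hP : Module.Projective S P) (b : Module.Basis ι F (P ⟶ N)) :
    Function.Bijective (sumTmulHom (F := F) M b) := by
  constructor
  · rw [injective_iff_map_eq_zero]
    intro m hm
    funext i
    -- Applying a functional of M to the first tensor factor turns the relation into a linear
    -- relation among the basis elements.
    refine (Module.forall_dual_apply_eq_zero_iff F (m i)).1 fun l => ?_
    have h0 : ∑ i, l (m i) • b i = 0 := by
      refine ModuleCat.hom_ext (LinearMap.ext fun p => ?_)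
      have h1 : ∑ i, (m i ⊗ₜ[F] (b i).hom p : M ⊗[F] N) = 0 :=
        (sumTmulHom_apply M b m p).symm.trans (DFunLike.congr_fun hm p)
      have h2 := congrArg (TensorProduct.lid F N ∘ l.rTensor N) h1
      simp only [Function.comp_apply, map_sum, LinearMap.rTensor_tmul, TensorProduct.lid_tmul,
        map_zero] at h2
      rw [ModuleCat.hom_sum, LinearMap.sum_apply]
      exact h2
    exact Fintype.linearIndependent_iff.1 b.linearIndependent (fun i => l (m i)) h0 i
  · intro g
    obtain ⟨n, e, d, hd⟩ := exists_dual_basis P hPf hP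
    -- By a dual basis, g is a sum of maps p ↦ f(p) z. For z = m ⊗ n such a map is m ⊗ (p ↦ f(p) n),
    -- and its preimage consists of the coordinates of p ↦ f(p) n multiplied by m.
    have key : ∀ (f : P →ₗ[S] S) (z : ExtTensor F M N), ∃ v, ∀ p,
        sumTmulHom (F := F) M b v p = ((1 : R) ⊗ₜ[F] f p) • z := by
      intro f
      refine extTensor_induction ⟨0, fun p => ?_⟩ (fun m n => ?_) ?_
      · rw [map_zero, smul_zero]
        rfl
      · let g' : P ⟶ N := ModuleCat.ofHom (f.smulRight n)
        refine ⟨fun i => b.repr g' i • m, fun p => ?_⟩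
        rw [← tmulHom_sum, b.sum_repr]
        exact (one_tmul_smul_extTmul (f p) m n).symm
      · rintro x y ⟨v, hv⟩ ⟨w, hw⟩
        refine ⟨v + w, fun p => ?_⟩
        rw [map_add, smul_add, ← hv, ← hw]
        rfl
    choose v hv using fun t => key (d t) (g (e t))
    refine ⟨∑ t, v t, LinearMap.ext fun p => ?_⟩
    rw [map_sum]
    refine (LinearMap.sum_apply _ _ _).trans ?_
    refine (Finset.sum_congr rfl fun t _ => hv t p).trans ?_
    conv_rhs => rw [← hd p, map_sum]
    exact Finset.sum_congr rfl fun t _ => (LinearMap.map_smulₛₗ g (d t p) (e t)).symm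

variable [Module.Finite F S]

theorem Groth.mk_homF_ext {P N : ModuleCat.{u} S} {M : ModuleCat.{u} R} (hP : IsKind .proj S P)
    (hN : IsKind .fg S N) (hM : IsKind .fg R M)
    (h : IsKind .fg R ((homF P).obj ((extF (F := F) M).obj N))) :
    Groth.mk _ h = (Module.finrank F (P ⟶ N) : ℤ) • Groth.mk M hM := by
  have := finite_hom (F := F) hP.1 hN
  let b := Module.finBasis F (P ⟶ N)
  have hM' : Module.Finite R M := hM
  have hpi : IsKind .fg R (ModuleCat.of R (Fin (Module.finrank F (P ⟶ N)) → M)) :=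
    inferInstanceAs (Module.Finite R (Fin _ → M))
  refine (Groth.mk_congr hpi h (LinearEquiv.ofBijective _
    (sumTmulHom_bijective (F := F) M hP.1 hP.2 b))).symm.trans ?_
  refine (Groth.mk_pi (fun _ => M) (fun _ => hM) hpi Finset.univ
    fun t ht => absurd (Finset.mem_univ t) ht).trans ?_
  rw [Finset.sum_const, Finset.card_univ, Fintype.card_fin, natCast_zsmul]

end HomTensor

/-! ### The map on classes induced by Hom(P, -) -/

section HomClass

variable {F : Type u} [Field F]

theorem homF_isSES {R S : Type u} [Ring R] [Algebra F R] [Ring S] [Algebra F S]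
    {P : ModuleCat.{u} S} (hP : Module.Projective S P) {X Y Z : ModuleCat.{u} (R ⊗[F] S)}
    {f : X ⟶ Y} {g : Y ⟶ Z} (h : IsSES f g) :
    IsSES ((homF (F := F) (R := R) P).map f) ((homF P).map g) := by
  refine ⟨fun a b hab => LinearMap.ext fun p => h.1 (DFunLike.congr_fun (F := PHom P Y) hab p), fun a => ⟨?_, ?_⟩,
    homF_surjective P hP g h.2.2⟩
  · intro ha
    have hmem : ∀ p, ∃ x, f.hom x = (show PHom P Y from a) p := fun p =>
      (h.2.1 _).1 (DFunLike.congr_fun (F := PHom P Z) ha p)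
    choose r hr using hmem
    refine ⟨({ toFun := r
               map_add' := fun p p' => h.1 (by rw [map_add, hr, hr, hr, map_add])
               map_smul' := fun s p => h.1 (by
                rw [map_smul, hr, hr, LinearMap.map_smulₛₗ]) } : PHom P X), ?_⟩
    exact LinearMap.ext fun p => hr p
  · rintro ⟨b, rfl⟩
    exact LinearMap.ext fun p => h.2.1.apply_apply_eq_zero _

variable {ι κ : Type} [DecidableEq ι] [DecidableEq κ]
variable {R : ι → Type u} [∀ i, Ring (R i)] [∀ i, Algebra F (R i)] [∀ i, Module.Finite F (R i)]
variable {S : κ → Type u} [∀ i, Ring (S i)] [∀ i, Algebra F (S i)] [∀ i, Module.Finite F (S i)]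

/-- The map on Grothendieck groups induced by `Hom(P, -)`, for an object `P` with projective
components. -/
noncomputable def homClass (P : GrMod S) (hP : IsProj S P) :
    (⨁ p, G₀ (Tens F R S p)) →ₗ[ℤ] ⨁ i, G₀ (R i) :=
  DirectSum.toModule ℤ (ι × κ) (⨁ i, G₀ (R i)) fun p =>
    lof ℤ ι (fun i => G₀ (R i)) p.1 ∘ₗ
      Groth.map (c := .fg) (homF (F := F) (R := R p.1) (P.obj p.2))
        (fun Y hY => finite_homF _ Y (P.property.1 p.2) hY) (fun _ _ h => homF_isSES (hP p.2) h)

theorem homClass_lof_mk (P : GrMod S) (hP : IsProj S P) (p : ι × κ)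
    (Y : ModuleCat.{u} (Tens F R S p)) (hY) :
    homClass P hP (lof ℤ (ι × κ) (fun p => G₀ (Tens F R S p)) p (Groth.mk Y hY)) =
      lof ℤ ι (fun i => G₀ (R i)) p.1 (Groth.mk ((homF (F := F) (R := R p.1) (P.obj p.2)).obj Y)
        (finite_homF _ Y (P.property.1 p.2) hY)) := by
  rw [homClass, DirectSum.toModule_lof]
  rfl

theorem homClass_clsG (P : GrMod S) (hP : IsProj S P) (Y : GrMod (Tens F R S)) :
    homClass P hP (clsG Y) = clsG ((grHom P).obj Y) := by
  classical
  refine grCls_ext _ fun i => ?_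
  -- The support of Y is enclosed in a rectangle whose first side contains i, so that the double sum
  -- collapses to row i.
  let s := Y.property.2.toFinset.image Prod.snd
  let r := insert i (Y.property.2.toFinset.image Prod.fst)
  have hsub : Y.property.2.toFinset ⊆ r ×ˢ s := fun p hp => Finset.mem_product.2
    ⟨Finset.mem_insert_of_mem (Finset.mem_image_of_mem _ hp), Finset.mem_image_of_mem _ hp⟩
  have h3 := Groth.mk_pi (c := .fg) (fun j : κ => (homF (F := F) (R := R i) (P.obj j)).obj
      (Y.obj (i, j))) (fun j => finite_homF _ _ (P.property.1 j) (Y.property.1 (i, j)))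
    (((grHom P).obj Y).property.1 i) s fun j hj => by
      have hY : Subsingleton (Y.obj (i, j)) := not_nontrivial_iff_subsingleton.1 fun hn =>
        hj (Finset.mem_image.2 ⟨(i, j), Y.property.2.mem_toFinset.2 hn, rfl⟩)
      refine subsingleton_of_forall_eq 0 fun f => ?_
      exact LinearMap.ext fun p => Subsingleton.elim (α := Y.obj (i, j)) _ _
  refine Eq.trans ?_ h3.symm
  have h1 := grCls_eq_sum (c := .fg) Y.property.1 (r ×ˢ s) hsub
  rw [show clsG Y = _ from h1, map_sum, map_sum, Finset.sum_product, Finset.sum_eq_single i]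
  · refine Finset.sum_congr rfl fun j _ => ?_
    exact (congrArg _ (homClass_lof_mk P hP (i, j) (Y.obj (i, j)) (Y.property.1 (i, j)))).trans
      (DirectSum.component.lof_self ..)
  · intro k _ hk
    refine Finset.sum_eq_zero fun j _ => ?_
    refine (congrArg _ (homClass_lof_mk P hP (k, j) (Y.obj (k, j)) (Y.property.1 (k, j)))).trans ?_
    exact (DirectSum.component.of ..).trans (dif_neg hk)
  · intro hn
    exact absurd (Finset.mem_insert_self _ _) hn

end HomClass

/-! ### Homomorphisms determined on classes of modules -/

section GrExt

variable {ι : Type} [DecidableEq ι] {R : ι → Type u} [∀ i, Ring (R i)] {c : ModKind}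

theorem groth_hom_ext {L : Type*} [AddCommGroup L] {f g : (⨁ i, Groth c (R i)) →ₗ[ℤ] L}
    (h : ∀ i X hX, f (lof ℤ ι (fun i => Groth c (R i)) i (Groth.mk X hX)) =
      g (lof ℤ ι (fun i => Groth c (R i)) i (Groth.mk X hX))) : f = g := by
  refine DirectSum.linearMap_ext ℤ fun i => LinearMap.toAddMonoidHom_injective ?_
  exact Groth.hom_ext fun X hX => h i X hX

theorem groth_tensor_hom_ext {κ : Type} [DecidableEq κ] {S : κ → Type u} [∀ i, Ring (S i)]
    {d : ModKind} {L : Type*} [AddCommGroup L]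
    {f g : (⨁ i, Groth c (R i)) ⊗[ℤ] (⨁ i, Groth d (S i)) →ₗ[ℤ] L}
    (h : ∀ i X hX j Y hY, f (lof ℤ ι (fun i => Groth c (R i)) i (Groth.mk X hX) ⊗ₜ
        lof ℤ κ (fun i => Groth d (S i)) j (Groth.mk Y hY)) =
      g (lof ℤ ι (fun i => Groth c (R i)) i (Groth.mk X hX) ⊗ₜ
        lof ℤ κ (fun i => Groth d (S i)) j (Groth.mk Y hY))) : f = g := by
  refine TensorProduct.ext (groth_hom_ext fun i X hX => groth_hom_ext fun j Y hY => ?_)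
  exact h i X hX j Y hY

end GrExt

/-! ### The pairing on direct sums of Grothendieck groups -/

section GrPairing

variable {F : Type u} [Field F] {ι : Type} [DecidableEq ι]
variable {R : ι → Type u} [∀ i, Ring (R i)] [∀ i, Algebra F (R i)] [∀ i, Module.Finite F (R i)]

/-- The pairing of `⨁ i, K₀(R_i)` and `⨁ i, G₀(R_i)` for which distinct indices are orthogonal. -/
noncomputable def grPairing (F : Type u) [Field F] (R : ι → Type u) [∀ i, Ring (R i)]
    [∀ i, Algebra F (R i)] [∀ i, Module.Finite F (R i)] :
    (⨁ i, K₀ (R i)) →ₗ[ℤ] (⨁ i, G₀ (R i)) →ₗ[ℤ] ℤ :=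
  DirectSum.toModule ℤ ι ((⨁ i, G₀ (R i)) →ₗ[ℤ] ℤ) fun i =>
    (pairing F (R i)).compl₂ (DirectSum.component ℤ ι (fun i => G₀ (R i)) i)

theorem grPairing_lof (i : ι) (x : K₀ (R i)) (y : ⨁ i, G₀ (R i)) :
    grPairing F R (lof ℤ ι (fun i => K₀ (R i)) i x) y =
      pairing F (R i) x (DirectSum.component ℤ ι (fun i => G₀ (R i)) i y) := by
  rw [grPairing, DirectSum.toModule_lof]
  rfl

theorem grPairing_lof_lof (i : ι) (x : K₀ (R i)) (y : G₀ (R i)) :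
    grPairing F R (lof ℤ ι (fun i => K₀ (R i)) i x) (lof ℤ ι (fun i => G₀ (R i)) i y) =
      pairing F (R i) x y := by
  rw [grPairing_lof, DirectSum.component.lof_self]

theorem grPairing_lof_lof_ne {i j : ι} (h : i ≠ j) (x : K₀ (R i)) (y : G₀ (R j)) :
    grPairing F R (lof ℤ ι (fun i => K₀ (R i)) i x) (lof ℤ ι (fun i => G₀ (R i)) j y) = 0 := by
  rw [grPairing_lof, DirectSum.component.of, dif_neg h.symm, map_zero]

theorem grPairing_clsK {Q : GrMod R} (hQ : IsProj R Q) (y : ⨁ i, G₀ (R i)) (s : Finset ι)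
    (hs : Q.property.2.toFinset ⊆ s) : grPairing F R (clsK Q hQ) y =
      ∑ i ∈ s, pairing F (R i) (Groth.mk (Q.obj i) ⟨Q.property.1 i, hQ i⟩)
        (DirectSum.component ℤ ι (fun i => G₀ (R i)) i y) := by
  have h1 := grCls_eq_sum (c := .proj) (fun i => ⟨Q.property.1 i, hQ i⟩) s hs
  rw [show clsK Q hQ = _ from h1, map_sum, LinearMap.sum_apply]
  exact Finset.sum_congr rfl fun i _ => grPairing_lof _ _ _

theorem grPairing_clsK_lof {Q : GrMod R} (hQ : IsProj R Q) (j : ι) (y : G₀ (R j)) :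
    grPairing F R (clsK Q hQ) (lof ℤ ι (fun i => G₀ (R i)) j y) =
      pairing F (R j) (Groth.mk (Q.obj j) ⟨Q.property.1 j, hQ j⟩) y := by
  rw [grPairing_clsK hQ _ (insert j Q.property.2.toFinset) (Finset.subset_insert _ _),
    Finset.sum_eq_single j]
  · rw [DirectSum.component.lof_self]
  · intro n _ hn
    rw [DirectSum.component.of, dif_neg (Ne.symm hn), map_zero]
  · intro hn
    exact absurd (Finset.mem_insert_self _ _) hn

theorem finrank_pi_of_support {V : ι → Type*} [∀ i, AddCommGroup (V i)] [∀ i, Module F (V i)]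
    [∀ i, Module.Finite F (V i)] (s : Finset ι) (hs : ∀ i, i ∉ s → Subsingleton (V i)) :
    Module.finrank F (∀ i, V i) = ∑ i ∈ s, Module.finrank F (V i) := by
  let e : (∀ i, V i) →ₗ[F] ∀ i : s, V i.1 := LinearMap.pi fun i => LinearMap.proj i.1
  have he : Function.Bijective e := by
    constructor
    · intro f g hfg
      funext i
      by_cases hi : i ∈ s
      · exact congrFun hfg ⟨i, hi⟩
      · have := hs i hi
        exact Subsingleton.elim _ _
    · intro f
      refine ⟨fun i => if h : i ∈ s then f ⟨i, h⟩ else 0, funext fun i => ?_⟩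
      exact dif_pos i.2
  rw [(LinearEquiv.ofBijective e he).finrank_eq, Module.finrank_pi_fintype]
  exact Finset.sum_coe_sort s fun i => Module.finrank F (V i)

/-- With the pairing read as the dimension of a full graded Hom space, an adjunction translates
directly into an equality of pairings. -/
theorem grPairing_clsK_clsG {Q : GrMod R} (hQ : IsProj R Q) (Z : GrMod R) :
    grPairing F R (clsK Q hQ) (clsG Z) = (Module.finrank F (∀ i, Q.obj i ⟶ Z.obj i) : ℤ) := by
  have hfin : ∀ i, Module.Finite F (Q.obj i ⟶ Z.obj i) := fun i =>
    finite_hom (F := F) (Q.property.1 i) (Z.property.1 i)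
  rw [grPairing_clsK hQ _ _ subset_rfl, finrank_pi_of_support Q.property.2.toFinset, Nat.cast_sum]
  · refine Finset.sum_congr rfl fun i _ => ?_
    exact (congrArg _ (component_grCls (c := .fg) Z.property.1 i)).trans rfl
  · intro i hi
    have : Subsingleton (Q.obj i) := not_nontrivial_iff_subsingleton.1 fun hn =>
      hi (Q.property.2.mem_toFinset.2 hn)
    refine subsingleton_of_forall_eq 0 fun f => ModuleCat.hom_ext (LinearMap.ext fun q => ?_)
    rw [Subsingleton.elim q 0, map_zero, map_zero]

end GrPairing

/-! ### The class of Res_P(X) -/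

namespace Tower

variable {F : Type u} [Field F] (T : Tower F) {c : ModKind}

/-- Otherwise `comul` takes its default value 0. The counit axiom then forces the unit to be 0,
against ε(1) = 1. -/
theorem grothExt_bijective (h : (T.ops c).IsBialgebra) : Function.Bijective (T.grothExt c) := by
  by_contra hn
  have h0 : (T.ops c).comul = 0 := dif_neg hn
  have h1 := congrArg (TensorProduct.lid ℤ (T.Gr c)) (h.rTensor_counit (T.ops c).one)
  rw [h0, LinearMap.zero_apply, map_zero, map_zero, TensorProduct.lid_tmul, one_smul] at h1
  have h2 := h.counit_one
  rw [← h1, map_zero] at h2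
  exact zero_ne_one h2

theorem grothExt_comul (h : (T.ops c).IsBialgebra) (x : T.Gr c) :
    T.grothExt c ((T.ops c).comul x) = T.grothDelta c x := by
  have hb := T.grothExt_bijective h
  have h0 : (T.ops c).comul =
      (LinearEquiv.ofBijective (T.grothExt c) hb).symm.toLinearMap ∘ₗ T.grothDelta c := dif_pos hb
  rw [h0]
  exact (LinearEquiv.ofBijective (T.grothExt c) hb).apply_symm_apply _

theorem pair_lof {P : T.Md} (hP : IsProj T.A P) (j : ℕ) (y : G₀ (T.A j)) :
    T.pair (clsK P hP) (lof ℤ ℕ (fun n => G₀ (T.A n)) j y) =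
      pairing F (T.A j) (Groth.mk (P.obj j) ⟨P.property.1 j, hP j⟩) y := grPairing_clsK_lof hP j y

/-- Since Hom(P, M ⊗ N) has class dim Hom(P, N) · [M], the functor Hom(P, -) contracts the second
tensor factor with [P]. -/
theorem homClass_grothExt {P : T.Md} (hP : IsProj T.A P) :
    homClass P hP ∘ₗ T.grothExt .fg = (TensorProduct.rid ℤ T.G).toLinearMap ∘ₗ
      (T.pair (clsK P hP)).lTensor T.G := by
  refine groth_tensor_hom_ext fun i M hM j N hN => ?_
  have h1 := T.grothExt_tmul_lof (Groth.mk M hM) (Groth.mk N hN)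
  refine (congrArg (homClass P hP) h1).trans ?_
  refine (homClass_lof_mk P hP (i, j) ((extF (F := F) M).obj N) (hM.ext hN)).trans ?_
  have h2 : (TensorProduct.rid ℤ T.G) ((T.pair (clsK P hP)).lTensor T.G
      (lof ℤ ℕ (fun n => G₀ (T.A n)) i (Groth.mk M hM) ⊗ₜ
        lof ℤ ℕ (fun n => G₀ (T.A n)) j (Groth.mk N hN))) =
      (Module.finrank F (P.obj j ⟶ N) : ℤ) • lof ℤ ℕ (fun n => G₀ (T.A n)) i (Groth.mk M hM) := by
    rw [LinearMap.lTensor_tmul, TensorProduct.rid_tmul, pair_lof]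
    rfl
  refine Eq.trans ?_ h2.symm
  rw [← map_zsmul]
  exact congrArg _ (Groth.mk_homF_ext ⟨P.property.1 j, hP j⟩ hN hM _)

/-- Res_P is Δ followed by Hom(P, -); on classes this is the coproduct followed by contraction with
[P], the defining formula of R_x^*. -/
theorem clsG_res (h : (T.ops .fg).IsBialgebra) {P : T.Md} (hP : IsProj T.A P) (X : T.Md) :
    clsG ((T.Res P).obj X) = T.regAct (clsK P hP) (clsG X) := by
  refine (homClass_clsG P hP (T.delta.obj X)).symm.trans ?_
  have h1 : T.grothExt .fg ((T.ops .fg).comul (clsG X)) = clsG (T.delta.obj X) :=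
    (T.grothExt_comul h _).trans (T.grothDelta_grCls (c := .fg) (X := X) X.property.1)
  rw [← h1]
  exact LinearMap.congr_fun (T.homClass_grothExt hP) _

end Tower

/-! ### A projective module is determined by the dimensions of its Hom spaces -/

section ProjectiveIso

variable {F : Type u} [Field F] {B : Type u} [Ring B] [Algebra F B] [Module.Finite F B]

/-- Take f : P → T with minimal kernel, I its image and T = I ⊕ C. Every map P → C factors through
I, so dim Hom(P', C) ≤ dim Hom(P, C) ≤ dim Hom(I, C). Composition with P' → T → I embeds Hom(I, C)
in Hom(P', C), so it is bijective. The map P' → T → C thus factors through I, which forces C = 0. -/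
theorem exists_surjective_of_finrank_hom_le {P P' T : ModuleCat.{u} B} (hP : Module.Finite B P)
    (hT : Module.Finite B T) [IsSemisimpleModule B T] (q : P' →ₗ[B] T)
    (hP' : Module.Finite B P') (hq : Function.Surjective q)
    (h : ∀ M : ModuleCat.{u} B, Module.Finite B M →
      Module.finrank F (P' ⟶ M) ≤ Module.finrank F (P ⟶ M)) :
    ∃ f : P →ₗ[B] T, Function.Surjective f := by
  have hB : IsArtinianRing B := IsArtinianRing.of_finite F B
  obtain ⟨_, ⟨f, rfl⟩, hmin⟩ := IsWellFounded.wf.has_min (r := ((· < ·) : Submodule B P → _ → Prop))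
    (Set.range fun f : P →ₗ[B] T => LinearMap.ker f) ⟨_, 0, rfl⟩
  obtain ⟨C, hC⟩ := exists_isCompl (LinearMap.range f)
  -- If g did not vanish on the kernel of f, then f + g would have a strictly smaller kernel, since
  -- I and C meet in 0.
  have hker : ∀ g : P →ₗ[B] C, LinearMap.ker f ≤ LinearMap.ker g := by
    intro g
    have h0 : ∀ p, (f + C.subtype ∘ₗ g) p = 0 → f p = 0 ∧ g p = 0 := by
      intro p hp
      have h1 : f p = -(g p : T) := eq_neg_of_add_eq_zero_left hp
      have h2 : f p = 0 := by
        refine Submodule.disjoint_def.1 hC.disjoint _ ⟨p, rfl⟩ ?_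
        rw [h1]
        exact C.neg_mem (g p).2
      refine ⟨h2, Subtype.ext ?_⟩
      rw [h2] at h1
      exact neg_eq_zero.1 h1.symm
    have h3 : LinearMap.ker (f + C.subtype ∘ₗ g) ≤ LinearMap.ker f := fun p hp => (h0 p hp).1
    have h4 := (h3.lt_or_eq).resolve_left (hmin _ ⟨_, rfl⟩)
    intro p hp
    rw [← h4] at hp
    exact (h0 p hp).2
  let I : ModuleCat.{u} B := ModuleCat.of B (LinearMap.range f)
  let C' : ModuleCat.{u} B := ModuleCat.of B C
  have hC' : Module.Finite B C' := inferInstanceAs (Module.Finite B C)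
  have hI : Module.Finite B I := inferInstanceAs (Module.Finite B (LinearMap.range f))
  have hIC := finite_hom (F := F) hI hC'
  have hPC := finite_hom (F := F) hP' hC'
  have h1 : Function.Surjective (Linear.leftComp F C' (ModuleCat.ofHom f.rangeRestrict : P ⟶ I)) := by
    intro g
    refine ⟨ModuleCat.ofHom ((LinearMap.ker f).liftQ g.hom (hker g.hom) ∘ₗ
      f.quotKerEquivRange.symm.toLinearMap), ModuleCat.hom_ext (LinearMap.ext fun p => ?_)⟩
    change (LinearMap.ker f).liftQ g.hom (hker g.hom) (f.quotKerEquivRange.symm (f.rangeRestrict p)) =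
      g.hom p
    have : f.rangeRestrict p = f.quotKerEquivRange (Submodule.Quotient.mk p) := rfl
    rw [this, LinearEquiv.symm_apply_apply]
    rfl
  let π : P' ⟶ I := ModuleCat.ofHom (Submodule.projectionOnto _ C hC ∘ₗ q)
  have h2 : Function.Injective (Linear.leftComp F C' π) := by
    intro a b hab
    refine ModuleCat.hom_ext (LinearMap.ext fun x => ?_)
    obtain ⟨y, hy⟩ := hq x.1
    have hx : π.hom y = x := by
      change Submodule.projectionOnto _ C hC (q y) = x
      rw [hy]
      exact Submodule.projectionOnto_apply_left hC x
    rw [← hx]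
    exact congrArg (fun g : P' ⟶ C' => g.hom y) hab
  have h3 : Module.finrank F (I ⟶ C') = Module.finrank F (P' ⟶ C') :=
    le_antisymm (LinearMap.finrank_le_finrank_of_injective h2)
      ((h C' hC').trans (LinearMap.finrank_le_finrank_of_surjective h1))
  have h4 := (LinearMap.injective_iff_surjective_of_finrank_eq_finrank h3).1 h2
  obtain ⟨k, hk⟩ := h4 (ModuleCat.ofHom (Submodule.projectionOnto C _ hC.symm ∘ₗ q))
  -- An element c of C lifts to some y in P'. The projection to I kills c, hence so does the
  -- projection to C, which factors through it; but the latter fixes c.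
  have h5 : C = ⊥ := by
    refine (Submodule.eq_bot_iff C).2 fun c hc => ?_
    obtain ⟨y, hy⟩ := hq c
    have h6 : k.hom (Submodule.projectionOnto _ C hC (q y)) =
        Submodule.projectionOnto C _ hC.symm (q y) :=
      congrArg (fun g : P' ⟶ C' => g.hom y) hk
    rw [hy, (Submodule.projectionOnto_apply_eq_zero_iff hC).2 hc, map_zero,
      Submodule.projectionOnto_apply_left hC.symm ⟨c, hc⟩] at h6
    exact congrArg Subtype.val h6.symm
  refine ⟨f, LinearMap.range_eq_top.1 ?_⟩
  rw [h5] at hC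
  simpa using hC.sup_eq_top

/-- Nakayama's lemma: a surjection onto P'/rad P' lifts to P' because P is projective, and a proper
image of the lift would lie in a maximal submodule, which also contains the radical. -/
theorem exists_surjective_of_projective {P P' : ModuleCat.{u} B} (hP : IsKind .proj B P)
    (hP' : Module.Finite B P') (h : ∀ M : ModuleCat.{u} B, Module.Finite B M →
      Module.finrank F (P' ⟶ M) ≤ Module.finrank F (P ⟶ M)) :
    ∃ f : P →ₗ[B] P', Function.Surjective f := by
  have hB : IsArtinianRing B := IsArtinianRing.of_finite F B
  let J := Module.jacobson B P'
  let T : ModuleCat.{u} B := ModuleCat.of B (P' ⧸ J)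
  have hT : Module.Finite B T := inferInstanceAs (Module.Finite B (P' ⧸ J))
  have hs : IsSemisimpleModule B T := (IsArtinian.isSemisimpleModule_iff_jacobson B (P' ⧸ J)).2
    (Module.jacobson_quotient_jacobson B P')
  obtain ⟨f, hf⟩ := exists_surjective_of_finrank_hom_le (F := F) (T := T) hP.1 hT J.mkQ hP'
    J.mkQ_surjective h
  have := hP.2
  obtain ⟨g, hg⟩ := Module.projective_lifting_property J.mkQ f J.mkQ_surjective
  refine ⟨g, LinearMap.range_eq_top.1 ?_⟩
  by_contra hne
  obtain ⟨m, hm, hle⟩ := (eq_top_or_exists_le_coatom (LinearMap.range g)).resolve_left hne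
  refine hm.1 (eq_top_iff.2 fun x _ => ?_)
  obtain ⟨p, hp⟩ := hf (J.mkQ x)
  have h1 : x - g p ∈ J := by
    rw [← J.ker_mkQ, LinearMap.mem_ker, map_sub, ← hp, ← hg, LinearMap.comp_apply, sub_self]
  have h2 : J ≤ m := sInf_le hm
  have h3 := m.add_mem (h2 h1) (hle ⟨p, rfl⟩)
  rwa [sub_add_cancel] at h3

/-- Surjections in both directions force equal dimensions over `F`, and then each surjection is
bijective. -/
theorem nonempty_linearEquiv_of_finrank_hom_eq {P P' : ModuleCat.{u} B} (hP : IsKind .proj B P)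
    (hP' : IsKind .proj B P') (h : ∀ M : ModuleCat.{u} B, Module.Finite B M →
      Module.finrank F (P ⟶ M) = Module.finrank F (P' ⟶ M)) : Nonempty (P ≃ₗ[B] P') := by
  obtain ⟨f, hf⟩ := exists_surjective_of_projective (F := F) hP hP'.1 fun M hM => (h M hM).ge
  obtain ⟨g, hg⟩ := exists_surjective_of_projective (F := F) hP' hP.1 fun M hM => (h M hM).le
  have h1 := (finite_base_iff (F := F) P).2 hP.1
  have h2 := (finite_base_iff (F := F) P').2 hP'.1
  have h3 : Module.finrank F P = Module.finrank F P' :=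
    le_antisymm (LinearMap.finrank_le_finrank_of_surjective (f := g.restrictScalars F) hg)
      (LinearMap.finrank_le_finrank_of_surjective (f := f.restrictScalars F) hf)
  exact ⟨LinearEquiv.ofBijective f
    ⟨(LinearMap.injective_iff_surjective_of_finrank_eq_finrank (f := f.restrictScalars F) h3).2 hf,
      hf⟩⟩

end ProjectiveIso

/-! ### Hom spaces between external tensor products -/

section Curry

variable {F : Type u} [Field F] {R S : Type u} [Ring R] [Algebra F R] [Ring S] [Algebra F S]

theorem indMap_smul (φ : R →ₐ[F] S) {N N' : ModuleCat.{u} R} (c : F) (f : N ⟶ N')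
    (x : IndMod φ N) : indMap φ (c • f).hom x = algebraMap F S c • indMap φ f.hom x := by
  revert x
  refine DFunLike.congr_fun (f := (indMap φ (c • f).hom).toAddMonoidHom)
    (g := (LinearMap.toAddMonoidHom (indMap φ f.hom)).comp
      (DistribSMul.toAddMonoidHom (IndMod φ N) (algebraMap F S c)))
    (indMod_hom_ext φ fun s n => ?_) |> fun h x => (h x).trans (map_smul (indMap φ f.hom) _ x)
  change indTmul φ s (algebraMap F R c • f.hom n) = indMap φ f.hom (algebraMap F S c • indTmul φ s n)
  rw [smul_indTmul, indTmul_smul, indMap_tmul, φ.commutes, Algebra.commutes]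

/-- The homomorphism `m ↦ (n ↦ f(m ⊗ n))`. -/
noncomputable def curryHom {M : ModuleCat.{u} R} {N : ModuleCat.{u} S}
    {Y : ModuleCat.{u} (R ⊗[F] S)} (f : ExtTensor F M N →ₗ[R ⊗[F] S] Y) :
    M →ₗ[R] PHom N Y where
  toFun m :=
    { toFun := fun n => f (extTmul F m n)
      map_add' := fun n n' => (congrArg f (TensorProduct.tmul_add m n n')).trans (map_add f _ _)
      map_smul' := fun s n =>
        (congrArg f (one_tmul_smul_extTmul (R := R) s m n).symm).trans (map_smul f _ _) }
  map_add' m m' := LinearMap.ext fun n =>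
    (congrArg f (TensorProduct.add_tmul m m' n)).trans (map_add f _ _)
  map_smul' r m := LinearMap.ext fun n =>
    (congrArg f (tmul_one_smul_extTmul (S := S) r m n).symm).trans (map_smul f _ _)

/-- The adjunction isomorphism `Hom_{R ⊗ S}(M ⊗ N, Y) → Hom_R(M, Hom_S(N, Y))`. -/
noncomputable def curryMap (M : ModuleCat.{u} R) (N : ModuleCat.{u} S)
    (Y : ModuleCat.{u} (R ⊗[F] S)) :
    ((extF (F := F) M).obj N ⟶ Y) →ₗ[F] (M ⟶ (homF N).obj Y) where
  toFun f := ModuleCat.ofHom (curryHom f.hom)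
  map_add' f g := rfl
  map_smul' c f := by
    refine ModuleCat.hom_ext (LinearMap.ext fun m => LinearMap.ext fun n => ?_)
    rfl

theorem curryMap_bijective (M : ModuleCat.{u} R) (N : ModuleCat.{u} S)
    (Y : ModuleCat.{u} (R ⊗[F] S)) : Function.Bijective (curryMap M N Y) := by
  constructor
  · intro f g h
    refine ModuleCat.hom_ext (LinearMap.toAddMonoidHom_injective (extTensor_hom_ext fun m n => ?_))
    exact congrArg (fun q : M ⟶ (homF N).obj Y => (show PHom N Y from q.hom m) n) h
  · intro g
    let g' : M →ₗ[R] PHom N Y := g.hom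
    let β : M →+ N →+ Y := AddMonoidHom.mk' (fun m => (g' m).toAddMonoidHom) fun m m' =>
      AddMonoidHom.ext fun n => DFunLike.congr_fun (F := PHom N Y) (map_add g' m m') n
    have hβ : ∀ (r : R) (s : S) m n, β (r • m) (s • n) =
        AlgHom.id F (R ⊗[F] S) (r ⊗ₜ s) • β m n := by
      intro r s m n
      have h1 : g' (r • m) (s • n) = (r ⊗ₜ[F] (1 : S)) • g' m (s • n) :=
        DFunLike.congr_fun (F := PHom N Y) (map_smul g' r m) (s • n)
      have h2 : g' m (s • n) = ((1 : R) ⊗ₜ[F] s) • g' m n := LinearMap.map_smulₛₗ (g' m) s n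
      refine h1.trans ?_
      rw [h2, smul_smul, Algebra.TensorProduct.tmul_mul_tmul, mul_one, one_mul]
      rfl
    refine ⟨ModuleCat.ofHom
      { toFun := extLift (AlgHom.id F (R ⊗[F] S)) β hβ
        map_add' := map_add _
        map_smul' := extLift_smul (AlgHom.id F (R ⊗[F] S)) β hβ }, ?_⟩
    rfl

/-- Currying identifies the Hom space with Hom(P, Hom(Q, M ⊗ N)), and the inner Hom has class dim
Hom(Q, N) · [M]. Pairing with [P] gives the product of dimensions. -/
theorem finrank_hom_ext [Module.Finite F R] [Module.Finite F S] {P M : ModuleCat.{u} R}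
    {Q N : ModuleCat.{u} S} (hP : IsKind .proj R P) (hQ : IsKind .proj S Q) (hM : IsKind .fg R M)
    (hN : IsKind .fg S N) :
    Module.finrank F ((extF (F := F) P).obj Q ⟶ (extF (F := F) M).obj N) =
      Module.finrank F (P ⟶ M) * Module.finrank F (Q ⟶ N) := by
  rw [(LinearEquiv.ofBijective _ (curryMap_bijective P Q ((extF (F := F) M).obj N))).finrank_eq]
  have h := finite_homF Q ((extF (F := F) M).obj N) hQ.1 (finite_ext M N hM hN)
  have h1 := congrArg (pairing F R (Groth.mk P hP)) (Groth.mk_homF_ext hQ hN hM h)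
  rw [map_zsmul] at h1
  rw [← Nat.cast_inj (R := ℤ), Nat.cast_mul, mul_comm]
  exact h1

/-- Used to see that the twists by the ψ_n preserve projectivity. -/
theorem leftProjective_of_bijective (φ : R →ₐ[F] S) (h : Function.Bijective φ) :
    LeftProjective φ :=
  Module.Projective.of_equiv (R := R) (M := R) (LinearEquiv.ofBijective
    ({ toFun := φ
       map_add' := map_add φ
       map_smul' := map_mul φ } : R →ₗ[R] (resF φ).obj (ModuleCat.of S S)) h)

end Curry

/-! ### Objects concentrated in one degree -/

section Single

variable {ι : Type} [DecidableEq ι] {R : ι → Type u} [∀ i, Ring (R i)]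

/-- The graded module with component `M` in degree `i` and zero in all other degrees. -/
noncomputable def singleObj (i : ι) (M : ModuleCat.{u} (R i)) : ∀ j, ModuleCat.{u} (R j) :=
  Function.update (fun j => ModuleCat.of (R j) PUnit.{u+1}) i M

theorem singleObj_induction {p : ∀ j, ModuleCat.{u} (R j) → Prop} (i : ι) (M : ModuleCat.{u} (R i))
    (h : p i M) (h0 : ∀ j, p j (ModuleCat.of (R j) PUnit.{u+1})) (j : ι) :
    p j (singleObj i M j) := by
  by_cases hj : j = i
  · subst hj
    rw [singleObj, Function.update_self]
    exact h
  · rw [singleObj, Function.update_of_ne hj]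
    exact h0 j

theorem isKind_singleObj {c : ModKind} (i : ι) {M : ModuleCat.{u} (R i)} (h : IsKind c (R i) M)
    (j : ι) : IsKind c (R j) (singleObj i M j) :=
  singleObj_induction (p := fun j X => IsKind c (R j) X) i M h (fun j => isKind_punit c (R j)) j

theorem subsingleton_singleObj {i j : ι} (M : ModuleCat.{u} (R i)) (h : j ≠ i) :
    Subsingleton (singleObj i M j) := by
  rw [singleObj, Function.update_of_ne h]
  exact inferInstanceAs (Subsingleton PUnit.{u+1})

/-- The object `M` in degree `i`. -/
noncomputable def single (i : ι) (M : ModuleCat.{u} (R i)) (h : Module.Finite (R i) M) : GrMod R :=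
  ⟨singleObj i M, isKind_singleObj (c := .fg) i h, (Set.finite_singleton i).subset fun j hj => by
    by_contra hne
    exact not_nontrivial_iff_subsingleton.2 (subsingleton_singleObj M hne) hj⟩

theorem grCls_single {c : ModKind} (i : ι) (M : ModuleCat.{u} (R i)) (hf : Module.Finite (R i) M)
    (h : IsKind c (R i) M) : grCls c (single i M hf) (isKind_singleObj i h) =
      lof ℤ ι (fun i => Groth c (R i)) i (Groth.mk M h) := by
  refine (grCls_ext _ fun j => ?_).symm
  by_cases hj : j = i
  · subst hj
    rw [DirectSum.component.lof_self]
    exact Groth.mk_congr _ _ (eqToIso (Function.update_self j M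
      (fun j => ModuleCat.of (R j) PUnit.{u+1})).symm).toLinearEquiv
  · refine (DirectSum.component.of ..).trans ((dif_neg (Ne.symm hj)).trans ?_)
    exact (Groth.mk_subsingleton _ (subsingleton_singleObj M hj)).symm

end Single

/-! ### The adjunction as an isomorphism of vector spaces -/

namespace Tower

variable {F : Type u} [Field F] (T : Tower F) {ψ : ∀ n, T.A n ≃ₐ[F] T.A n}

section Adjoint

variable (adj : T.conjDelta ψ ⊣ T.nabla)

/-- Through the unit, the adjunction bijection is expressed by the functor Ind, which is `F`-linear
on morphisms. This makes it an isomorphism of vector spaces and allows dimensions to be compared. -/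
theorem homEquiv_apply (P : T.Md) (Z : T.Md₂) (f : ∀ j, ((T.conjDelta ψ).obj P).obj j ⟶ Z.obj j)
    (k : ℕ) (x : P.obj k) (j : {j // T.mult.g j = k}) :
    (show ∀ j : {j // T.mult.g j = k}, IndMod (T.mult.hom j.2) (Z.obj j.1) from
      ((adj.homEquiv P Z (ObjectProperty.homMk f)).hom k).hom x) j =
      indMap (T.mult.hom j.2) (f j.1).hom (T.unitApp adj P ⟨k, j⟩ x) := by
  rw [Adjunction.homEquiv_unit]
  rfl

/-- The adjunction isomorphism as a linear map. -/
noncomputable def adjLinear (P : T.Md) (Z : T.Md₂) :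
    (∀ j, ((T.conjDelta ψ).obj P).obj j ⟶ Z.obj j) →ₗ[F]
      ∀ k, P.obj k ⟶ (T.nabla.obj Z).obj k where
  toFun f := (adj.homEquiv P Z (ObjectProperty.homMk f)).hom
  map_add' f g := by
    funext k
    refine ModuleCat.hom_ext (LinearMap.ext fun x => funext fun j : {j // T.mult.g j = k} => ?_)
    refine (T.homEquiv_apply adj P Z _ k x j).trans ?_
    refine (LinearMap.congr_fun (indMap_add (T.mult.hom j.2) (f j.1).hom (g j.1).hom) _).trans ?_
    exact congrArg₂ (· + ·) (T.homEquiv_apply adj P Z f k x j).symm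
      (T.homEquiv_apply adj P Z g k x j).symm
  map_smul' c f := by
    funext k
    refine ModuleCat.hom_ext (LinearMap.ext fun x => funext fun j : {j // T.mult.g j = k} => ?_)
    refine (T.homEquiv_apply adj P Z _ k x j).trans ?_
    refine (indMap_smul (T.mult.hom j.2) c (f j.1) _).trans ?_
    exact congrArg (algebraMap F (T.A k) c • ·) (T.homEquiv_apply adj P Z f k x j).symm

theorem adjLinear_bijective (P : T.Md) (Z : T.Md₂) : Function.Bijective (T.adjLinear adj P Z) := by
  constructor
  · intro f g h
    have h1 := (adj.homEquiv P Z).injective (ObjectProperty.hom_ext _ h)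
    exact congrArg (fun q : (T.conjDelta ψ).obj P ⟶ Z => q.hom) h1
  · intro g
    obtain ⟨f, hf⟩ := (adj.homEquiv P Z).surjective (ObjectProperty.homMk g)
    exact ⟨f.hom, congrArg (fun q : P ⟶ T.nabla.obj Z => q.hom) hf⟩

end Adjoint

theorem isProj_conjDelta {P : T.Md} (hP : IsProj T.A P) :
    IsProj T.A₂ ((T.conjDelta ψ).obj P) := fun p =>
  projective_resF (leftProjective_of_bijective _
      (TensorProduct.map_bijective (ψ p.1).symm.bijective (ψ p.2).symm.bijective)) _
    (projective_resF (T.left_projective rfl) _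
      (projective_resF (leftProjective_of_bijective _ (ψ (p.1 + p.2)).bijective) _ (hP (p.1 + p.2))))

theorem isProj_delta {P : T.Md} (hP : IsProj T.A P) : IsProj T.A₂ (T.delta.obj P) := fun _ =>
  projective_resF (T.left_projective rfl) _ (hP _)

end Tower

/-! ### Dependence of Hom(P, -) on P -/

section GrHom

variable {ι κ : Type} {F : Type u} [Field F]
variable {R : ι → Type u} [∀ i, Ring (R i)] [∀ i, Algebra F (R i)] [∀ i, Module.Finite F (R i)]
variable {S : κ → Type u} [∀ i, Ring (S i)] [∀ i, Algebra F (S i)] [∀ i, Module.Finite F (S i)]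

/-- Precomposition with an isomorphism `P ≅ P'`. -/
noncomputable def homFCongr {A B : Type u} [Ring A] [Algebra F A] [Ring B] [Algebra F B]
    {P P' : ModuleCat.{u} B} (e : P ≃ₗ[B] P') (Y : ModuleCat.{u} (A ⊗[F] B)) :
    PHom P Y ≃ₗ[A] PHom P' Y where
  toFun f := f.comp e.symm.toLinearMap
  invFun f := f.comp e.toLinearMap
  left_inv f := LinearMap.ext fun p => congrArg f (e.symm_apply_apply p)
  right_inv f := LinearMap.ext fun p => congrArg f (e.apply_symm_apply p)
  map_add' _ _ := rfl
  map_smul' _ _ := rfl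

/-- Any choice of isomorphisms in the separate degrees will do: precomposition with them is natural
in Y, and no compatibility between degrees is needed. -/
theorem nonempty_grHom_iso {P P' : GrMod S} (e : ∀ j, Nonempty (P.obj j ≃ₗ[S j] P'.obj j)) :
    Nonempty (grHom (R := R) (F := F) P ≅ grHom P') :=
  nonempty_natIso (fun Y i => LinearEquiv.piCongrRight fun j =>
    homFCongr (e j).some (Y.obj (i, j))) fun _ _ _ => rfl

end GrHom

/-! ### Removing the conjugation for dualizing towers -/

namespace Tower

variable {F : Type u} [Field F] (T : Tower F) {ψ : ∀ n, T.A n ≃ₐ[F] T.A n}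

theorem nonempty_res₂_iso {Q Q' : T.Md₂} (e : ∀ p, Nonempty (Q.obj p ≃ₗ[T.A₂ p] Q'.obj p)) :
    Nonempty (T.Res₂ Q ≅ T.Res₂ Q') := by
  obtain ⟨e⟩ := nonempty_grHom_iso (F := F) (R := T.A₂) e
  exact ⟨Functor.isoWhiskerLeft T.delta₂ (Functor.isoWhiskerLeft T.s₂₃ e)⟩

/-- Dimensions of Hom spaces are multiplicative under ⊗ by `finrank_hom_ext`, and distinct degrees
are orthogonal on both sides. -/
theorem grPairing_grothExt : (grPairing F T.A₂).compl₁₂ (T.grothExt .proj) (T.grothExt .fg) =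
    tensorPairing T.pair := by
  refine groth_tensor_hom_ext fun i P hP j Q hQ => groth_tensor_hom_ext fun k M hM l N hN => ?_
  have h1 := T.grothExt_tmul_lof (Groth.mk P hP) (Groth.mk Q hQ)
  have h2 := T.grothExt_tmul_lof (Groth.mk M hM) (Groth.mk N hN)
  refine (congrArg₂ (fun a b => grPairing F T.A₂ a b) h1 h2).trans ?_
  have h3 : tensorPairing T.pair (lof ℤ ℕ (fun n => K₀ (T.A n)) i (Groth.mk P hP) ⊗ₜ
      lof ℤ ℕ (fun n => K₀ (T.A n)) j (Groth.mk Q hQ)) (lof ℤ ℕ (fun n => G₀ (T.A n)) k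
        (Groth.mk M hM) ⊗ₜ lof ℤ ℕ (fun n => G₀ (T.A n)) l (Groth.mk N hN)) =
      grPairing F T.A (lof ℤ ℕ (fun n => K₀ (T.A n)) i (Groth.mk P hP))
        (lof ℤ ℕ (fun n => G₀ (T.A n)) k (Groth.mk M hM)) *
      grPairing F T.A (lof ℤ ℕ (fun n => K₀ (T.A n)) j (Groth.mk Q hQ))
        (lof ℤ ℕ (fun n => G₀ (T.A n)) l (Groth.mk N hN)) := rfl
  refine Eq.trans ?_ h3.symm
  by_cases hik : i = k
  · by_cases hjl : j = l
    · subst hik hjl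
      rw [grPairing_lof_lof, grPairing_lof_lof, grPairing_lof_lof]
      exact (congrArg Nat.cast (finrank_hom_ext (F := F) hP hQ hM hN)).trans (Nat.cast_mul _ _)
    · rw [grPairing_lof_lof_ne hjl, mul_zero]
      exact grPairing_lof_lof_ne (F := F) (R := T.A₂) (fun h => hjl (congrArg Prod.snd h)) _ _
  · rw [grPairing_lof_lof_ne hik, zero_mul]
    exact grPairing_lof_lof_ne (F := F) (R := T.A₂) (fun h => hik (congrArg Prod.fst h)) _ _

theorem grothDelta_clsK {P : T.Md} (hP : IsProj T.A P) :
    T.grothDelta .proj (clsK P hP) = clsK (T.delta.obj P) (T.isProj_delta hP) :=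
  T.grothDelta_grCls (c := .proj) (X := P) fun i => ⟨P.property.1 i, hP i⟩

/-- This is the Hopf pairing axiom ⟨x, ab⟩ = ⟨Δx, a ⊗ b⟩, moved to classes over `T.A₂` by the
isomorphism `grothExt`. -/
theorem pair_grothNabla (hD : T.IsDualizing) {P : T.Md} (hP : IsProj T.A P) (z : T.Gr₂ .fg) :
    T.pair (clsK P hP) (T.grothNabla .fg z) =
      grPairing F T.A₂ (clsK (T.delta.obj P) (T.isProj_delta hP)) z := by
  obtain ⟨w, rfl⟩ := (T.grothExt_bijective hD.plus.isBialgebra).2 z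
  rw [← T.grothDelta_clsK hP, ← T.grothExt_comul hD.minus.isBialgebra]
  have h1 := LinearMap.congr_fun₂ T.grPairing_grothExt ((T.ops .proj).comul (clsK P hP)) w
  refine Eq.trans ?_ h1.symm
  clear h1
  induction w using TensorProduct.induction_on with
  | zero => simp only [map_zero]
  | tmul a b => exact hD.hopf.mul_right _ a b
  | add a b ha hb => rw [map_add, map_add, map_add, map_add, ha, hb]

/-- The pairing of either module with [M] equals dim Hom(P, ∇M): by the adjunction for the
conjugated coproduct, and by `pair_grothNabla` for Δ(P). Projective modules with equal Hom
dimensions are isomorphic. -/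
theorem nonempty_conjDelta_equiv (hT : T.IsStrongWith ψ) (hD : T.IsDualizing) {P : T.Md}
    (hP : IsProj T.A P) (p : ℕ × ℕ) :
    Nonempty (((T.conjDelta ψ).obj P).obj p ≃ₗ[T.A₂ p] (T.delta.obj P).obj p) := by
  obtain ⟨adj⟩ := hT.adjoint
  let Q := (T.conjDelta ψ).obj P
  have hQ : IsProj T.A₂ Q := T.isProj_conjDelta hP
  refine nonempty_linearEquiv_of_finrank_hom_eq (F := F) ⟨Q.property.1 p, hQ p⟩
    ⟨(T.delta.obj P).property.1 p, T.isProj_delta hP p⟩ fun M hM => ?_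
  -- Placing M in the single degree p isolates the component at p in the graded pairings.
  let Z : T.Md₂ := single p M hM
  have hZ : clsG Z = lof ℤ (ℕ × ℕ) (fun p => G₀ (T.A₂ p)) p (Groth.mk M hM) :=
    grCls_single (c := .fg) p M hM hM
  have h1 : grPairing F T.A₂ (clsK Q hQ) (clsG Z) =
      grPairing F T.A₂ (clsK (T.delta.obj P) (T.isProj_delta hP)) (clsG Z) := by
    rw [grPairing_clsK_clsG,
      (LinearEquiv.ofBijective _ (T.adjLinear_bijective adj P Z)).finrank_eq,
      ← pair_grothNabla T hD]
    refine (grPairing_clsK_clsG hP (T.nabla.obj Z)).symm.trans ?_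
    exact congrArg (T.pair (clsK P hP)) (T.grothNabla_grCls (c := .fg) (Z := Z) Z.property.1).symm
  rw [hZ, grPairing_clsK_lof, grPairing_clsK_lof] at h1
  exact Nat.cast_injective (R := ℤ) h1

theorem nonempty_cross_delta_iso (hT : T.IsStrongWith ψ) (hD : T.IsDualizing) (M P : T.Md)
    (hP : IsProj T.A P) :
    Nonempty (T.Ind M ⋙ T.Res P ≅ T.ext M ⋙ T.Res₂ (T.delta.obj P) ⋙ T.nabla) := by
  obtain ⟨e⟩ := T.nonempty_cross_iso hT M P hP
  obtain ⟨e'⟩ := T.nonempty_res₂_iso (T.nonempty_conjDelta_equiv hT hD hP)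
  exact ⟨e ≪≫ Functor.isoWhiskerLeft (T.ext M) (Functor.isoWhiskerRight e' T.nabla)⟩

end Tower

/-! ### Projectivity of Hom(P, Y) -/

section ProjectiveHom

variable {F : Type u} [Field F] {R S : Type u} [Ring R] [Algebra F R] [Ring S] [Algebra F S]

theorem leftProjective_includeLeft :
    LeftProjective (Algebra.TensorProduct.includeLeft : R →ₐ[F] R ⊗[F] S) := by
  have h : ∀ (r : R) (x : R ⊗[F] S), r • x = (r ⊗ₜ[F] (1 : S)) * x := by
    intro r x
    induction x using TensorProduct.induction_on with
    | zero => rw [smul_zero, mul_zero]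
    | tmul a s => rw [TensorProduct.smul_tmul', Algebra.TensorProduct.tmul_mul_tmul, one_mul,
        smul_eq_mul]
    | add x y hx hy => rw [smul_add, mul_add, hx, hy]
  exact Module.Projective.of_equiv (R := R) (M := R ⊗[F] S)
    ({ toFun := fun x => x
       invFun := fun x => x
       left_inv := fun _ => rfl
       right_inv := fun _ => rfl
       map_add' := fun _ _ => rfl
       map_smul' := h } : R ⊗[F] S ≃ₗ[R]
        (resF (Algebra.TensorProduct.includeLeft : R →ₐ[F] R ⊗[F] S)).obj
          (ModuleCat.of (R ⊗[F] S) (R ⊗[F] S)))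

/-- Evaluation at a dual basis (e_t, d_t) embeds Hom(P, Y) in Yⁿ, split by y ↦ (a ↦ Σ d_t(a) y_t).
As an `R`-module Y is projective because `R ⊗ S` is. -/
theorem projective_homF {P : ModuleCat.{u} S} (hP : IsKind .proj S P)
    {Y : ModuleCat.{u} (R ⊗[F] S)} (hY : Module.Projective (R ⊗[F] S) Y) :
    Module.Projective R (PHom P Y) := by
  obtain ⟨n, e, d, hd⟩ := exists_dual_basis P hP.1 hP.2
  let Y' : ModuleCat.{u} R :=
    (resF (Algebra.TensorProduct.includeLeft : R →ₐ[F] R ⊗[F] S)).obj Y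
  have hY' : Module.Projective R Y' := projective_resF leftProjective_includeLeft Y hY
  have hpi : Module.Projective R (Fin n → Y') :=
    projective_pi (V := fun _ => Y') (fun _ => hY') (Set.toFinite _)
  let i : PHom P Y →ₗ[R] (Fin n → Y') :=
    { toFun := fun f t => f (e t)
      map_add' := fun _ _ => rfl
      map_smul' := fun _ _ => rfl }
  let θ : (Fin n → Y) → PHom P Y := fun y =>
    { toFun := fun a => ∑ t, ((1 : R) ⊗ₜ[F] d t a) • y t
      map_add' := fun a b => by
        simp only [map_add, TensorProduct.tmul_add, add_smul, Finset.sum_add_distrib]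
      map_smul' := fun s a => by
        rw [Finset.smul_sum]
        refine Finset.sum_congr rfl fun t _ => ?_
        rw [map_smul, smul_smul]
        congr 1
        simp }
  let p : (Fin n → Y') →ₗ[R] PHom P Y :=
    { toFun := θ
      map_add' := fun y z => LinearMap.ext fun a => by
        change ∑ t, ((1 : R) ⊗ₜ[F] d t a) • ((show Y from y t) + (show Y from z t)) =
          ∑ t, ((1 : R) ⊗ₜ[F] d t a) • (show Y from y t) +
            ∑ t, ((1 : R) ⊗ₜ[F] d t a) • (show Y from z t)
        rw [← Finset.sum_add_distrib]
        exact Finset.sum_congr rfl fun t _ => smul_add _ _ _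
      map_smul' := fun r y => LinearMap.ext fun a => by
        change ∑ t, ((1 : R) ⊗ₜ[F] d t a) • (r ⊗ₜ[F] (1 : S)) • (show Y from y t) =
          (r ⊗ₜ[F] (1 : S)) • ∑ t, ((1 : R) ⊗ₜ[F] d t a) • (show Y from y t)
        rw [Finset.smul_sum]
        refine Finset.sum_congr rfl fun t _ => ?_
        rw [smul_smul, smul_smul]
        congr 1
        simp }
  refine Module.Projective.of_split i p (LinearMap.ext fun f => LinearMap.ext fun a => ?_)
  change ∑ t, ((1 : R) ⊗ₜ[F] d t a) • f (e t) = f a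
  conv_rhs => rw [← hd a, map_sum]
  exact Finset.sum_congr rfl fun t _ => (LinearMap.map_smulₛₗ f (d t a) (e t)).symm

end ProjectiveHom

/-! ### The classes of projective objects generate 𝒦(A) -/

section Span

variable {ι : Type} [DecidableEq ι] {R : ι → Type u} [∀ i, Ring (R i)]

theorem clsK_hom_ext {L : Type*} [AddCommGroup L] {f g : (⨁ i, K₀ (R i)) →ₗ[ℤ] L}
    (h : ∀ X hX, f (clsK X hX) = g (clsK X hX)) : f = g := by
  refine groth_hom_ext fun i X hX => ?_
  have h1 := grCls_single (c := .proj) i X hX.1 hX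
  rw [← h1]
  exact h (single i X hX.1) fun j => (isKind_singleObj (c := .proj) i hX j).2

end Span

/-! ### Categorification of the Fock space and of its projective part -/

namespace Tower

variable {F : Type u} [Field F] (T : Tower F)

theorem isProj_ind {M : T.Md} (hM : IsProj T.A M) {X : T.Md} (hX : IsProj T.A X) :
    IsProj T.A ((T.Ind M).obj X) := fun k =>
  (T.isKind_nabla (c := .proj) (T.isKind_ext (fun i => ⟨M.property.1 i, hM i⟩)
    (fun i => ⟨X.property.1 i, hX i⟩)) k).2

theorem isProj_res {P : T.Md} (hP : IsProj T.A P) {X : T.Md} (hX : IsProj T.A X) :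
    IsProj T.A ((T.Res P).obj X) := fun i => by
  refine projective_pi (V := fun j => PHom (P.obj j) ((T.delta.obj X).obj (i, j)))
    (fun j => projective_homF ⟨P.property.1 j, hP j⟩ (T.isProj_delta hX (i, j)))
    (P.property.2.subset fun j hj => ?_)
  by_contra hne
  have hj' : Subsingleton (P.obj j) := not_nontrivial_iff_subsingleton.1 hne
  refine not_nontrivial_iff_subsingleton.2 ⟨fun f g => LinearMap.ext fun p => ?_⟩ hj
  rw [Subsingleton.elim p 0, map_zero, map_zero]

theorem mul_clsG (M X : T.Md) :
    (T.ops .fg).mul (clsG M) (clsG X) = clsG ((T.Ind M).obj X) :=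
  T.mul_grCls (c := .fg) M.property.1 X.property.1

theorem regAct_mul (hD : T.IsDualizing) (x : T.K) (a : T.G) :
    T.regAct x * (T.ops .fg).mul a = T.crossAct x a :=
  LinearMap.ext fun c => leftReg_cross hD.plus.isBialgebra hD.hopf x a c

theorem categorifiesFock {ψ : ∀ n, T.A n ≃ₐ[F] T.A n} (hT : T.IsStrongWith ψ)
    (hD : T.IsDualizing) : T.CategorifiesFock where
  fock_one := fockAct_one hD.plus.isBialgebra hD.hopf
  fock_mul := fockAct_mul hD.plus.isBialgebra hD.hopf
  ind M X := (T.mul_clsG M X).symm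
  res P hP X := T.clsG_res hD.plus.isBialgebra hP X
  act M P hP X := (T.mul_clsG M _).symm.trans
    (congrArg ((T.ops .fg).mul (clsG M)) (T.clsG_res hD.plus.isBialgebra hP X))
  mul_G M N := (T.mul_clsG M N).symm
  iso_ind := T.nonempty_ind_comp_iso
  mul_K P Q hP hQ := ⟨T.isProj_ind hP hQ, (T.mul_grCls (c := .proj)
    (fun i => ⟨P.property.1 i, hP i⟩) (fun i => ⟨Q.property.1 i, hQ i⟩)).symm⟩
  iso_res P Q _ _ := T.nonempty_res_comp_iso P Q
  rel_cross := T.regAct_mul hD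
  comul_K P hP := ⟨T.isProj_delta hP,
    (T.grothExt_comul hD.minus.isBialgebra _).trans (T.grothDelta_clsK hP)⟩
  cross M P hP X := by
    -- The class of the right-hand functor is computed from the isomorphic functor Res_P ∘ Ind_M,
    -- whose action on classes is already known.
    obtain ⟨e⟩ := T.nonempty_cross_delta_iso hT hD M P hP
    rw [← T.regAct_mul hD]
    refine (grCls_congr (c := .fg) ((T.Ind M ⋙ T.Res P).obj X).property.1
      ((T.ext M ⋙ T.Res₂ (T.delta.obj P) ⋙ T.nabla).obj X).property.1 (e.app X)).symm.trans ?_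
    exact (T.clsG_res hD.plus.isBialgebra hP ((T.Ind M).obj X)).trans
      (congrArg (T.regAct (clsK P hP)) (T.mul_clsG M X).symm)
  iso_cross := T.nonempty_cross_delta_iso hT hD

/-- The Cartan map `𝒦(A) → 𝒢(A)`. -/
noncomputable def cartan : T.K →ₗ[ℤ] T.G := DirectSum.lmap fun n => Groth.cartan (T.A n)

theorem cartan_lof_mk (n : ℕ) (X : ModuleCat.{u} (T.A n)) (hX : IsKind .proj (T.A n) X) :
    T.cartan (lof ℤ ℕ (fun n => K₀ (T.A n)) n (Groth.mk X hX)) =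
      lof ℤ ℕ (fun n => G₀ (T.A n)) n (Groth.mk X hX.1) :=
  DirectSum.lmap_lof _ _ _

theorem cartan_clsK (X : T.Md) (hX : IsProj T.A X) : T.cartan (clsK X hX) = clsG X := by
  refine (map_sum T.cartan _ _).trans ?_
  exact Finset.sum_congr rfl fun i _ => T.cartan_lof_mk i _ _

theorem clsG_mem_gproj (X : T.Md) (hX : IsProj T.A X) : clsG X ∈ T.Gproj :=
  ⟨clsK X hX, T.cartan_clsK X hX⟩

/-- A biadditive map vanishes modulo 𝒢_proj(A) once it does so on classes of projective objects.
Closure properties of 𝒢_proj(A) thereby reduce to functors preserving projectivity. -/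
theorem mem_gproj_of_clsK {f : T.K →ₗ[ℤ] T.K →ₗ[ℤ] T.G}
    (h : ∀ P hP X hX, f (clsK P hP) (clsK X hX) ∈ T.Gproj) (x y : T.K) : f x y ∈ T.Gproj := by
  have h1 : f.compr₂ T.Gproj.mkQ = 0 := clsK_hom_ext fun P hP => clsK_hom_ext fun X hX =>
    (Submodule.Quotient.mk_eq_zero _).2 (h P hP X hX)
  exact (Submodule.Quotient.mk_eq_zero _).1 (LinearMap.congr_fun₂ h1 x y)

theorem mul_mem_gproj {a b : T.G} (ha : a ∈ T.Gproj) (hb : b ∈ T.Gproj) :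
    (T.ops .fg).mul a b ∈ T.Gproj := by
  obtain ⟨x, rfl⟩ := ha
  obtain ⟨y, rfl⟩ := hb
  refine T.mem_gproj_of_clsK (f := (T.ops .fg).mul.compl₁₂ T.cartan T.cartan)
    (fun P hP X hX => ?_) x y
  rw [LinearMap.compl₁₂_apply, cartan_clsK, cartan_clsK, mul_clsG]
  exact T.clsG_mem_gproj _ (T.isProj_ind hP hX)

theorem regAct_mem_gproj (hD : T.IsDualizing) (x : T.K) {a : T.G} (ha : a ∈ T.Gproj) :
    T.regAct x a ∈ T.Gproj := by
  obtain ⟨y, rfl⟩ := ha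
  refine T.mem_gproj_of_clsK (f := T.regAct.compl₂ T.cartan) (fun P hP X hX => ?_) x y
  rw [LinearMap.compl₂_apply, cartan_clsK, ← T.clsG_res hD.plus.isBialgebra]
  exact T.clsG_mem_gproj _ (T.isProj_res hP hX)

theorem tmul_mem_heisProj {a : T.G} (ha : a ∈ T.Gproj) (x : T.K) : a ⊗ₜ x ∈ T.HeisProj :=
  ⟨⟨a, ha⟩ ⊗ₜ x, rfl⟩

theorem heisProj_induction {p : T.Heis → Prop} (h0 : p 0)
    (ht : ∀ a ∈ T.Gproj, ∀ x, p (a ⊗ₜ x)) (ha : ∀ α β, p α → p β → p (α + β)) {α : T.Heis}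
    (hα : α ∈ T.HeisProj) : p α := by
  obtain ⟨w, rfl⟩ := hα
  let f : T.Gproj ⊗[ℤ] T.K →+ T.Heis :=
    (TensorProduct.map T.Gproj.subtype (LinearMap.id : T.K →ₗ[ℤ] T.K)).toAddMonoidHom
  change p (f w)
  induction w using TensorProduct.induction_on with
  | zero => rwa [map_zero]
  | tmul a x => exact ht a.1 a.2 x
  | add v w hv hw =>
    rw [map_add]
    exact ha _ _ hv hw

theorem one_mem_gproj : (T.ops .fg).one ∈ T.Gproj :=
  ⟨(T.ops .proj).one, T.cartan_lof_mk 0 _ _⟩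

/-- Only the left tensor factor is constrained. In Σ a R_{x₍₁₎}^*(c) # x₍₂₎y it stays in 𝒢_proj(A),
which is closed under products and under the operators R^*. -/
theorem hMul_mem_heisProj (hD : T.IsDualizing) {α β : T.Heis} (hα : α ∈ T.HeisProj)
    (hβ : β ∈ T.HeisProj) : T.hMul α β ∈ T.HeisProj := by
  refine T.heisProj_induction (p := fun α => T.hMul α β ∈ T.HeisProj) ?_ (fun a ha x => ?_)
    (fun α α' h h' => ?_) hα
  · rw [map_zero, LinearMap.zero_apply]
    exact zero_mem _
  · refine T.heisProj_induction (p := fun β => T.hMul (a ⊗ₜ x) β ∈ T.HeisProj) ?_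
      (fun c hc y => ?_) (fun β β' h h' => ?_) hβ
    · rw [map_zero]
      exact zero_mem _
    · have h1 : T.hMul (a ⊗ₜ x) (c ⊗ₜ y) = TensorProduct.map ((T.ops .fg).mul a ∘ₗ T.regAct.flip c)
          ((T.ops .proj).mul.flip y) ((T.ops .proj).comul x) := heisMul_tmul a c x y
      rw [h1]
      induction (T.ops .proj).comul x using TensorProduct.induction_on with
      | zero =>
        rw [map_zero]
        exact zero_mem _
      | tmul s t =>
        exact T.tmul_mem_heisProj (T.mul_mem_gproj ha (T.regAct_mem_gproj hD s hc)) _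
      | add v w hv hw =>
        rw [map_add]
        exact add_mem hv hw
    · rw [map_add]
      exact add_mem h h'
  · rw [map_add, LinearMap.add_apply]
    exact add_mem h h'

theorem fock_mem_gproj (hD : T.IsDualizing) {α : T.Heis} (hα : α ∈ T.HeisProj) {v : T.G}
    (hv : v ∈ T.Gproj) : T.fock α v ∈ T.Gproj := by
  refine T.heisProj_induction (p := fun α => T.fock α v ∈ T.Gproj) ?_ (fun a ha x => ?_)
    (fun α α' h h' => ?_) hα
  · rw [map_zero, LinearMap.zero_apply]
    exact zero_mem _
  · exact T.mul_mem_gproj ha (T.regAct_mem_gproj hD x hv)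
  · rw [map_add, LinearMap.add_apply]
    exact add_mem h h'

/-- Projectivity is transported along the crossing isomorphism from Res_P(Ind_M(X)). -/
theorem isProj_cross {ψ : ∀ n, T.A n ≃ₐ[F] T.A n} (hT : T.IsStrongWith ψ) (hD : T.IsDualizing)
    {M P : T.Md} (hM : IsProj T.A M) (hP : IsProj T.A P) {X : T.Md} (hX : IsProj T.A X) :
    IsProj T.A ((T.ext M ⋙ T.Res₂ (T.delta.obj P) ⋙ T.nabla).obj X) := by
  obtain ⟨e⟩ := T.nonempty_cross_delta_iso hT hD M P hP
  exact IsProj.of_iso (e.app X) (T.isProj_res hP (T.isProj_ind hM hX))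

theorem categorifiesProjFock {ψ : ∀ n, T.A n ≃ₐ[F] T.A n} (hT : T.IsStrongWith ψ)
    (hD : T.IsDualizing) : T.CategorifiesProjFock where
  one_mem := T.tmul_mem_heisProj T.one_mem_gproj _
  mul_mem _ hα _ hβ := T.hMul_mem_heisProj hD hα hβ
  fock_mem _ hα _ hv := T.fock_mem_gproj hD hα hv
  cls_mem := T.clsG_mem_gproj
  proj_ind _ hM _ hX := T.isProj_ind hM hX
  proj_res _ hP _ hX := T.isProj_res hP hX
  proj_cross _ _ hM hP _ hX := T.isProj_cross hT hD hM hP hX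
  act M P _ hP X := (T.categorifiesFock hT hD).act M P hP X.obj
  iso_ind M N hM hN := nonempty_restrictProj_iso (Φ := T.Ind N ⋙ T.Ind M)
    (fun _ hX => T.isProj_ind hM (T.isProj_ind hN hX)) _ (T.nonempty_ind_comp_iso M N)
  iso_res P Q hP hQ := nonempty_restrictProj_iso (Φ := T.Res Q ⋙ T.Res P)
    (fun _ hX => T.isProj_res hP (T.isProj_res hQ hX)) _ (T.nonempty_res_comp_iso P Q)
  iso_cross M P hM hP := nonempty_restrictProj_iso (Φ := T.Ind M ⋙ T.Res P)
    (fun _ hX => T.isProj_res hP (T.isProj_ind hM hX)) _ (T.nonempty_cross_delta_iso hT hD M P hP)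

end Tower

end TowerAlg

theorem theorem3 {F : Type*} [Field F] (T : TowerAlg.Tower F) (ψ : ∀ n, T.A n ≃ₐ[F] T.A n)
    (hT : T.IsStrongWith ψ) :
    (∀ M N : T.Md,
      Nonempty (T.Ind N ⋙ T.Ind M ≅ T.Ind (T.nabla.obj ((T.ext M).obj N)))) ∧
    (∀ P Q : T.Md, TowerAlg.IsProj T.A P → TowerAlg.IsProj T.A Q →
      Nonempty (T.Res Q ⋙ T.Res P ≅ T.Res (T.nabla.obj ((T.ext P).obj Q)))) ∧
    (∀ M P : T.Md, TowerAlg.IsProj T.A P →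
      Nonempty (T.Ind M ⋙ T.Res P ≅
        T.ext M ⋙ T.Res₂ ((T.conjDelta ψ).obj P) ⋙ T.nabla)) ∧
    (T.IsDualizing → T.CategorifiesFock ∧ T.CategorifiesProjFock) := by
  exact ⟨T.nonempty_ind_comp_iso, fun P Q _ _ => T.nonempty_res_comp_iso P Q,
    fun M P hP => T.nonempty_cross_iso hT M P hP,
    fun hD => ⟨T.categorifiesFock hT hD, T.categorifiesProjFock hT hD⟩⟩
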